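/- Let $a,\mu>0$, $\gamma>1$, $\delta>0$, $T>0$, $P(\rho)=a\rho^\gamma$, $\mu(\rho)=\mu\rho^\gamma$ and $\varphi'(\rho)=\mu(\rho)/\rho^2$. Consider on $(0,T)\times\mathbb R$ the one-dimensional compressible Navier–Stokes system written with the effective velocity $v=u+\partial_x\varphi(\rho)$: $$\partial_t\rho-\partial_x\Big(\frac{\mu(\rho)}{\rho}\partial_x\rho\Big)+\partial_x(\rho v)=0,\qquad \rho\,\partial_t v+\rho u\,\partial_x v+\partial_xP(\rho)=0,\qquad \rho\ge 0 .$$ Solutions are understood in the sense of distributions, with initial values $\rho_0$ of $\rho$ and $\rho_0v_0$ of $\rho v$. The second equation is taken in the conservative form $\partial_t(\rho v)+\partial_x(\rho uv)+\partial_xP(\rho)=0$. The relation between $u$ and $v$ is taken in the form $\rho v=\rho u+\partial_x\psi(\rho)$, where $\psi(\rho)=\frac{\mu}{\gamma}\rho^\gamma$, so that $\psi'(\rho)=\rho\varphi'(\rho)$; vacuum ($\rho=0$) is allowed. Put $$\mathcal E(\rho,u)(t)=\int_{\mathbb R}\Big(\tfrac12\rho u^2+\tfrac1{\gamma-1}\rho^\gamma\Big)(t,x)\,dx+\int_0^t\!\int_{\mathbb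 R}\mu(\rho)|\partial_xu|^2\,dx\,ds,$$ $$\mathcal E(\rho,v)(t)=\int_{\mathbb R}\Big(\tfrac12\rho v^2+\tfrac1{\gamma-1}\rho^\gamma\Big)(t,x)\,dx+\int_0^t\!\int_{\mathbb R}\partial_xP(\rho)\,\partial_x\varphi(\rho)\,dx\,ds .$$ Here $\partial_xu$ and $\partial_x\varphi(\rho)$ are needed only where $\rho>0$: there $\partial_x\varphi(\rho)=v-u$, and $\partial_xu$ is defined by $\partial_x(\psi(\rho)u)=\psi(\rho)\partial_xu+u\,\partial_x\psi(\rho)$ in the sense of distributions. Let the initial data satisfy $\rho_0\ge0$, $\rho_0\in L^1\cap L^\gamma$, $\sqrt{\rho_0}\,u_0\in L^2$, $\sqrt{\rho_0}\,v_0\in L^2$ and $\rho_0^{1/(2+\delta)}u_0\in L^{2+\delta}$, where $\rho_0v_0=\rho_0u_0+\partial_x\psi(\rho_0)$. Let $\mathcal S$ be the set of solutions $(\rho,v)$ on $[0,T]$, with associated velocity $u$ and these initial data, such that $$\sup_{t\in(0,T)}\|\rho(t,\cdot)\|_{L^1}<\infty,\qquad \sup_{t\in(0,T)}\mathcal E(\rho,u)(t)<\infty,\qquad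 \sup_{t\in(0,T)}\mathcal E(\rho,v)(t)<\infty$$ (essential suprema). If $(\bar\rho,\bar v)\in\mathcal S$, with associated velocity $\bar u$, satisfies $\bar u,\partial_x\bar u,\partial_x\bar v\in L^1(0,T;L^\infty(\mathbb R))$ and $\bar u\in L^\infty((0,T)\times\mathbb R)$, then it is unique in $\mathcal S$: every $(\rho,v)\in\mathcal S$ satisfies $\rho=\bar\rho$ and $\sqrt{\rho}\,v=\sqrt{\bar\rho}\,\bar v$ almost everywhere on $(0,T)\times\mathbb R$. -/

import Mathlib

open MeasureTheory Set
open scoped ENNReal NNReal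

namespace DegenerateNS

/-- The open space-time strip `(0,T) × ℝ`; a point is `z = (t, x)`. -/
def strip (T : ℝ) : Set (ℝ × ℝ) := Ioo 0 T ×ˢ univ

/-- Time derivative of a (smooth) function on space-time. -/
noncomputable def dt (f : ℝ × ℝ → ℝ) (z : ℝ × ℝ) : ℝ := fderiv ℝ f z (1, 0)

/-- Space derivative of a (smooth) function on space-time. -/
noncomputable def dx (f : ℝ × ℝ → ℝ) (z : ℝ × ℝ) : ℝ := fderiv ℝ f z (0, 1)

/-- Test functions in `C_c^∞((0,T) × ℝ)`. -/
def IsTest (T : ℝ) (f : ℝ × ℝ → ℝ) : Prop :=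
  ContDiff ℝ (⊤ : ℕ∞) f ∧ HasCompactSupport f ∧ tsupport f ⊆ strip T

/-- Test functions in `C_c^∞([0,T) × ℝ)`, which need not vanish at `t = 0`. -/
def IsTestInit (T : ℝ) (f : ℝ × ℝ → ℝ) : Prop :=
  ContDiff ℝ (⊤ : ℕ∞) f ∧ HasCompactSupport f ∧ tsupport f ⊆ Iio T ×ˢ univ

/-- `g` is the weak space derivative of `f` on `(0,T) × ℝ`. -/
def HasWeakDx (T : ℝ) (f g : ℝ × ℝ → ℝ) : Prop :=
  LocallyIntegrableOn f (strip T) ∧ LocallyIntegrableOn g (strip T) ∧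
    ∀ η : ℝ × ℝ → ℝ, IsTest T η →
      ∫ z in strip T, f z * dx η z = -∫ z in strip T, g z * η z

/-- `g` is the weak derivative of `f` on the real line. -/
def HasWeakDeriv (f g : ℝ → ℝ) : Prop :=
  LocallyIntegrable f ∧ LocallyIntegrable g ∧
    ∀ η : ℝ → ℝ, ContDiff ℝ (⊤ : ℕ∞) η → HasCompactSupport η →
      ∫ x, f x * deriv η x = -∫ x, g x * η x

/-- Integrability on every `(0,T) × [-R,R]`. -/
def LocInt (T : ℝ) (f : ℝ × ℝ → ℝ) : Prop :=
  ∀ R : ℝ, IntegrableOn f (Ioo 0 T ×ˢ Icc (-R) R)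

/-- `f ∈ L¹(0,T; L^∞(ℝ))`: `|f(t,x)| ≤ b(t)` almost everywhere for some integrable `b`. -/
def MemL1Linfty (T : ℝ) (f : ℝ × ℝ → ℝ) : Prop :=
  AEStronglyMeasurable f (volume.restrict (strip T)) ∧
    ∃ b : ℝ → ℝ, IntegrableOn b (Ioo 0 T) ∧ ∀ᵐ z ∂(volume.restrict (strip T)), |f z| ≤ b z.1

/-- The pressure `P(r) = a r^γ`. -/
noncomputable def pressure (a γ r : ℝ) : ℝ := a * r ^ γ

/-- The viscosity `μ(r) = μ r^γ`. -/
noncomputable def viscosity (μ γ r : ℝ) : ℝ := μ * r ^ γ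

/-- The function `ψ(r) = (μ/γ) r^γ`, with `ψ(0) = 0` and `ψ'(r) = μ(r)/r = r φ'(r)`, where
`φ'(r) = μ(r)/r²`. Thus `∂ₓ ψ(ρ) = (μ(ρ)/ρ) ∂ₓ ρ = ρ ∂ₓ φ(ρ)`, also across the vacuum. -/
noncomputable def fluxPotential (μ γ r : ℝ) : ℝ := μ / γ * r ^ γ

theorem hasDerivAt_fluxPotential {μ γ r : ℝ} (hγ : 1 < γ) (hr : 0 < r) :
    HasDerivAt (fluxPotential μ γ) (r * (viscosity μ γ r / r ^ 2)) r := by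
  have h := (Real.hasDerivAt_rpow_const (x := r) (p := γ) (Or.inl hr.ne')).const_mul (μ / γ)
  have e : r * (viscosity μ γ r / r ^ 2) = μ / γ * (γ * r ^ (γ - 1)) := by
    have hγ0 : γ ≠ 0 := by linarith
    rw [viscosity, Real.rpow_sub_one hr.ne']
    field_simp
  rw [e]
  exact h

/-- Admissible initial data `(ρ₀, u₀)` with effective velocity `v₀ = u₀ + ∂ₓ φ(ρ₀)`. The last
relation is expressed after multiplication by `ρ₀`, so that it makes sense when there is vacuum:
`ρ₀ v₀ = ρ₀ u₀ + ∂ₓ ψ(ρ₀)`. -/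
structure IsInitialData (μ γ δ : ℝ) (ρ₀ u₀ v₀ : ℝ → ℝ) : Prop where
  measurable_rho : Measurable ρ₀
  measurable_u : Measurable u₀
  measurable_v : Measurable v₀
  nonneg : ∀ᵐ x, 0 ≤ ρ₀ x
  rho_L1 : MemLp ρ₀ 1
  rho_Lgamma : MemLp ρ₀ (ENNReal.ofReal γ)
  u_L2 : MemLp (fun x => √(ρ₀ x) * u₀ x) 2
  v_L2 : MemLp (fun x => √(ρ₀ x) * v₀ x) 2
  u_higher : MemLp (fun x => ρ₀ x ^ (1 / (2 + δ)) * u₀ x) (ENNReal.ofReal (2 + δ))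
  effective : ∃ q₀ : ℝ → ℝ, HasWeakDeriv (fun x => fluxPotential μ γ (ρ₀ x)) q₀ ∧
    ∀ᵐ x, ρ₀ x * v₀ x = ρ₀ x * u₀ x + q₀ x

/-- `(ρ, v)`, with velocity `u`, is a weak solution on `[0,T]` of
`∂ₜρ - ∂ₓ((μ(ρ)/ρ) ∂ₓρ) + ∂ₓ(ρ v) = 0`, `ρ ∂ₜv + ρ u ∂ₓv + ∂ₓP(ρ) = 0`, `v = u + ∂ₓφ(ρ)`,
with initial values `ρ₀` and `ρ₀ v₀`. Here `q` is the weak derivative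
`∂ₓψ(ρ) = (μ(ρ)/ρ) ∂ₓρ = ρ ∂ₓφ(ρ)`, and the second equation is taken in the conservative form
`∂ₜ(ρ v) + ∂ₓ(ρ u v) + ∂ₓP(ρ) = 0`. -/
structure IsWeakSolution (a μ γ T : ℝ) (ρ₀ v₀ : ℝ → ℝ) (ρ u v q : ℝ × ℝ → ℝ) : Prop where
  measurable_rho : Measurable ρ
  measurable_u : Measurable u
  measurable_v : Measurable v
  nonneg : ∀ᵐ z ∂(volume.restrict (strip T)), 0 ≤ ρ z
  locInt_rho : LocInt T ρ
  locInt_pressure : LocInt T (fun z => pressure a γ (ρ z))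
  locInt_momentum : LocInt T (fun z => ρ z * v z)
  locInt_flux : LocInt T (fun z => ρ z * u z * v z)
  locInt_q : LocInt T q
  weakDx_q : HasWeakDx T (fun z => fluxPotential μ γ (ρ z)) q
  effective : ∀ᵐ z ∂(volume.restrict (strip T)), ρ z * v z = ρ z * u z + q z
  mass : ∀ η : ℝ × ℝ → ℝ, IsTestInit T η →
    (∫ z in strip T, (ρ z * dt η z + (ρ z * v z - q z) * dx η z))
      + ∫ x, ρ₀ x * η (0, x) = 0
  momentum : ∀ η : ℝ × ℝ → ℝ, IsTestInit T η →
    (∫ z in strip T, (ρ z * v z * dt η z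
      + (ρ z * u z * v z + pressure a γ (ρ z)) * dx η z))
      + ∫ x, ρ₀ x * v₀ x * η (0, x) = 0

/-- `w` is the space derivative `∂ₓu` away from the vacuum, defined through the product rule
`∂ₓ(ψ(ρ) u) = ψ(ρ) ∂ₓu + u ∂ₓψ(ρ)` with `q = ∂ₓψ(ρ)`. This determines `w` almost everywhere
on `{ρ > 0}`. -/
def IsVelocityGradient (μ γ T : ℝ) (ρ u q w : ℝ × ℝ → ℝ) : Prop :=
  Measurable w ∧
    HasWeakDx T (fun z => fluxPotential μ γ (ρ z) * u z)
      (fun z => fluxPotential μ γ (ρ z) * w z + u z * q z)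

/-- The energy `E(ρ,u)(t)`, with `w = ∂ₓu`; all the integrands are nonnegative. -/
noncomputable def energyU (μ γ : ℝ) (ρ u w : ℝ × ℝ → ℝ) (t : ℝ) : ℝ≥0∞ :=
  (∫⁻ x, ENNReal.ofReal (1 / 2 * ρ (t, x) * u (t, x) ^ 2 + 1 / (γ - 1) * ρ (t, x) ^ γ))
    + ∫⁻ s in Ioo 0 t, ∫⁻ x, ENNReal.ofReal (viscosity μ γ (ρ (s, x)) * w (s, x) ^ 2)

/-- The energy `E(ρ,v)(t)`, with `px = ∂ₓP(ρ)` and `phix = ∂ₓφ(ρ)`; all the integrands are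
nonnegative, since `∂ₓP(ρ) ∂ₓφ(ρ) = P'(ρ) φ'(ρ) |∂ₓρ|²`. -/
noncomputable def energyV (γ : ℝ) (ρ v px phix : ℝ × ℝ → ℝ) (t : ℝ) : ℝ≥0∞ :=
  (∫⁻ x, ENNReal.ofReal (1 / 2 * ρ (t, x) * v (t, x) ^ 2 + 1 / (γ - 1) * ρ (t, x) ^ γ))
    + ∫⁻ s in Ioo 0 t, ∫⁻ x, ENNReal.ofReal (px (s, x) * phix (s, x))

/-- Weak solutions with bounded mass and bounded energies `E(ρ,u)` and `E(ρ,v)` on `(0,T)`.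
Suprema in time are essential suprema. On `{ρ > 0}` one has `∂ₓφ(ρ) = v - u`, and
`∂ₓP(ρ) = 0` almost everywhere on the vacuum set. -/
def IsFiniteEnergySolution (a μ γ T : ℝ) (ρ₀ v₀ : ℝ → ℝ) (ρ u v : ℝ × ℝ → ℝ) : Prop :=
  ∃ q w px : ℝ × ℝ → ℝ,
    IsWeakSolution a μ γ T ρ₀ v₀ ρ u v q ∧
    IsVelocityGradient μ γ T ρ u q w ∧
    Measurable px ∧ HasWeakDx T (fun z => pressure a γ (ρ z)) px ∧
    ∃ C : ℝ≥0, ∀ᵐ t ∂(volume.restrict (Ioo 0 T)),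
      eLpNorm (fun x => ρ (t, x)) 1 volume ≤ C ∧
      energyU μ γ ρ u w t ≤ C ∧
      energyV γ ρ v px (fun z => v z - u z) t ≤ C

/-- The additional regularity of the strong solution: `u ∈ L^∞((0,T) × ℝ)` and
`u, ∂ₓu, ∂ₓv ∈ L¹(0,T; L^∞(ℝ))`. -/
def IsRegular (T : ℝ) (u v : ℝ × ℝ → ℝ) : Prop :=
  MemLp u ⊤ (volume.restrict (strip T)) ∧ MemL1Linfty T u ∧
    (∃ ux : ℝ × ℝ → ℝ, HasWeakDx T u ux ∧ MemL1Linfty T ux) ∧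
    (∃ vx : ℝ × ℝ → ℝ, HasWeakDx T v vx ∧ MemL1Linfty T vx)

end DegenerateNS

/-! The viscosity and the pressure are both multiples of ρ^γ, so P(ρ) = λψ(ρ) with λ = aγ/μ, and ∂ₓP
= λρ(v − u): the pressure acts as a linear damping. The system becomes ∂ₜρ + ∂ₓ(ρu) = 0 and ∂ₜ(ρv) +
∂ₓ(ρuv) = −λ(ρv − ρu). Let M(t,x) be the integral of ρ(t,·) over (−∞,x], let X(t,s) be its quantile
function, and put V(t,s) = v(t,X(t,s)). Formally ∂ₜX = u(t,X), hence ∂ₜ(V − λX) = −λV. For two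
solutions with the same data, the differences D = V − V' and Y = X − X' satisfy D = λY − λ∫₀ᵗ D
(`massVelocity_sub_eq`). No characteristics are needed for this: the momentum balance is tested with
functions of M (`integral_momentum_mass_coordinate`), where the convective terms cancel, and the
weak equation for Y comes from the duality between quantiles and distribution functions
(`integral_lagrangian_sub_mul`).

The estimate of Y by D uses the parabolic structure of the mass equation. N = M − M' solves ∂ₜN =
∂ₓ(ψ(ρ) − ψ(ρ')) − (ρv − ρ'v'). Tested with sign N, the diffusion has a favourable sign because ∂ₓN
= ρ − ρ' and ψ is nondecreasing (`integral_abs_spacePrim_le`). The remaining term is rewritten in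
mass coordinates: for almost every s, N has the same sign at X(s) and at X'(s), so the term is at
most ∫|D| ds (`IsDensity.neg_integral_sign_le`). Therefore ‖N(t)‖₁ ≤ ∫₀ᵗ ‖D‖₁. Fubini gives ‖Y‖₁ ≤
‖N‖₁ (`IsDensity.lintegral_quantile_sub_le`), so ‖D(t)‖₁ ≤ 2λ∫₀ᵗ ‖D‖₁ and Gronwall yields D = 0.
Then N = 0, so the densities agree, and the velocities agree where ρ > 0.

The energy bounds supply the integrability. In particular ψ(ρ) is the space primitive of ρ(v − u),
which is integrable, so ρ is bounded and ρu, ρv are square integrable.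
`IsFiniteEnergySolution.exists_isConservedSolution` turns the distributional equations into
identities between primitives, on which everything else rests. -/

namespace DegenerateNS

open Filter Topology

/-! ### Primitives on the line: chain rule and integration by parts. -/

section Line

/-- The primitive of `f` vanishing at `-∞`. -/
noncomputable def primitive (f : ℝ → ℝ) (x : ℝ) : ℝ := ∫ y in Iic x, f y

theorem primitive_sub {f : ℝ → ℝ} (hf : Integrable f) (a b : ℝ) :
    primitive f b - primitive f a = ∫ y in a..b, f y :=
  intervalIntegral.integral_Iic_sub_Iic hf.integrableOn hf.integrableOn

theorem continuous_primitive {f : ℝ → ℝ} (hf : Integrable f) : Continuous (primitive f) := by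
  have : primitive f = fun x => primitive f 0 + ∫ y in (0 : ℝ)..x, f y := by
    ext x; rw [← primitive_sub hf]; ring
  rw [this]
  exact continuous_const.add
    (intervalIntegral.continuous_primitive (fun a b => hf.intervalIntegrable) 0)

theorem tendsto_primitive_atTop {f : ℝ → ℝ} (hf : Integrable f) :
    Tendsto (primitive f) atTop (𝓝 (∫ x, f x)) :=
  (aecover_Iic tendsto_id).integral_tendsto_of_countably_generated hf

theorem tendsto_primitive_atBot (f : ℝ → ℝ) :
    Tendsto (primitive f) atBot (𝓝 0) :=
  tendsto_integral_Iic_zero tendsto_id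

theorem abs_primitive_le {f : ℝ → ℝ} (hf : Integrable f) (x : ℝ) :
    |primitive f x| ≤ ∫ y, |f y| :=
  (abs_integral_le_integral_abs).trans
    (setIntegral_le_integral hf.abs (ae_of_all _ fun _ => abs_nonneg _))

theorem primitive_congr {f g : ℝ → ℝ} (h : f =ᵐ[volume] g) : primitive f = primitive g := by
  ext x
  exact integral_congr_ae (ae_restrict_of_ae h)

theorem primitive_sub_fun {f g : ℝ → ℝ} (hf : Integrable f) (hg : Integrable g) (x : ℝ) :
    primitive (fun y => f y - g y) x = primitive f x - primitive g x :=
  integral_sub hf.integrableOn hg.integrableOn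

theorem primitive_mono {f : ℝ → ℝ} (hf : Integrable f) (h0 : ∀ᵐ x, 0 ≤ f x) :
    Monotone (primitive f) := by
  intro a b hab
  have := primitive_sub hf a b
  have h2 : 0 ≤ ∫ y in a..b, f y :=
    intervalIntegral.integral_nonneg_of_ae hab h0
  linarith

theorem primitive_le_integral {f : ℝ → ℝ} (hf : Integrable f) (h0 : ∀ᵐ x, 0 ≤ f x) (x : ℝ) :
    primitive f x ≤ ∫ y, f y :=
  setIntegral_le_integral hf h0

/-- Lebesgue differentiation for primitives. -/
theorem ae_hasDerivAt_of_sub_eq {f g : ℝ → ℝ} (hf : Integrable f)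
    (h : ∀ c d, g d - g c = ∫ y in c..d, f y) : ∀ᵐ x, HasDerivAt g (f x) x := by
  filter_upwards [LocallyIntegrable.ae_hasDerivAt_integral hf.locallyIntegrable] with x hx
  have e : g = fun x => g 0 + ∫ y in (0 : ℝ)..x, f y := by ext y; rw [← h]; ring
  rw [e]; exact (hx 0).const_add _

theorem ae_hasDerivAt_primitive {f : ℝ → ℝ} (hf : Integrable f) :
    ∀ᵐ x, HasDerivAt (primitive f) (f x) x :=
  ae_hasDerivAt_of_sub_eq hf (primitive_sub hf)

/-- Functions with equal primitives agree almost everywhere. -/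
theorem ae_eq_of_primitive_eq {f g : ℝ → ℝ} (hf : Integrable f) (hg : Integrable g)
    (h : ∀ x, primitive f x = primitive g x) : f =ᵐ[volume] g := by
  filter_upwards [ae_hasDerivAt_primitive hf, ae_hasDerivAt_primitive hg] with x h1 h2
  rw [funext h] at h1
  exact h1.unique h2

theorem absolutelyContinuous_of_sub_eq {f g : ℝ → ℝ} {a b : ℝ}
    (hf : IntervalIntegrable f volume a b)
    (h : ∀ c d, g d - g c = ∫ y in c..d, f y) : AbsolutelyContinuousOnInterval g a b := by
  have h1 := hf.absolutelyContinuousOnInterval_intervalIntegral (c := a) left_mem_uIcc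
  have h2 : AbsolutelyContinuousOnInterval (fun _ : ℝ => g a) a b :=
    (LipschitzWith.const (g a)).lipschitzOnWith.absolutelyContinuousOnInterval
  have h3 := h2.add h1
  have e : g = (fun _ : ℝ => g a) + fun x => ∫ y in a..x, f y := by
    ext x; simp [← h]
  rw [e]; exact h3

/-- A Lipschitz map multiplies the sums of increments by at most K. Only the values taken by `g`
matter, which allows maps that are merely locally Lipschitz. -/
theorem _root_.AbsolutelyContinuousOnInterval.lipschitz_comp {g ξ : ℝ → ℝ} {a b : ℝ} {K : ℝ≥0}
    {s : Set ℝ} (hξ : LipschitzOnWith K ξ s) (hg : AbsolutelyContinuousOnInterval g a b)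
    (hs : MapsTo g (uIcc a b) s) :
    AbsolutelyContinuousOnInterval (fun x => ξ (g x)) a b := by
  unfold AbsolutelyContinuousOnInterval at hg ⊢
  have h1 := hg.const_mul (K : ℝ)
  rw [mul_zero] at h1
  refine squeeze_zero' (Eventually.of_forall fun E => Finset.sum_nonneg fun i _ => dist_nonneg)
    ?_ h1
  have hE : ∀ᶠ (E : ℕ × (ℕ → ℝ × ℝ)) in AbsolutelyContinuousOnInterval.totalLengthFilter ⊓
      𝓟 (AbsolutelyContinuousOnInterval.disjWithin a b),
      E ∈ AbsolutelyContinuousOnInterval.disjWithin a b :=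
    eventually_inf_principal.mpr (by simp)
  filter_upwards [hE] with E hE
  rw [Finset.mul_sum]
  exact Finset.sum_le_sum fun i hi =>
    hξ.dist_le_mul _ (hs (hE.1 i hi).1) _ (hs (hE.1 i hi).2)

/-- Chain rule for a `C¹` function of a primitive of an integrable function. -/
theorem comp_sub_eq_integral {f g ξ : ℝ → ℝ} (hf : Integrable f)
    (h : ∀ c d, g d - g c = ∫ y in c..d, f y) (hξ : ContDiff ℝ 1 ξ) (a b : ℝ) :
    ξ (g b) - ξ (g a) = ∫ y in a..b, deriv ξ (g y) * f y := by
  have hac := absolutelyContinuous_of_sub_eq (hf.intervalIntegrable (a := a) (b := b)) h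
  obtain ⟨C, hC⟩ := hac.exists_bound
  -- A `C¹` function is Lipschitz on the compact interval containing the range of `g`.
  obtain ⟨K, hK⟩ := hξ.contDiffOn.exists_lipschitzOnWith (s := Icc (-C) C) (by simp)
    (convex_Icc _ _) isCompact_Icc
  have hm : MapsTo g (uIcc a b) (Icc (-C) C) := fun x hx => abs_le.1 (hC x hx)
  rw [← (AbsolutelyContinuousOnInterval.lipschitz_comp hK hac hm).integral_deriv_eq_sub]
  refine intervalIntegral.integral_congr_ae ?_
  filter_upwards [ae_hasDerivAt_of_sub_eq hf h] with x hg _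
  exact ((hξ.differentiable (by simp) _).hasDerivAt.comp x hg).deriv

theorem intervalIntegral_tendsto_nat {f : ℝ → ℝ} (hf : Integrable f) :
    Tendsto (fun n : ℕ => ∫ y in (-(n : ℝ))..n, f y) atTop (𝓝 (∫ x, f x)) :=
  intervalIntegral_tendsto_integral hf
    (tendsto_neg_atTop_atBot.comp tendsto_natCast_atTop_atTop) tendsto_natCast_atTop_atTop

theorem exists_bound_comp_primitive {r ξ : ℝ → ℝ} (hr : Integrable r) (hξ : Continuous ξ) :
    ∃ C, ∀ x, |ξ (primitive r x)| ≤ C := by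
  obtain ⟨C, hC⟩ := (isCompact_Icc (a := -∫ y, |r y|) (b := ∫ y, |r y|)).exists_bound_of_continuousOn
    hξ.continuousOn
  exact ⟨C, fun x => hC _ (abs_le.1 (abs_primitive_le hr x))⟩

/-- Integration by parts on the line for `C¹` functions of primitives. -/
theorem integral_mul_comp_primitive {α r ξ : ℝ → ℝ} (hα : Integrable α) (hr : Integrable r)
    (hξ : ContDiff ℝ 1 ξ) :
    ∫ x, α x * ξ (primitive r x) =
      (∫ x, α x) * ξ (∫ x, r x) - ∫ x, primitive α x * (deriv ξ (primitive r x) * r x) := by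
  have hcr := continuous_primitive hr
  have hcα := continuous_primitive hα
  have hdξ : Continuous (deriv ξ) := hξ.continuous_deriv (by simp)
  obtain ⟨C, hC⟩ := exists_bound_comp_primitive hr hξ.continuous
  obtain ⟨C', hC'⟩ := exists_bound_comp_primitive hr hdξ
  have i1 : Integrable fun x => α x * ξ (primitive r x) :=
    hα.mul_bdd (hξ.continuous.comp hcr).aestronglyMeasurable (ae_of_all _ hC)
  have i2 : Integrable fun x => deriv ξ (primitive r x) * r x :=
    hr.bdd_mul (hdξ.comp hcr).aestronglyMeasurable (ae_of_all _ hC')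
  have i3 : Integrable fun x => primitive α x * (deriv ξ (primitive r x) * r x) :=
    i2.bdd_mul hcα.aestronglyMeasurable (ae_of_all _ fun x => abs_primitive_le hα x)
  -- The product rule for absolutely continuous functions on `[-n,n]`. As `n → ∞` only the boundary
  -- term at `+∞` survives, because `primitive α` vanishes at `-∞`.
  have key : ∀ n : ℕ, ∫ x in (-(n : ℝ))..n, (α x * ξ (primitive r x) +
      primitive α x * (deriv ξ (primitive r x) * r x)) =
      primitive α n * ξ (primitive r n) - primitive α (-n) * ξ (primitive r (-n)) := by
    intro n
    have hacα := absolutelyContinuous_of_sub_eq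
      (hα.intervalIntegrable (a := -(n : ℝ)) (b := n)) (primitive_sub hα)
    have hacξ : AbsolutelyContinuousOnInterval (fun x => ξ (primitive r x)) (-(n : ℝ)) n :=
      absolutelyContinuous_of_sub_eq i2.intervalIntegrable
        (fun c d => comp_sub_eq_integral hr (primitive_sub hr) hξ c d)
    rw [← hacα.integral_deriv_mul_eq_sub hacξ]
    refine intervalIntegral.integral_congr_ae ?_
    filter_upwards [ae_hasDerivAt_primitive hα, ae_hasDerivAt_primitive hr] with x d1 d2 _
    rw [d1.deriv]
    have := ((hξ.differentiable (by simp) _).hasDerivAt.comp x d2).deriv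
    simp only [Function.comp_def] at this
    rw [this]
  have l1 := intervalIntegral_tendsto_nat (i1.add i3)
  have hcast : Tendsto (fun n : ℕ => (n : ℝ)) atTop atTop := tendsto_natCast_atTop_atTop
  have hcast' : Tendsto (fun n : ℕ => -(n : ℝ)) atTop atBot :=
    tendsto_neg_atTop_atBot.comp hcast
  have l2 : Tendsto (fun n : ℕ => primitive α n * ξ (primitive r n) -
      primitive α (-n) * ξ (primitive r (-n))) atTop
      (𝓝 ((∫ x, α x) * ξ (∫ x, r x) - 0 * ξ 0)) := by
    refine Tendsto.sub (Tendsto.mul ?_ ?_) (Tendsto.mul ?_ ?_)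
    · exact (tendsto_primitive_atTop hα).comp hcast
    · exact (hξ.continuous.tendsto _).comp ((tendsto_primitive_atTop hr).comp hcast)
    · exact (tendsto_primitive_atBot α).comp hcast'
    · exact (hξ.continuous.tendsto _).comp ((tendsto_primitive_atBot r).comp hcast')
  have := tendsto_nhds_unique l1 (l2.congr fun n => (key n).symm)
  simp only [Pi.add_apply] at this
  rw [integral_add i1 i3] at this
  linarith

end Line

/-! ### Cutoffs, window integrals and weak derivatives on the line. -/

section Cutoff

/-- Smooth functions on the line vanishing outside `[a,b]`. -/
def IsCutoff (a b : ℝ) (θ : ℝ → ℝ) : Prop :=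
  ContDiff ℝ (⊤ : ℕ∞) θ ∧ ∀ x, x ∉ Icc a b → θ x = 0

theorem IsCutoff.tsupport_subset {a b : ℝ} {θ : ℝ → ℝ} (h : IsCutoff a b θ) :
    tsupport θ ⊆ Icc a b :=
  closure_minimal (fun x hx => by by_contra h'; exact hx (h.2 x h')) isClosed_Icc

theorem IsCutoff.hasCompactSupport {a b : ℝ} {θ : ℝ → ℝ} (h : IsCutoff a b θ) :
    HasCompactSupport θ :=
  isCompact_Icc.of_isClosed_subset (isClosed_tsupport θ) h.tsupport_subset

theorem IsCutoff.continuous {a b : ℝ} {θ : ℝ → ℝ} (h : IsCutoff a b θ) : Continuous θ :=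
  h.1.continuous

theorem IsCutoff.hasDerivAt {a b : ℝ} {θ : ℝ → ℝ} (h : IsCutoff a b θ) (x : ℝ) :
    HasDerivAt θ (deriv θ x) x :=
  (h.1.differentiable (by simp) x).hasDerivAt

theorem IsCutoff.deriv {a b : ℝ} {θ : ℝ → ℝ} (h : IsCutoff a b θ) : IsCutoff a b (deriv θ) :=
  ⟨(contDiff_infty_iff_deriv.1 h.1).2, fun x hx => by
    have : θ =ᶠ[𝓝 x] fun _ => 0 := by
      filter_upwards [isClosed_Icc.isOpen_compl.mem_nhds hx] with y hy using h.2 y hy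
    rw [this.deriv_eq]; simp⟩

theorem IsCutoff.integrable {a b : ℝ} {θ : ℝ → ℝ} (h : IsCutoff a b θ) : Integrable θ :=
  h.continuous.integrable_of_hasCompactSupport h.hasCompactSupport

theorem IsCutoff.exists_bound {a b : ℝ} {θ : ℝ → ℝ} (h : IsCutoff a b θ) :
    ∃ C, 0 ≤ C ∧ ∀ x, |θ x| ≤ C := by
  obtain ⟨C, hC⟩ := h.hasCompactSupport.exists_bound_of_continuous h.continuous
  exact ⟨C, (norm_nonneg _).trans (hC 0), hC⟩

theorem exists_isCutoff_of_tsupport_subset {τ : ℝ → ℝ} (h1 : ContDiff ℝ (⊤ : ℕ∞) τ)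
    (h2 : HasCompactSupport τ) {c d : ℝ} (hcd : c < d) (h3 : tsupport τ ⊆ Ioo c d) :
    ∃ a b, c < a ∧ a ≤ b ∧ b < d ∧ IsCutoff a b τ := by
  rcases (tsupport τ).eq_empty_or_nonempty with h | h
  · refine ⟨(c + d) / 2, (c + d) / 2, by linarith, le_rfl, by linarith, h1, fun x _ => ?_⟩
    exact image_eq_zero_of_notMem_tsupport (by simp [h])
  · obtain ⟨a, ha, ha'⟩ := h2.isCompact.exists_isLeast h
    obtain ⟨b, hb, hb'⟩ := h2.isCompact.exists_isGreatest h
    refine ⟨a, b, (h3 ha).1, ha' hb, (h3 hb).2, h1, fun x hx => ?_⟩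
    exact image_eq_zero_of_notMem_tsupport fun hx' => hx ⟨ha' hx', hb' hx'⟩

theorem exists_isCutoff_of_hasCompactSupport {τ : ℝ → ℝ} (h1 : ContDiff ℝ (⊤ : ℕ∞) τ)
    (h2 : HasCompactSupport τ) : ∃ a b, IsCutoff a b τ := by
  obtain ⟨R, hR⟩ := h2.isCompact.isBounded.subset_closedBall 0
  refine ⟨-R, R, h1, fun x hx => image_eq_zero_of_notMem_tsupport fun hx' => hx ?_⟩
  have := hR hx'
  rwa [Real.closedBall_eq_Icc, zero_sub, zero_add] at this

theorem IsCutoff.primitive_deriv {a b : ℝ} {θ : ℝ → ℝ} (h : IsCutoff a b θ) (x : ℝ) :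
    primitive (_root_.deriv θ) x = θ x := by
  have hc : ∀ᶠ y in atBot, θ y = 0 := by
    filter_upwards [eventually_lt_atBot a] with y hy
    exact h.2 y fun hy' => absurd hy'.1 (not_le.2 hy)
  have h1 : Tendsto (fun y => θ x - θ y) atBot (𝓝 (θ x - 0)) :=
    tendsto_const_nhds.sub (tendsto_const_nhds.congr' (hc.mono fun y hy => hy.symm))
  have h2 : Tendsto (fun y => primitive (_root_.deriv θ) x - primitive (_root_.deriv θ) y) atBot
      (𝓝 (primitive (_root_.deriv θ) x - 0)) :=
    tendsto_const_nhds.sub (tendsto_primitive_atBot _)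
  have e : (fun y => primitive (_root_.deriv θ) x - primitive (_root_.deriv θ) y) =
      fun y => θ x - θ y := by
    ext y
    rw [primitive_sub h.deriv.integrable, intervalIntegral.integral_deriv_eq_sub]
    · exact fun z _ => (h.hasDerivAt z).differentiableAt
    · exact h.deriv.continuous.intervalIntegrable _ _
  rw [e] at h2
  have := tendsto_nhds_unique h1 h2
  linarith

theorem IsCutoff.integral_deriv_eq_zero {a b : ℝ} {θ : ℝ → ℝ} (h : IsCutoff a b θ) :
    ∫ x, _root_.deriv θ x = 0 := by
  refine tendsto_nhds_unique (tendsto_primitive_atTop h.deriv.integrable) ?_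
  refine tendsto_const_nhds.congr' ?_
  filter_upwards [eventually_gt_atTop b] with y hy
  rw [h.primitive_deriv, h.2 y fun hy' => absurd hy'.2 (not_le.2 hy)]

/-- The integral of `τ` over `[x, x + R]`. -/
noncomputable def windowIntegral (τ : ℝ → ℝ) (R x : ℝ) : ℝ :=
  primitive τ (x + R) - primitive τ x

theorem IsCutoff.hasDerivAt_primitive {a b : ℝ} {τ : ℝ → ℝ} (h : IsCutoff a b τ) (x : ℝ) :
    HasDerivAt (primitive τ) (τ x) x := by
  have e : primitive τ = fun x => primitive τ 0 + ∫ y in (0 : ℝ)..x, τ y := by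
    ext y; rw [← primitive_sub h.integrable]; ring
  rw [e]
  exact (intervalIntegral.integral_hasDerivAt_right (h.continuous.intervalIntegrable _ _)
    h.continuous.stronglyMeasurable.stronglyMeasurableAtFilter h.continuous.continuousAt).const_add _

theorem IsCutoff.contDiff_primitive {a b : ℝ} {τ : ℝ → ℝ} (h : IsCutoff a b τ) :
    ContDiff ℝ (⊤ : ℕ∞) (primitive τ) := by
  rw [contDiff_infty_iff_deriv]
  refine ⟨fun x => (h.hasDerivAt_primitive x).differentiableAt, ?_⟩
  rw [funext fun x => (h.hasDerivAt_primitive x).deriv]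
  exact h.1

theorem IsCutoff.hasDerivAt_windowIntegral {a b : ℝ} {τ : ℝ → ℝ} (h : IsCutoff a b τ) (R x : ℝ) :
    HasDerivAt (windowIntegral τ R) (τ (x + R) - τ x) x :=
  ((h.hasDerivAt_primitive (x + R)).comp_add_const x R).sub (h.hasDerivAt_primitive x)

/-- The antiderivative of a test function need not have compact support; integrating over a window
of finite length repairs this, at the price of a second copy of `τ` in the derivative, translated by
`R`. That copy is either sent to infinity or, when `R = T`, pushed to negative times. -/
theorem IsCutoff.windowIntegral {a b : ℝ} {τ : ℝ → ℝ} (h : IsCutoff a b τ) {R : ℝ} (hR : 0 ≤ R) :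
    IsCutoff (a - R) b (windowIntegral τ R) := by
  refine ⟨(h.contDiff_primitive.comp (contDiff_id.add contDiff_const)).sub h.contDiff_primitive,
    fun x hx => ?_⟩
  unfold DegenerateNS.windowIntegral
  rw [primitive_sub h.integrable]
  refine intervalIntegral.integral_zero_ae (ae_of_all _ fun y hy => h.2 y fun hy' => hx ?_)
  rw [uIoc_of_le (by linarith)] at hy
  exact ⟨by linarith [hy.2, hy'.1], by linarith [hy.1, hy'.2]⟩

theorem IsCutoff.abs_windowIntegral_le {a b : ℝ} {τ : ℝ → ℝ} (h : IsCutoff a b τ) (R x : ℝ) :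
    |DegenerateNS.windowIntegral τ R x| ≤ 2 * ∫ y, |τ y| := by
  have h1 := abs_primitive_le h.integrable (x + R)
  have h2 := abs_primitive_le h.integrable x
  have := abs_sub (primitive τ (x + R)) (primitive τ x)
  unfold DegenerateNS.windowIntegral
  linarith

/-- An integrable function with integrable weak derivative `g` is the primitive of `g`. -/
theorem ae_eq_primitive_of_weak {f g : ℝ → ℝ} (hf : Integrable f) (hg : Integrable g)
    (h : ∀ a b Φ, IsCutoff a b Φ → ∫ x, f x * deriv Φ x = -∫ x, g x * Φ x) :
    ∀ᵐ x, f x = primitive g x := by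
  refine ae_eq_of_integral_contDiff_smul_eq hf.locallyIntegrable
    (continuous_primitive hg).locallyIntegrable fun τ h1 h2 => ?_
  obtain ⟨a, b, hτ⟩ := exists_isCutoff_of_hasCompactSupport h1 h2
  obtain ⟨C, hC0, hC⟩ := hτ.exists_bound
  have hid : ContDiff ℝ 1 (fun y : ℝ => y) := contDiff_id
  have ibp := integral_mul_comp_primitive hg hτ.integrable hid
  simp only [deriv_id'', one_mul] at ibp
  have hprim := continuous_primitive hτ.integrable
  -- The weak derivative is tested with the window of length `n`.
  have key : ∀ n : ℕ, (∫ x, f x * τ (x + n)) - ∫ x, f x * τ x =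
      -∫ x, g x * windowIntegral τ n x := by
    intro n
    rw [← h _ _ _ (hτ.windowIntegral (Nat.cast_nonneg n)), ← integral_sub]
    · refine integral_congr_ae (ae_of_all _ fun x => ?_)
      simp only [(hτ.hasDerivAt_windowIntegral _ x).deriv]
      ring
    · exact hf.mul_bdd (c := C)
        (hτ.continuous.comp (continuous_id.add continuous_const)).aestronglyMeasurable
        (ae_of_all _ fun x => hC _)
    · exact hf.mul_bdd (c := C) hτ.continuous.aestronglyMeasurable (ae_of_all _ fun x => hC _)
  -- The translated copy leaves every bounded set, so integrability of `f` makes its contribution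
  -- vanish. This fixes the constant of integration at `-∞`.
  have l1 : Tendsto (fun n : ℕ => (∫ x, f x * τ (x + n)) - ∫ x, f x * τ x) atTop
      (𝓝 (0 - ∫ x, f x * τ x)) := by
    refine Tendsto.sub ?_ tendsto_const_nhds
    have := tendsto_integral_of_dominated_convergence (F := fun (n : ℕ) x => f x * τ (x + n))
      (f := fun _ => (0 : ℝ)) (μ := volume) (fun x => |f x| * C) ?_ (hf.abs.mul_const C) ?_ ?_
    · simpa using this
    · exact fun n => hf.1.mul
        (hτ.continuous.comp (continuous_id.add continuous_const)).aestronglyMeasurable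
    · refine fun n => ae_of_all _ fun x => ?_
      rw [Real.norm_eq_abs, abs_mul]
      exact mul_le_mul_of_nonneg_left (hC _) (abs_nonneg _)
    · refine ae_of_all _ fun x => tendsto_const_nhds.congr' ?_
      filter_upwards [(tendsto_natCast_atTop_atTop (R := ℝ)).eventually_gt_atTop (b - x)] with n hn
      rw [hτ.2 _ fun h' => absurd h'.2 (by linarith), mul_zero]
  have l2 : Tendsto (fun n : ℕ => -∫ x, g x * windowIntegral τ n x) atTop
      (𝓝 (-∫ x, g x * ((∫ y, τ y) - primitive τ x))) := by
    refine Tendsto.neg ?_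
    refine tendsto_integral_of_dominated_convergence (fun x => |g x| * (2 * ∫ y, |τ y|)) ?_
      (hg.abs.mul_const _) ?_ ?_
    · exact fun n => hg.1.mul (hτ.windowIntegral (Nat.cast_nonneg n)).continuous.aestronglyMeasurable
    · refine fun n => ae_of_all _ fun x => ?_
      rw [Real.norm_eq_abs, abs_mul]
      exact mul_le_mul_of_nonneg_left (hτ.abs_windowIntegral_le _ _) (abs_nonneg _)
    · refine ae_of_all _ fun x => Tendsto.const_mul _ (Tendsto.sub ?_ tendsto_const_nhds)
      exact (tendsto_primitive_atTop hτ.integrable).comp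
        (tendsto_atTop_add_const_left _ _ tendsto_natCast_atTop_atTop)
  have e := tendsto_nhds_unique l1 (l2.congr fun n => (key n).symm)
  have i1 : Integrable fun x => g x * primitive τ x :=
    hg.mul_bdd hprim.aestronglyMeasurable
      (ae_of_all _ fun x => abs_primitive_le hτ.integrable x)
  have e2 : ∫ x, g x * ((∫ y, τ y) - primitive τ x) =
      (∫ x, g x) * (∫ y, τ y) - ∫ x, g x * primitive τ x := by
    rw [← integral_mul_const, ← integral_sub (hg.mul_const _) i1]
    congr 1; ext x; ring
  simp only [smul_eq_mul]
  have c1 : ∫ x, τ x * f x = ∫ x, f x * τ x := by congr 1; ext x; ring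
  have c2 : ∫ x, τ x * primitive g x = ∫ x, primitive g x * τ x := by congr 1; ext x; ring
  rw [c1, c2]
  linarith

end Cutoff

/-! ### Identification of functions on a product by testing. -/

section Separation

/-- An integrable function on a product whose integrals over all rectangles vanish is zero. -/
theorem ae_eq_zero_of_forall_rectangle {α β : Type*} [MeasurableSpace α] [MeasurableSpace β]
    {m : Measure (α × β)} {f : α × β → ℝ} (hf : Integrable f m)
    (h : ∀ A B, MeasurableSet A → MeasurableSet B → ∫ z in A ×ˢ B, f z ∂m = 0) :
    ∀ᵐ z ∂m, f z = 0 := by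
  -- Positive and negative parts have the same finite integral over each rectangle, and rectangles
  -- determine the densities.
  have h1 : (fun z => ENNReal.ofReal (f z)) =ᵐ[m] fun z => ENNReal.ofReal (-f z) := by
    refine ae_eq_of_setLIntegral_prod_eq hf.1.aemeasurable.ennreal_ofReal
      hf.1.aemeasurable.neg.ennreal_ofReal hf.lintegral_lt_top.ne fun A hA B hB => ?_
    have h2 := h A B hA hB
    have hi := hf.integrableOn (s := A ×ˢ B)
    rw [integral_eq_lintegral_pos_part_sub_lintegral_neg_part hi, sub_eq_zero] at h2
    exact (ENNReal.toReal_eq_toReal_iff' hi.lintegral_lt_top.ne hi.neg.lintegral_lt_top.ne).1 h2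
  filter_upwards [h1] with z hz
  rcases le_total 0 (f z) with h0 | h0
  · rw [ENNReal.ofReal_of_nonpos (by linarith : -f z ≤ 0), ENNReal.ofReal_eq_zero] at hz
    linarith
  · rw [ENNReal.ofReal_of_nonpos h0, eq_comm, ENNReal.ofReal_eq_zero] at hz
    linarith

/-- Smooth functions of the first variable separate integrable functions on a product. -/
theorem ae_eq_zero_of_forall_cutoff {β : Type*} [MeasurableSpace β] {ν : Measure β} [SFinite ν]
    {c d : ℝ} (hcd : c < d) {f : ℝ × β → ℝ}
    (hf : Integrable f ((volume.restrict (Ioo c d)).prod ν))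
    (h : ∀ a b τ, c < a → a ≤ b → b < d → IsCutoff a b τ →
      ∀ᵐ x ∂ν, ∫ t in Ioo c d, τ t * f (t, x) = 0) :
    ∀ᵐ z ∂((volume.restrict (Ioo c d)).prod ν), f z = 0 := by
  refine ae_eq_zero_of_forall_rectangle hf fun A B hA hB => ?_
  set μ := volume.restrict (Ioo c d) with hμ
  have hfB : Integrable f (μ.prod (ν.restrict B)) := by
    have := hf.integrableOn (s := univ ×ˢ B)
    rwa [IntegrableOn, ← Measure.prod_restrict, Measure.restrict_univ] at this
  -- The exceptional set in `h` depends on `τ`. Integrating over `B` first removes it, leaving a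
  -- function of time alone.
  have hF : ∀ᵐ t ∂μ, ∫ x in B, f (t, x) ∂ν = 0 := by
    rw [hμ, ae_restrict_iff' measurableSet_Ioo]
    have hFi : IntegrableOn (fun t => ∫ x in B, f (t, x) ∂ν) (Ioo c d) := hfB.integral_prod_left
    refine isOpen_Ioo.ae_eq_zero_of_integral_contDiff_smul_eq_zero
      hFi.locallyIntegrableOn fun τ h1 h2 h3 => ?_
    obtain ⟨a, b, ha, hab, hb, hτ⟩ := exists_isCutoff_of_tsupport_subset h1 h2 hcd h3
    obtain ⟨C, hC0, hC⟩ := hτ.exists_bound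
    have hi : Integrable (fun z : ℝ × β => τ z.1 * f z) (μ.prod (ν.restrict B)) :=
      hfB.bdd_mul (hτ.continuous.measurable.comp measurable_fst).aestronglyMeasurable
        (ae_of_all _ fun z => hC z.1)
    have e1 : ∫ t, τ t • ∫ x in B, f (t, x) ∂ν = ∫ t, ∫ x in B, τ t * f (t, x) ∂ν ∂μ := by
      rw [hμ, setIntegral_eq_integral_of_forall_compl_eq_zero]
      · simp [integral_const_mul]
      · intro t ht
        have : τ t = 0 := hτ.2 t fun h' => ht ⟨ha.trans_le h'.1, h'.2.trans_lt hb⟩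
        simp [this]
    rw [e1, integral_integral_swap (f := fun t x => τ t * f (t, x)) hi]
    refine integral_eq_zero_of_ae ?_
    filter_upwards [ae_restrict_of_ae (h a b τ ha hab hb hτ)] with x hx
    simpa using hx
  rw [← Measure.prod_restrict, integral_prod _ (by
    rw [Measure.prod_restrict]; exact hf.integrableOn)]
  refine integral_eq_zero_of_ae ?_
  filter_upwards [ae_restrict_of_ae hF] with t ht using ht

end Separation

/-! ### Continuity of time translations and of products. -/

section Translation

theorem measurePreserving_shift (s : ℝ) :
    MeasurePreserving (fun z : ℝ × ℝ => (z.1 - s, z.2)) volume volume :=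
  (measurePreserving_sub_right volume s).prod (MeasurePreserving.id volume)

/-- Translations in time are continuous in `L^p`, `p < ∞`. -/
theorem tendsto_eLpNorm_shift {p : ℝ≥0∞} (hp1 : 1 ≤ p) (hp : p ≠ ∞) {f : ℝ × ℝ → ℝ}
    (hf : MemLp f p volume) :
    Tendsto (fun s : ℝ => eLpNorm (fun z => f (z.1 - s, z.2) - f z) p volume) (𝓝 0) (𝓝 0) := by
  have : Fact (1 ≤ p) := ⟨hp1⟩
  let G : C(ℝ, C(ℝ × ℝ, ℝ × ℝ)) :=
    (ContinuousMap.mk (fun a : ℝ × (ℝ × ℝ) => ((a.2.1 - a.1, a.2.2) : ℝ × ℝ))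
      (by fun_prop)).curry
  have hG : ∀ s, MeasurePreserving (G s) volume volume := fun s => measurePreserving_shift s
  have h1 := Filter.Tendsto.compMeasurePreservingLp (l := 𝓝 (0 : ℝ)) (f := fun _ => hf.toLp f)
    (g := fun s => G s) (g₀ := G 0) tendsto_const_nhds (G.continuous.tendsto 0) hG (hG 0) hp
  rw [Lp.tendsto_Lp_iff_tendsto_eLpNorm'] at h1
  refine h1.congr fun s => eLpNorm_congr_ae ?_
  have e : ∀ s, (Lp.compMeasurePreserving (G s) (hG s) (hf.toLp f) : ℝ × ℝ → ℝ) =ᵐ[volume]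
      fun z => f (z.1 - s, z.2) := fun s => by
    filter_upwards [Lp.coeFn_compMeasurePreserving (hf.toLp f) (hG s),
      (hG s).quasiMeasurePreserving.ae_eq_comp hf.coeFn_toLp] with z h1 h2
    rw [h1, h2]; rfl
  filter_upwards [e s, e 0] with z h1 h2
  simp only [Pi.sub_apply, h1, h2, sub_zero]

/-- Products of `L^p`- and `L^q`-convergent families converge in `L¹`. -/
theorem tendsto_integral_mul_of_eLpNorm {α ι : Type*} [MeasurableSpace α] {m : Measure α}
    {l : Filter ι} {p q : ℝ≥0∞} [ENNReal.HolderTriple p q 1] {a : ι → α → ℝ} {a₀ : α → ℝ}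
    {b : ι → α → ℝ} {b₀ : α → ℝ} (ha : ∀ i, MemLp (a i) p m) (ha₀ : MemLp a₀ p m)
    (hb : ∀ i, MemLp (b i) q m) (hb₀ : MemLp b₀ q m)
    (hal : Tendsto (fun i => eLpNorm (fun x => a i x - a₀ x) p m) l (𝓝 0))
    (hbl : Tendsto (fun i => eLpNorm (fun x => b i x - b₀ x) q m) l (𝓝 0)) :
    Tendsto (fun i => ∫ x, a i x * b i x ∂m) l (𝓝 (∫ x, a₀ x * b₀ x ∂m)) := by
  have hol : ∀ {f g : α → ℝ}, MemLp f p m → MemLp g q m →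
      eLpNorm (fun x => f x * g x) 1 m ≤ eLpNorm f p m * eLpNorm g q m := by
    intro f g hf hg
    have e : (fun x => f x * g x) = f • g := rfl
    rw [e]
    exact eLpNorm_smul_le_mul_eLpNorm (p := p) (q := q) (r := 1) hg.1 hf.1
  have hmem : ∀ {f g : α → ℝ}, MemLp f p m → MemLp g q m → MemLp (fun x => f x * g x) 1 m :=
    fun hf hg => MemLp.mul' hg hf
  refine tendsto_integral_of_L1' _ (hmem ha₀ hb₀).1
    (Eventually.of_forall fun i => memLp_one_iff_integrable.1 (hmem (ha i) (hb i))) ?_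
  have hub : ∀ i, eLpNorm ((fun x => a i x * b i x) - fun x => a₀ x * b₀ x) 1 m ≤
      eLpNorm (fun x => a i x - a₀ x) p m * eLpNorm (fun x => b i x - b₀ x) q m +
      eLpNorm (fun x => a i x - a₀ x) p m * eLpNorm b₀ q m +
      eLpNorm a₀ p m * eLpNorm (fun x => b i x - b₀ x) q m := by
    intro i
    have hda : MemLp (fun x => a i x - a₀ x) p m := (ha i).sub ha₀
    have hdb : MemLp (fun x => b i x - b₀ x) q m := (hb i).sub hb₀
    have e : ((fun x => a i x * b i x) - fun x => a₀ x * b₀ x) =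
        ((fun x => (a i x - a₀ x) * (b i x - b₀ x)) + fun x => (a i x - a₀ x) * b₀ x) +
        fun x => a₀ x * (b i x - b₀ x) := by
      ext x; simp only [Pi.sub_apply, Pi.add_apply]; ring
    rw [e]
    refine (eLpNorm_add_le ((hmem hda hdb).1.add (hmem hda hb₀).1) (hmem ha₀ hdb).1 le_rfl).trans ?_
    refine add_le_add ((eLpNorm_add_le (hmem hda hdb).1 (hmem hda hb₀).1 le_rfl).trans ?_)
      (hol ha₀ hdb)
    exact add_le_add (hol hda hdb) (hol hda hb₀)
  refine tendsto_of_tendsto_of_tendsto_of_le_of_le tendsto_const_nhds ?_ (fun i => zero_le) hub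
  have t1 := ENNReal.Tendsto.mul hal (Or.inr ENNReal.zero_ne_top) hbl (Or.inr ENNReal.zero_ne_top)
  have t2 := ENNReal.Tendsto.mul_const (b := eLpNorm b₀ q m) hal (Or.inr hb₀.2.ne)
  have t3 := ENNReal.Tendsto.const_mul (a := eLpNorm a₀ p m) hbl (Or.inr ha₀.2.ne)
  simpa using (t1.add t2).add t3

end Translation

/-! ### Gronwall's inequality for extended nonnegative functions. -/

section Gronwall

/-- A Gronwall inequality for almost everywhere defined functions. -/
theorem ae_eq_zero_of_le_lintegral {T C : ℝ} (hC : 0 < C) {g : ℝ → ℝ≥0∞} (hg : Measurable g)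
    (hfin : ∫⁻ t in Ioo 0 T, g t ≠ ∞)
    (h : ∀ᵐ t ∂(volume.restrict (Ioo 0 T)), g t ≤ ENNReal.ofReal C * ∫⁻ s in Ioo 0 t, g s) :
    ∀ᵐ t ∂(volume.restrict (Ioo 0 T)), g t = 0 := by
  set μ := volume.restrict (Ioo 0 T) with hμ
  -- The rate `2C` makes the tail integral of the weight equal to `1/(2C)` times the weight, so
  -- Tonelli turns the hypothesis into `I ≤ I/2` with `I` finite. No continuity of `g` is needed.
  let e : ℝ → ℝ≥0∞ := fun t => ENNReal.ofReal (Real.exp (-(2 * C) * t))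
  have he : Measurable e := by fun_prop
  let I := ∫⁻ t, e t * g t ∂μ
  have hfin2 : I ≠ ∞ := by
    refine ne_top_of_le_ne_top hfin (lintegral_mono_ae ?_)
    filter_upwards [ae_restrict_mem measurableSet_Ioo] with t ht
    have : e t ≤ 1 := by
      rw [← ENNReal.ofReal_one]
      exact ENNReal.ofReal_le_ofReal (Real.exp_le_one_iff.2 (by nlinarith [ht.1]))
    calc e t * g t ≤ 1 * g t := by gcongr
      _ = g t := one_mul _
  have tail : ∀ s, ∫⁻ t in Ioi s, e t = ENNReal.ofReal (1 / (2 * C)) * e s := by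
    intro s
    rw [← ofReal_integral_eq_lintegral_ofReal]
    · rw [integral_exp_mul_Ioi (by linarith), ← ENNReal.ofReal_mul (by positivity)]
      congr 1; field_simp
    · exact (integrableOn_exp_mul_Ioi (by linarith) s)
    · exact ae_of_all _ fun _ => (Real.exp_pos _).le
  have hle : I ≤ ENNReal.ofReal (1 / 2) * I := by
    calc I ≤ ∫⁻ t, e t * (ENNReal.ofReal C * ∫⁻ s, (Iio t).indicator g s ∂μ) ∂μ := by
          refine lintegral_mono_ae ?_
          filter_upwards [h, ae_restrict_mem measurableSet_Ioo] with t ht htT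
          refine mul_le_mul_right (ht.trans ?_) _
          refine mul_le_mul_right ?_ _
          rw [lintegral_indicator measurableSet_Iio, hμ, Measure.restrict_restrict measurableSet_Iio]
          refine lintegral_mono_set fun s hs => ⟨hs.2, hs.1, hs.2.trans htT.2⟩
      _ = ∫⁻ t, ∫⁻ s, ENNReal.ofReal C * (e t * (Iio t).indicator g s) ∂μ ∂μ := by
          refine lintegral_congr fun t => ?_
          rw [lintegral_const_mul _ ((hg.indicator measurableSet_Iio).const_mul _),
            lintegral_const_mul _ (hg.indicator measurableSet_Iio)]
          ring
      _ = ∫⁻ s, ∫⁻ t, ENNReal.ofReal C * (e t * (Iio t).indicator g s) ∂μ ∂μ := by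
          refine lintegral_lintegral_swap (Measurable.aemeasurable ?_)
          refine Measurable.const_mul (Measurable.mul (he.comp measurable_fst) ?_) _
          have : (Function.uncurry fun t s : ℝ => (Iio t).indicator g s) =
              {z : ℝ × ℝ | z.2 < z.1}.indicator (fun z => g z.2) := by
            ext z; simp [Function.uncurry, indicator]
          change Measurable (Function.uncurry fun t s : ℝ => (Iio t).indicator g s)
          rw [this]
          exact (hg.comp measurable_snd).indicator
            (measurableSet_lt measurable_snd measurable_fst)
      _ ≤ ∫⁻ s, ENNReal.ofReal C * (g s * (ENNReal.ofReal (1 / (2 * C)) * e s)) ∂μ := by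
          refine lintegral_mono fun s => ?_
          have hm : Measurable fun t : ℝ => e t * (Iio t).indicator g s := by
            have : (fun t : ℝ => (Iio t).indicator g s) = (Ioi s).indicator fun _ => g s := by
              ext z; simp [indicator]
            change Measurable (e * fun t : ℝ => (Iio t).indicator g s)
            rw [this]
            exact he.mul (measurable_const.indicator measurableSet_Ioi)
          rw [lintegral_const_mul _ hm, ← tail]
          gcongr
          rw [← lintegral_const_mul _ he, ← lintegral_indicator measurableSet_Ioi]
          refine (lintegral_mono' Measure.restrict_le_self le_rfl).trans (lintegral_mono fun t => ?_)
          by_cases hts : s < t <;> simp [indicator, hts, mul_comm]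
      _ = ENNReal.ofReal (1 / 2) * I := by
          change _ = _ * ∫⁻ t, e t * g t ∂μ
          rw [← lintegral_const_mul _ (by exact he.mul hg)]
          refine lintegral_congr fun s => ?_
          rw [show (1 / 2 : ℝ) = C * (1 / (2 * C)) by field_simp, ENNReal.ofReal_mul hC.le]
          ring
  have hI : I = 0 := by
    have h3 : I.toReal ≤ 1 / 2 * I.toReal := by
      have := ENNReal.toReal_mono (ENNReal.mul_ne_top ENNReal.ofReal_ne_top hfin2) hle
      rwa [ENNReal.toReal_mul, ENNReal.toReal_ofReal (by norm_num)] at this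
    have h4 : I.toReal = 0 := le_antisymm (by linarith) ENNReal.toReal_nonneg
    exact (ENNReal.toReal_eq_zero_iff _).1 h4 |>.resolve_right hfin2
  have := (lintegral_eq_zero_iff (he.mul hg)).1 hI
  filter_upwards [this] with t ht
  have h5 : e t ≠ 0 := by simp [e, Real.exp_pos]
  exact (mul_eq_zero.1 ht).resolve_left h5

end Gronwall

/-! ### Slices, primitives in one variable, and increments in time. -/

section Slices

theorem ae_of_ae_snd {p : ℝ → Prop} (h : ∀ᵐ x, p x) : ∀ᵐ z : ℝ × ℝ, p z.2 :=
  Measure.quasiMeasurePreserving_snd.ae h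

theorem ae_of_ae_fst {p : ℝ → Prop} (h : ∀ᵐ t, p t) : ∀ᵐ z : ℝ × ℝ, p z.1 :=
  Measure.quasiMeasurePreserving_fst.ae h

theorem ae_slice_fst {p : ℝ × ℝ → Prop} (h : ∀ᵐ z, p z) : ∀ᵐ t, ∀ᵐ x, p (t, x) :=
  Measure.ae_ae_of_ae_prod h

theorem ae_slice_snd {p : ℝ × ℝ → Prop} (h : ∀ᵐ z, p z) : ∀ᵐ x, ∀ᵐ t, p (t, x) :=
  Measure.ae_ae_of_ae_prod (Measure.measurePreserving_swap.quasiMeasurePreserving.ae h)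

theorem integrable_slice_fst {f : ℝ × ℝ → ℝ} (h : Integrable f) :
    ∀ᵐ t, Integrable fun x => f (t, x) :=
  Integrable.prod_right_ae h

theorem integrable_slice_snd {f : ℝ × ℝ → ℝ} (h : Integrable f) :
    ∀ᵐ x, Integrable fun t => f (t, x) :=
  Integrable.prod_left_ae h

theorem ae_shift {p : ℝ × ℝ → Prop} (h : ∀ᵐ z, p z) (s : ℝ) : ∀ᵐ z : ℝ × ℝ, p (z.1 - s, z.2) :=
  (measurePreserving_shift s).quasiMeasurePreserving.ae h

theorem integrable_shift {f : ℝ × ℝ → ℝ} (h : Integrable f) (s : ℝ) :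
    Integrable fun z : ℝ × ℝ => f (z.1 - s, z.2) :=
  (measurePreserving_shift s).integrable_comp_of_integrable h

theorem integral_shift (f : ℝ × ℝ → ℝ) (s : ℝ) :
    ∫ z : ℝ × ℝ, f (z.1 - s, z.2) = ∫ z, f z :=
  (measurePreserving_shift s).integral_comp
    ((MeasurableEquiv.subRight s).prodCongr (MeasurableEquiv.refl ℝ)).measurableEmbedding f

/-- The primitive in the space variable. -/
noncomputable def spacePrim (f : ℝ × ℝ → ℝ) (z : ℝ × ℝ) : ℝ := primitive (fun y => f (z.1, y)) z.2

/-- The primitive in the time variable. -/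
noncomputable def timePrim (f : ℝ × ℝ → ℝ) (z : ℝ × ℝ) : ℝ := primitive (fun s => f (s, z.2)) z.1

theorem measurable_spacePrim {f : ℝ × ℝ → ℝ} (hf : Measurable f) : Measurable (spacePrim f) := by
  have h : Measurable fun w : (ℝ × ℝ) × ℝ =>
      {w : (ℝ × ℝ) × ℝ | w.2 ≤ w.1.2}.indicator (fun w => f (w.1.1, w.2)) w :=
    (hf.comp (by fun_prop)).indicator (measurableSet_le (by fun_prop) (by fun_prop))
  have e : spacePrim f = fun z => ∫ y, {w : (ℝ × ℝ) × ℝ | w.2 ≤ w.1.2}.indicator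
      (fun w => f (w.1.1, w.2)) (z, y) := by
    ext z
    unfold spacePrim primitive
    rw [← integral_indicator measurableSet_Iic]
    rfl
  rw [e]
  exact h.stronglyMeasurable.integral_prod_right'.measurable

theorem measurable_timePrim {f : ℝ × ℝ → ℝ} (hf : Measurable f) : Measurable (timePrim f) :=
  (measurable_spacePrim (f := fun z => f z.swap) (hf.comp measurable_swap)).comp measurable_swap

/-- Increments in time of a function whose time derivative is `-F`. -/
theorem ae_sub_shift {a b : ℝ} {W F : ℝ × ℝ → ℝ} {W₀ : ℝ → ℝ} (hF : Integrable F)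
    (hW : ∀ᵐ z, z.1 ∈ Ioo a b → W z = W₀ z.2 - timePrim F z) (h : ℝ) :
    ∀ᵐ z, z.1 ∈ Ioo a b → z.1 - h ∈ Ioo a b →
      W z - W (z.1 - h, z.2) = -∫ s in (0 : ℝ)..h, F (z.1 - s, z.2) := by
  filter_upwards [hW, ae_shift hW h, ae_of_ae_snd (integrable_slice_snd hF)] with z h1 h2 h3 ht hth
  rw [h1 ht, h2 hth]
  have := primitive_sub h3 (z.1 - h) z.1
  have e := intervalIntegral.integral_comp_sub_left (a := 0) (b := h) (fun s => F (s, z.2)) z.1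
  rw [sub_zero] at e
  rw [e, ← this]
  simp only [timePrim]
  ring

/-- Increments in time of `ξ ∘ W` when the time derivative of `W` is `-F`. -/
theorem ae_comp_sub_shift {a b : ℝ} {W F : ℝ × ℝ → ℝ} {W₀ : ℝ → ℝ} (hF : Integrable F)
    (hW : ∀ᵐ z, z.1 ∈ Ioo a b → W z = W₀ z.2 - timePrim F z) {ξ : ℝ → ℝ} (hξ : ContDiff ℝ 1 ξ)
    {h : ℝ} (hh : 0 ≤ h) :
    ∀ᵐ z, z.1 ∈ Ioo a b → z.1 - h ∈ Ioo a b →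
      ξ (W z) - ξ (W (z.1 - h, z.2)) =
        -∫ s in (0 : ℝ)..h, deriv ξ (W (z.1 - s, z.2)) * F (z.1 - s, z.2) := by
  filter_upwards [hW, ae_shift hW h, ae_of_ae_snd (integrable_slice_snd hF),
    ae_of_ae_snd (ae_slice_snd hW)] with z h1 h2 h3 h4 ht hth
  have hg : ∀ c d, (W₀ z.2 - primitive (fun s => F (s, z.2)) d) -
      (W₀ z.2 - primitive (fun s => F (s, z.2)) c) = ∫ y in c..d, -F (y, z.2) := fun c d => by
    rw [intervalIntegral.integral_neg, ← primitive_sub h3]; ring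
  have hc := comp_sub_eq_integral (g := fun t => W₀ z.2 - primitive (fun s => F (s, z.2)) t)
    h3.neg hg hξ (z.1 - h) z.1
  rw [h1 ht, h2 hth]
  simp only [timePrim]
  rw [hc]
  have e := intervalIntegral.integral_comp_sub_left (a := 0) (b := h)
    (fun s => deriv ξ (W (s, z.2)) * F (s, z.2)) z.1
  rw [sub_zero] at e
  rw [e, ← intervalIntegral.integral_neg]
  refine intervalIntegral.integral_congr_ae ?_
  filter_upwards [h4] with s hs hs'
  rw [uIoc_of_le (by linarith)] at hs'
  rw [hs ⟨hth.1.trans hs'.1, hs'.2.trans_lt ht.2⟩]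
  simp [timePrim]

end Slices

/-! ### Limits of time averages and of difference quotients. -/

section TimeAverages

/-- The last variable ranges over a bounded interval, so a uniform bound on the `L¹` norms of the
slices suffices. -/
theorem integrable_prod_of_bounded_slices {G : (ℝ × ℝ) × ℝ → ℝ} (hG : Measurable G) {C h : ℝ}
    (hi : ∀ s, Integrable fun z => G (z, s)) (hb : ∀ s, ∫ z, ‖G (z, s)‖ ≤ C) :
    Integrable G ((volume : Measure (ℝ × ℝ)).prod (volume.restrict (Ioc 0 h))) := by
  rw [integrable_prod_iff' hG.aestronglyMeasurable]
  refine ⟨ae_of_all _ hi, ?_⟩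
  refine Integrable.of_bound (C := C) ?_ (ae_of_all _ fun s => ?_)
  · exact (hG.norm.stronglyMeasurable.integral_prod_left').aestronglyMeasurable
  · rw [Real.norm_of_nonneg (integral_nonneg fun _ => norm_nonneg _)]
    exact hb s

/-- The averaged function depends on `h` itself; joint convergence at the origin covers this because
`0 < s ≤ h`. -/
theorem tendsto_average {c : ℝ → ℝ → ℝ} {L : ℝ}
    (hc : Tendsto (fun p : ℝ × ℝ => c p.1 p.2) (𝓝 0) (𝓝 L)) {h₀ : ℝ} (h₀pos : 0 < h₀)
    (hi : ∀ h, 0 < h → h < h₀ → IntervalIntegrable (c h) volume 0 h) :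
    Tendsto (fun h => h⁻¹ * ∫ s in (0 : ℝ)..h, c h s) (𝓝[>] 0) (𝓝 L) := by
  rw [Metric.tendsto_nhds]
  intro ε hε
  rw [Metric.tendsto_nhds_nhds] at hc
  obtain ⟨δ, hδ, H⟩ := hc (ε / 2) (by positivity)
  filter_upwards [Ioo_mem_nhdsGT (lt_min hδ h₀pos)] with h hh
  have hh1 := hh.2.trans_le (min_le_left _ _)
  have hh2 := hh.2.trans_le (min_le_right _ _)
  have e : h⁻¹ * (∫ s in (0 : ℝ)..h, c h s) - L = h⁻¹ * ∫ s in (0 : ℝ)..h, (c h s - L) := by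
    rw [intervalIntegral.integral_sub (hi h hh.1 hh2) intervalIntegrable_const,
      intervalIntegral.integral_const, mul_sub]
    have := hh.1.ne'
    simp; field_simp
  rw [Real.dist_eq, e, abs_mul, abs_of_pos (inv_pos.2 hh.1)]
  have hb : ‖∫ s in (0 : ℝ)..h, (c h s - L)‖ ≤ ε / 2 * |h - 0| := by
    refine intervalIntegral.norm_integral_le_of_norm_le_const fun s hs => ?_
    rw [uIoc_of_le hh.1.le] at hs
    have := H (x := (h, s)) (by
      rw [Prod.dist_eq, max_lt_iff]
      simp only [Prod.fst_zero, Prod.snd_zero, Real.dist_eq, sub_zero]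
      rw [abs_of_pos hh.1, abs_of_pos hs.1]
      exact ⟨hh1, hs.2.trans_lt hh1⟩)
    rw [Real.dist_eq] at this
    exact this.le
  rw [sub_zero, abs_of_pos hh.1, Real.norm_eq_abs] at hb
  calc h⁻¹ * |∫ s in (0 : ℝ)..h, (c h s - L)| ≤ h⁻¹ * (ε / 2 * h) := by
        gcongr; exact (inv_pos.2 hh.1).le
    _ = ε / 2 := by field_simp [hh.1.ne']
    _ < ε := by linarith

theorem IsCutoff.abs_sub_le {a b : ℝ} {θ : ℝ → ℝ} (hθ : IsCutoff a b θ) :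
    ∃ C, 0 ≤ C ∧ ∀ x y, |θ x - θ y| ≤ C * |x - y| := by
  obtain ⟨C, hC0, hC⟩ := hθ.deriv.exists_bound
  refine ⟨C, hC0, fun x y => ?_⟩
  exact convex_univ.norm_image_sub_le_of_norm_deriv_le (f := θ)
    (fun z _ => (hθ.hasDerivAt z).differentiableAt) (fun z _ => hC z) (mem_univ y) (mem_univ x)

theorem tendsto_integral_difference_quotient {a b : ℝ} {θ : ℝ → ℝ} (hθ : IsCutoff a b θ)
    {g : ℝ × ℝ → ℝ} (hg : Integrable g) :
    Tendsto (fun h : ℝ => h⁻¹ * ∫ z : ℝ × ℝ, g z * (θ z.1 - θ (z.1 + h))) (𝓝[>] 0)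
      (𝓝 (-∫ z : ℝ × ℝ, g z * deriv θ z.1)) := by
  obtain ⟨C, hC0, hC⟩ := hθ.abs_sub_le
  have e : (-∫ z : ℝ × ℝ, g z * deriv θ z.1) = ∫ z : ℝ × ℝ, g z * -deriv θ z.1 := by
    rw [← integral_neg]; congr 1; ext z; ring
  rw [e]
  have e2 : (fun h : ℝ => h⁻¹ * ∫ z : ℝ × ℝ, g z * (θ z.1 - θ (z.1 + h))) =
      fun h : ℝ => ∫ z : ℝ × ℝ, g z * (h⁻¹ * (θ z.1 - θ (z.1 + h))) := by
    ext h; rw [← integral_const_mul]; congr 1; ext z; ring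
  rw [e2]
  refine tendsto_integral_filter_of_dominated_convergence (fun z => |g z| * C) ?_ ?_
    (hg.abs.mul_const C) ?_
  · refine Eventually.of_forall fun h => hg.1.mul (Measurable.aestronglyMeasurable ?_)
    have := hθ.continuous.measurable
    fun_prop
  · filter_upwards [self_mem_nhdsWithin] with h hh
    replace hh : 0 < h := hh
    refine ae_of_all _ fun z => ?_
    rw [Real.norm_eq_abs, abs_mul]
    refine mul_le_mul_of_nonneg_left ?_ (abs_nonneg _)
    have h1 := hC z.1 (z.1 + h)
    rw [show z.1 - (z.1 + h) = -h by ring, abs_neg, abs_of_pos hh] at h1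
    rw [abs_mul, abs_of_pos (inv_pos.2 hh)]
    rw [inv_mul_le_iff₀ hh]; linarith
  · refine ae_of_all _ fun z => Tendsto.const_mul _ ?_
    have h1 := (hθ.hasDerivAt z.1).tendsto_slope_zero_right
    refine h1.neg.congr fun h => ?_
    simp only [smul_eq_mul]; ring

end TimeAverages

/-! ### The momentum balance tested with functions of the mass coordinate. -/

section Lagrangian

variable {a b : ℝ} {A j ρ F : ℝ × ℝ → ℝ} {M₀ Q₀ θ ξ : ℝ → ℝ} {c d α β B : ℝ}

/-- Increment in time of a momentum tested with a function of the mass coordinate. -/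
theorem integral_increment (hA : Integrable A) (hj : Integrable j)
    (hF : Integrable F) (hρm : Measurable ρ)
    (hρi : ∀ t, Integrable fun x => ρ (t, x))
    (hM : ∀ᵐ z, z.1 ∈ Ioo a b → spacePrim ρ z = M₀ z.2 - timePrim j z)
    (hQ : ∀ᵐ z, z.1 ∈ Ioo a b → spacePrim A z = Q₀ z.2 - timePrim F z)
    (hξ : IsCutoff α β ξ) (hξm : ∀ t, ξ (∫ x, ρ (t, x)) = 0) {h : ℝ} (hh : 0 ≤ h) :
    ∀ᵐ t, t ∈ Ioo a b → t - h ∈ Ioo a b →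
      ∫ x, (A (t, x) * ξ (spacePrim ρ (t, x)) - A (t - h, x) * ξ (spacePrim ρ (t - h, x))) =
      ∫ x, (deriv ξ (spacePrim ρ (t, x)) * ρ (t, x) * (∫ s in (0 : ℝ)..h, F (t - s, x)) -
        A (t - h, x) * ∫ s in (0 : ℝ)..h,
          deriv ξ (spacePrim ρ (t - s, x)) * j (t - s, x)) := by
  have hξ1 : ContDiff ℝ 1 ξ := hξ.1.of_le (by exact_mod_cast le_top)
  obtain ⟨C, hC0, hC⟩ := hξ.exists_bound
  obtain ⟨C', hC'0, hC'⟩ := hξ.deriv.exists_bound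
  have hSm := measurable_spacePrim hρm
  filter_upwards [ae_slice_fst (ae_sub_shift hF hQ h),
    ae_slice_fst (ae_comp_sub_shift hj hM hξ1 hh), integrable_slice_fst hA,
    integrable_slice_fst (integrable_shift hA h)] with t h1 h2 h3 h4 ht hth
  -- The increment of the momentum is an `x`-derivative, known through its primitive; integration by
  -- parts in space will move that derivative onto `ξ`.
  have e1 : ∀ᵐ x, primitive (fun y => A (t, y) - A (t - h, y)) x =
      -∫ s in (0 : ℝ)..h, F (t - s, x) := by
    filter_upwards [h1] with x hx
    rw [primitive_sub_fun h3 h4]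
    exact hx ht hth
  have ibp := integral_mul_comp_primitive (h3.sub h4) (hρi t) hξ1
  rw [hξm t, mul_zero, zero_sub] at ibp
  have m1 : Measurable fun x => ξ (spacePrim ρ (t, x)) :=
    hξ.continuous.measurable.comp (hSm.comp (by fun_prop))
  have m2 : Measurable fun x => ξ (spacePrim ρ (t - h, x)) :=
    hξ.continuous.measurable.comp (hSm.comp (by fun_prop))
  have i1 : Integrable fun x => (A (t, x) - A (t - h, x)) * ξ (spacePrim ρ (t, x)) :=
    (h3.sub h4).mul_bdd (c := C) m1.aestronglyMeasurable (ae_of_all _ fun x => hC _)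
  have i2 : Integrable fun x => A (t - h, x) * (ξ (spacePrim ρ (t, x)) -
      ξ (spacePrim ρ (t - h, x))) :=
    h4.mul_bdd (c := 2 * C) (m1.sub m2).aestronglyMeasurable (ae_of_all _ fun x => by
      have := abs_sub (ξ (spacePrim ρ (t, x))) (ξ (spacePrim ρ (t - h, x)))
      rw [Real.norm_eq_abs]
      linarith [hC (spacePrim ρ (t, x)), hC (spacePrim ρ (t - h, x))])
  have i3 : Integrable fun x => primitive (fun y => A (t, y) - A (t - h, y)) x *
      (deriv ξ (spacePrim ρ (t, x)) * ρ (t, x)) := by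
    refine Integrable.bdd_mul (c := ∫ y, |A (t, y) - A (t - h, y)|)
      ((hρi t).bdd_mul (c := C')
        (hξ.deriv.continuous.measurable.comp (hSm.comp (by fun_prop))).aestronglyMeasurable
        (ae_of_all _ fun x => hC' _))
      (continuous_primitive (h3.sub h4)).aestronglyMeasurable
      (ae_of_all _ fun x => abs_primitive_le (h3.sub h4) x)
  -- A discrete product rule. The increment of `A` is treated in space, and that of `ξ` by the chain
  -- rule in time, so no product of distributions appears.
  have s1 : ∫ x, (A (t, x) * ξ (spacePrim ρ (t, x)) - A (t - h, x) * ξ (spacePrim ρ (t - h, x))) =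
      (∫ x, (A (t, x) - A (t - h, x)) * ξ (spacePrim ρ (t, x))) +
      ∫ x, A (t - h, x) * (ξ (spacePrim ρ (t, x)) - ξ (spacePrim ρ (t - h, x))) := by
    rw [← integral_add i1 i2]
    congr 1; ext x; ring
  have ibp' : ∫ x, (A (t, x) - A (t - h, x)) * ξ (spacePrim ρ (t, x)) =
      -∫ x, primitive (fun y => A (t, y) - A (t - h, y)) x *
      (deriv ξ (spacePrim ρ (t, x)) * ρ (t, x)) := ibp
  rw [s1, ibp', neg_add_eq_sub, ← integral_sub i2 i3]
  refine integral_congr_ae ?_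
  filter_upwards [e1, h2] with x hx1 hx2
  have hx3 := hx2 ht hth
  rw [hx1, hx3]
  ring

/-- The momentum balance in mass coordinates. -/
theorem integral_momentum_mass_coordinate (hAm : Measurable A) (hA : Integrable A)
    (hA2 : MemLp A 2) (hjm : Measurable j) (hj : Integrable j) (hj2 : MemLp j 2)
    (hFm : Measurable F) (hF : Integrable F) (hρm : Measurable ρ) (hρb : ∀ᵐ z, |ρ z| ≤ B)
    (hρi : ∀ t, Integrable fun x => ρ (t, x))
    (hM : ∀ᵐ z, z.1 ∈ Ioo a b → spacePrim ρ z = M₀ z.2 - timePrim j z)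
    (hQ : ∀ᵐ z, z.1 ∈ Ioo a b → spacePrim A z = Q₀ z.2 - timePrim F z)
    (hξ : IsCutoff α β ξ) (hξm : ∀ t, ξ (∫ x, ρ (t, x)) = 0)
    (hθ : IsCutoff c d θ) (hac : a < c) (hdb : d < b) :
    ∫ z, A z * ξ (spacePrim ρ z) * deriv θ z.1 =
      -∫ z, θ z.1 * deriv ξ (spacePrim ρ z) * (ρ z * F z - A z * j z) := by
  obtain ⟨C, hC0, hC⟩ := hξ.exists_bound
  obtain ⟨C', hC'0, hC'⟩ := hξ.deriv.exists_bound
  obtain ⟨D, hD0, hD⟩ := hθ.exists_bound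
  have hSm := measurable_spacePrim hρm
  set k : ℝ × ℝ → ℝ := fun z => deriv ξ (spacePrim ρ z) * j z with hk
  have hdξm : Measurable fun z => deriv ξ (spacePrim ρ z) :=
    hξ.deriv.continuous.measurable.comp hSm
  have hξSm : Measurable fun z => ξ (spacePrim ρ z) := hξ.continuous.measurable.comp hSm
  have hθm : Measurable fun z : ℝ × ℝ => θ z.1 := hθ.continuous.measurable.comp measurable_fst
  have hkm : Measurable k := hdξm.mul hjm
  have hk2 : MemLp k 2 :=
    hj2.of_le_mul (c := C') hkm.aestronglyMeasurable (ae_of_all _ fun z => by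
      rw [norm_mul]; exact mul_le_mul_of_nonneg_right (hC' _) (norm_nonneg _))
  set w : ℝ × ℝ → ℝ := fun z => θ z.1 * (deriv ξ (spacePrim ρ z) * ρ z) with hw
  have hwm : Measurable w := hθm.mul (hdξm.mul hρm)
  have hwb : ∀ᵐ z, ‖w z‖ ≤ D * (C' * B) := by
    filter_upwards [hρb] with z hz
    rw [hw, norm_mul, norm_mul]
    exact mul_le_mul (hD _) (mul_le_mul (hC' _) hz (norm_nonneg _) hC'0) (by positivity) hD0
  have hwT : MemLp w ⊤ := memLp_top_of_bound hwm.aestronglyMeasurable _ hwb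
  have hg : Integrable fun z => A z * ξ (spacePrim ρ z) :=
    hA.mul_bdd (c := C) hξSm.aestronglyMeasurable (ae_of_all _ fun z => hC _)
  -- The two pairings produced by the increment formula. In the first, a bounded function meets a
  -- translate of `F ∈ L¹`; in the second, two `L²` functions are translated independently. Both
  -- therefore converge as the shifts vanish.
  let c₁ : ℝ → ℝ := fun s => ∫ z : ℝ × ℝ, w z * F (z.1 - s, z.2)
  let c₂ : ℝ → ℝ → ℝ := fun h s => ∫ z : ℝ × ℝ, θ z.1 * A (z.1 - h, z.2) * k (z.1 - s, z.2)
  have hshm : ∀ h : ℝ, Measurable fun z : ℝ × ℝ => (z.1 - h, z.2) := fun h => by fun_prop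
  have hAθ : ∀ h : ℝ, MemLp (fun z : ℝ × ℝ => θ z.1 * A (z.1 - h, z.2)) 2 := fun h =>
    (hA2.comp_measurePreserving (measurePreserving_shift h)).of_le_mul (c := D)
      (hθm.mul (hAm.comp (hshm h))).aestronglyMeasurable (ae_of_all _ fun z => by
        rw [norm_mul]; exact mul_le_mul_of_nonneg_right (hD _) (norm_nonneg _))
  have hAθ0 : MemLp (fun z : ℝ × ℝ => θ z.1 * A z) 2 := by simpa using hAθ 0
  have l1 : Tendsto c₁ (𝓝 0) (𝓝 (∫ z, w z * F z)) := by
    refine tendsto_integral_mul_of_eLpNorm (p := ⊤) (q := 1) (a := fun _ => w) (a₀ := w)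
      (fun _ => hwT) hwT (fun s => memLp_one_iff_integrable.2 (integrable_shift hF s))
      (memLp_one_iff_integrable.2 hF) ?_ ?_
    · simp only [sub_self, eLpNorm_zero']
      exact tendsto_const_nhds
    · exact tendsto_eLpNorm_shift le_rfl (by simp) (memLp_one_iff_integrable.2 hF)
  have l2 : Tendsto (fun p : ℝ × ℝ => c₂ p.1 p.2) (𝓝 0) (𝓝 (∫ z, θ z.1 * A z * k z)) := by
    refine tendsto_integral_mul_of_eLpNorm (p := 2) (q := 2)
      (a := fun (p : ℝ × ℝ) (z : ℝ × ℝ) => θ z.1 * A (z.1 - p.1, z.2))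
      (b := fun (p : ℝ × ℝ) (z : ℝ × ℝ) => k (z.1 - p.2, z.2))
      (fun p => hAθ p.1) hAθ0
      (fun p => hk2.comp_measurePreserving (measurePreserving_shift p.2)) hk2 ?_ ?_
    · have t1 := (tendsto_eLpNorm_shift (p := 2) (by norm_num) (by simp) hA2).comp
        (continuous_fst.tendsto (0 : ℝ × ℝ))
      have t2 := ENNReal.Tendsto.const_mul (a := ENNReal.ofReal D) t1
        (Or.inr ENNReal.ofReal_ne_top)
      rw [mul_zero] at t2
      refine tendsto_of_tendsto_of_tendsto_of_le_of_le tendsto_const_nhds t2 (fun _ => zero_le)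
        fun p => ?_
      refine eLpNorm_le_mul_eLpNorm_of_ae_le_mul (ae_of_all _ fun z => ?_) 2
      rw [← mul_sub, norm_mul]
      exact mul_le_mul_of_nonneg_right (hD _) (norm_nonneg _)
    · exact (tendsto_eLpNorm_shift (p := 2) (by norm_num) (by simp) hk2).comp
        (continuous_snd.tendsto (0 : ℝ × ℝ))
  have hI1 : ∀ h : ℝ, Integrable (fun p : (ℝ × ℝ) × ℝ => w p.1 * F (p.1.1 - p.2, p.1.2))
      ((volume : Measure (ℝ × ℝ)).prod (volume.restrict (Ioc 0 h))) := fun h => by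
    have hi : ∀ s : ℝ, Integrable fun z : ℝ × ℝ => w z * F (z.1 - s, z.2) := fun s =>
      (integrable_shift hF s).bdd_mul hwm.aestronglyMeasurable hwb
    refine integrable_prod_of_bounded_slices
      (G := fun p : (ℝ × ℝ) × ℝ => w p.1 * F (p.1.1 - p.2, p.1.2))
      (C := D * (C' * B) * ∫ z, ‖F z‖)
      ((hwm.comp measurable_fst).mul (hFm.comp (by fun_prop))) hi fun s => ?_
    rw [← integral_shift (fun z => ‖F z‖) s, ← integral_const_mul]
    refine integral_mono_ae (hi s).norm ((integrable_shift hF s).norm.const_mul _) ?_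
    filter_upwards [hwb] with z hz
    rw [norm_mul]
    exact mul_le_mul_of_nonneg_right hz (norm_nonneg _)
  have hI2 : ∀ h : ℝ, Integrable (fun p : (ℝ × ℝ) × ℝ =>
      θ p.1.1 * A (p.1.1 - h, p.1.2) * k (p.1.1 - p.2, p.1.2))
      ((volume : Measure (ℝ × ℝ)).prod (volume.restrict (Ioc 0 h))) := fun h => by
    have hks : ∀ s : ℝ, MemLp (fun z : ℝ × ℝ => k (z.1 - s, z.2)) 2 := fun s =>
      hk2.comp_measurePreserving (measurePreserving_shift s)
    have hi : ∀ s : ℝ, Integrable fun z : ℝ × ℝ =>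
        θ z.1 * A (z.1 - h, z.2) * k (z.1 - s, z.2) := fun s => (hAθ h).integrable_mul (hks s)
    have hsqk : ∀ s : ℝ, ∫ z : ℝ × ℝ, ‖k (z.1 - s, z.2)‖ ^ 2 = ∫ z, ‖k z‖ ^ 2 := fun s =>
      integral_shift (fun z => ‖k z‖ ^ 2) s
    refine integrable_prod_of_bounded_slices (G := fun p : (ℝ × ℝ) × ℝ =>
        θ p.1.1 * A (p.1.1 - h, p.1.2) * k (p.1.1 - p.2, p.1.2))
      (C := (∫ z : ℝ × ℝ, ‖θ z.1 * A (z.1 - h, z.2)‖ ^ 2) + ∫ z, ‖k z‖ ^ 2)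
      (Measurable.mul (Measurable.mul (hθm.comp measurable_fst) (hAm.comp (by fun_prop)))
        (hkm.comp (by fun_prop))) hi fun s => ?_
    rw [← hsqk s, ← integral_add (hAθ h).norm.integrable_sq (hks s).norm.integrable_sq]
    refine integral_mono (hi s).norm
      ((hAθ h).norm.integrable_sq.add (hks s).norm.integrable_sq) fun z => ?_
    rw [norm_mul _ (k _)]
    nlinarith [sq_nonneg (‖θ z.1 * A (z.1 - h, z.2)‖ - ‖k (z.1 - s, z.2)‖),
      sq_nonneg ‖θ z.1 * A (z.1 - h, z.2)‖, sq_nonneg ‖k (z.1 - s, z.2)‖]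
  have hcint : ∀ h : ℝ, 0 < h → IntervalIntegrable (fun s => c₁ s - c₂ h s) volume 0 h := by
    intro h hh
    rw [intervalIntegrable_iff, uIoc_of_le hh.le]
    exact (hI1 h).integral_prod_right.sub (hI2 h).integral_prod_right
  -- The condition `h < c - a` keeps `t - h` inside `(a,b)` for `t` in the support of `θ`.
  have hmain : ∀ h : ℝ, 0 < h → h < c - a →
      ∫ z, A z * ξ (spacePrim ρ z) * (θ z.1 - θ (z.1 + h)) =
        ∫ s in (0 : ℝ)..h, (c₁ s - c₂ h s) := by
    intro h hh hhc
    have hgs := integrable_shift hg h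
    have b1 : Integrable fun z : ℝ × ℝ => θ z.1 * (A z * ξ (spacePrim ρ z)) :=
      hg.bdd_mul hθm.aestronglyMeasurable (ae_of_all _ fun z => hD _)
    have b2 : Integrable fun z : ℝ × ℝ =>
        θ z.1 * (A (z.1 - h, z.2) * ξ (spacePrim ρ (z.1 - h, z.2))) :=
      hgs.bdd_mul hθm.aestronglyMeasurable (ae_of_all _ fun z => hD _)
    have b3 : Integrable fun z : ℝ × ℝ => A z * ξ (spacePrim ρ z) * θ (z.1 + h) :=
      hg.mul_bdd (hθ.continuous.measurable.comp (by fun_prop)).aestronglyMeasurable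
        (ae_of_all _ fun z => hD _)
    -- Translation invariance transfers the difference from `θ` to the tested momentum.
    have step1 : ∫ z, A z * ξ (spacePrim ρ z) * (θ z.1 - θ (z.1 + h)) =
        ∫ z : ℝ × ℝ, (θ z.1 * (A z * ξ (spacePrim ρ z)) -
          θ z.1 * (A (z.1 - h, z.2) * ξ (spacePrim ρ (z.1 - h, z.2)))) := by
      rw [integral_sub b1 b2]
      have := integral_shift (fun z => A z * ξ (spacePrim ρ z) * θ (z.1 + h)) h
      simp only [sub_add_cancel] at this
      have e : ∫ z : ℝ × ℝ, θ z.1 * (A (z.1 - h, z.2) * ξ (spacePrim ρ (z.1 - h, z.2))) =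
          ∫ z : ℝ × ℝ, A z * ξ (spacePrim ρ z) * θ (z.1 + h) := by
        rw [← this]; congr 1; ext z; ring
      rw [e, ← integral_sub b1 b3]
      congr 1; ext z; ring
    let G : (ℝ × ℝ) × ℝ → ℝ := fun p => w p.1 * F (p.1.1 - p.2, p.1.2) -
      θ p.1.1 * A (p.1.1 - h, p.1.2) * k (p.1.1 - p.2, p.1.2)
    have hG : Integrable G ((volume : Measure (ℝ × ℝ)).prod (volume.restrict (Ioc 0 h))) :=
      (hI1 h).sub (hI2 h)
    have step2 : ∫ z : ℝ × ℝ, (θ z.1 * (A z * ξ (spacePrim ρ z)) -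
          θ z.1 * (A (z.1 - h, z.2) * ξ (spacePrim ρ (z.1 - h, z.2)))) =
        ∫ z : ℝ × ℝ, ∫ s in Ioc 0 h, G (z, s) := by
      have hGz := hG.integral_prod_left
      have b12 : Integrable fun z : ℝ × ℝ => θ z.1 * (A z * ξ (spacePrim ρ z)) -
          θ z.1 * (A (z.1 - h, z.2) * ξ (spacePrim ρ (z.1 - h, z.2))) := b1.sub b2
      rw [Measure.volume_eq_prod] at b12 hGz ⊢
      rw [integral_prod _ b12, integral_prod _ hGz]
      refine integral_congr_ae ?_
      filter_upwards [integral_increment hA hj hF hρm hρi hM hQ hξ hξm hh.le,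
        ae_slice_fst hG.prod_right_ae, ae_slice_fst (hI1 h).prod_right_ae,
        ae_slice_fst (hI2 h).prod_right_ae] with t ht hgt h1t h2t
      by_cases hθt : θ t = 0
      · simp [G, hw, hθt]
      have htcd : t ∈ Icc c d := by by_contra h'; exact hθt (hθ.2 t h')
      have ht' := ht ⟨hac.trans_le htcd.1, htcd.2.trans_lt hdb⟩
        ⟨by linarith [htcd.1], by linarith [htcd.2]⟩
      have e1 : ∫ x, (θ t * (A (t, x) * ξ (spacePrim ρ (t, x))) -
          θ t * (A (t - h, x) * ξ (spacePrim ρ (t - h, x)))) =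
          θ t * ∫ x, (A (t, x) * ξ (spacePrim ρ (t, x)) -
            A (t - h, x) * ξ (spacePrim ρ (t - h, x))) := by
        rw [← integral_const_mul]; congr 1; ext x; ring
      rw [e1, ht', ← integral_const_mul]
      refine integral_congr_ae ?_
      filter_upwards [h1t, h2t] with x h1x h2x
      rw [integral_sub h1x h2x, integral_const_mul, integral_const_mul,
        intervalIntegral.integral_of_le hh.le, intervalIntegral.integral_of_le hh.le]
      simp only [hw]
      ring
    have hswap : ∫ z : ℝ × ℝ, ∫ s in Ioc 0 h, G (z, s) = ∫ s in Ioc 0 h, ∫ z, G (z, s) :=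
      integral_integral_swap (f := fun z s => G (z, s)) hG
    rw [step1, step2, hswap, intervalIntegral.integral_of_le hh.le]
    refine integral_congr_ae ?_
    filter_upwards [(hI1 h).prod_left_ae, (hI2 h).prod_left_ae] with s h1s h2s
    exact integral_sub h1s h2s
  have lim1 := tendsto_integral_difference_quotient hθ hg
  -- Dividing by `h`, the difference quotient of `θ` converges on one side and the time average of
  -- the pairings on the other.
  have l12 : Tendsto (fun p : ℝ × ℝ => c₁ p.2 - c₂ p.1 p.2) (𝓝 0)
      (𝓝 ((∫ z, w z * F z) - ∫ z, θ z.1 * A z * k z)) :=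
    (l1.comp (continuous_snd.tendsto (0 : ℝ × ℝ))).sub l2
  have lim2 := tendsto_average (c := fun h s => c₁ s - c₂ h s) l12 (sub_pos.2 hac)
    fun h hh _ => hcint h hh
  have heq := tendsto_nhds_unique lim1 (lim2.congr' (by
    filter_upwards [Ioo_mem_nhdsGT (sub_pos.2 hac)] with h hh
    rw [hmain h hh.1 hh.2]))
  have i1 : Integrable fun z => w z * F z := hF.bdd_mul hwm.aestronglyMeasurable hwb
  have i2 : Integrable fun z => θ z.1 * A z * k z := hAθ0.integrable_mul hk2
  rw [neg_eq_iff_eq_neg] at heq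
  rw [heq, ← integral_sub i1 i2]
  congr 1
  refine integral_congr_ae (ae_of_all _ fun z => ?_)
  simp only [hw, hk]
  ring

end Lagrangian

/-! ### Quantile functions and their comparison with distribution functions. -/

section Quantile

/-- A nonnegative density of total mass `m`. -/
structure IsDensity (m : ℝ) (r : ℝ → ℝ) : Prop where
  measurable : Measurable r
  integrable : Integrable r
  nonneg : ∀ᵐ x, 0 ≤ r x
  mass : ∫ x, r x = m

/-- The quantile function of a density of mass `m`, set to `0` outside `(0,m)`. -/
noncomputable def quantile (m : ℝ) (r : ℝ → ℝ) (s : ℝ) : ℝ :=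
  open Classical in if s ∈ Ioo 0 m then sInf {x | s ≤ primitive r x} else 0

variable {m : ℝ} {r r' : ℝ → ℝ}

/-- The Galois connection between quantile and distribution function. The set defining the infimum
is nonempty and bounded below since `0 < s < m`, and closed since the distribution function is
continuous, so the infimum is attained. -/
theorem IsDensity.quantile_le_iff (h : IsDensity m r) {s : ℝ} (hs : s ∈ Ioo 0 m) (x : ℝ) :
    quantile m r s ≤ x ↔ s ≤ primitive r x := by
  have hq : quantile m r s = sInf {x | s ≤ primitive r x} := if_pos hs
  have hne : {x | s ≤ primitive r x}.Nonempty := by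
    have h1 := tendsto_primitive_atTop h.integrable
    rw [h.mass] at h1
    obtain ⟨x, hx⟩ := (h1.eventually (lt_mem_nhds hs.2)).exists
    exact ⟨x, le_of_lt hx⟩
  have hbd : BddBelow {x | s ≤ primitive r x} := by
    obtain ⟨y, hy⟩ := ((tendsto_primitive_atBot r).eventually (gt_mem_nhds hs.1)).exists
    refine ⟨y, fun x hx => ?_⟩
    by_contra hxy
    exact absurd (hx.trans (primitive_mono h.integrable h.nonneg (not_le.1 hxy).le)) (not_le.2 hy)
  have hcl : IsClosed {x | s ≤ primitive r x} :=
    isClosed_le continuous_const (continuous_primitive h.integrable)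
  rw [hq]
  constructor
  · intro hx
    exact le_trans (hcl.csInf_mem hne hbd) (primitive_mono h.integrable h.nonneg hx)
  · exact fun hx => csInf_le hbd hx

/-- A density has no atoms, so its distribution function cannot jump over `s`: points to the left of
the quantile have value below `s`, and continuity passes this to the limit. -/
theorem IsDensity.primitive_quantile (h : IsDensity m r) {s : ℝ} (hs : s ∈ Ioo 0 m) :
    primitive r (quantile m r s) = s := by
  refine le_antisymm ?_ ((h.quantile_le_iff hs _).1 le_rfl)
  refine le_of_tendsto ((continuous_primitive h.integrable).continuousWithinAt
    (s := Iio (quantile m r s))) ?_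
  filter_upwards [self_mem_nhdsWithin] with x hx
  by_contra hlt
  exact absurd ((h.quantile_le_iff hs x).2 (not_le.1 hlt).le) (not_le.2 hx)

theorem IsDensity.measurable_quantile (h : IsDensity m r) : Measurable (quantile m r) := by
  refine measurable_of_Iic fun x => ?_
  have e : quantile m r ⁻¹' Iic x =
      (Ioo 0 m ∩ Iic (primitive r x)) ∪ ((Ioo 0 m)ᶜ ∩ {_s | 0 ≤ x}) := by
    ext s
    by_cases hs : s ∈ Ioo 0 m
    · simp [hs, h.quantile_le_iff hs]
    · simp [hs, quantile]
  rw [e]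
  exact (measurableSet_Ioo.inter measurableSet_Iic).union
    (measurableSet_Ioo.compl.inter (MeasurableSet.const _))

/-- By the Galois connection, the preimage of a half-line `(-∞,x]` in `(0,m)` is the part of `(0,m)`
up to the distribution function at `x`; half-lines determine a finite measure. -/
theorem IsDensity.map_quantile (h : IsDensity m r) :
    (volume.restrict (Ioo 0 m)).map (quantile m r) =
      volume.withDensity fun x => ENNReal.ofReal (r x) := by
  refine Measure.ext_of_Iic _ _ fun x => ?_
  rw [Measure.map_apply h.measurable_quantile measurableSet_Iic,
    Measure.restrict_apply (h.measurable_quantile measurableSet_Iic),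
    withDensity_apply _ measurableSet_Iic,
    ← ofReal_integral_eq_lintegral_ofReal h.integrable.integrableOn (ae_restrict_of_ae h.nonneg)]
  have e : quantile m r ⁻¹' Iic x ∩ Ioo 0 m = Ioo 0 m ∩ Iic (primitive r x) := by
    ext s
    simp only [mem_inter_iff, mem_preimage, mem_Iic]
    constructor
    · exact fun hs => ⟨hs.2, (h.quantile_le_iff hs.2 x).1 hs.1⟩
    · exact fun hs => ⟨(h.quantile_le_iff hs.1 x).2 hs.2, hs.1⟩
  have hle : primitive r x ≤ m := h.mass ▸ primitive_le_integral h.integrable h.nonneg x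
  rw [e]
  change _ = ENNReal.ofReal (primitive r x)
  rcases hle.lt_or_eq with hlt | heq
  · have e2 : Ioo 0 m ∩ Iic (primitive r x) = Ioc 0 (primitive r x) := by
      ext s
      simp only [mem_inter_iff, mem_Ioo, mem_Iic, mem_Ioc]
      constructor
      · exact fun hs => ⟨hs.1.1, hs.2⟩
      · exact fun hs => ⟨⟨hs.1, hs.2.trans_lt hlt⟩, hs.2⟩
    rw [e2, Real.volume_Ioc, sub_zero]
  · have e2 : Ioo 0 m ∩ Iic (primitive r x) = Ioo 0 m :=
      inter_eq_left.2 fun s hs => heq ▸ hs.2.le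
    rw [e2, Real.volume_Ioo, sub_zero, heq]

theorem IsDensity.lintegral_quantile (h : IsDensity m r) {f : ℝ → ℝ≥0∞} (hf : Measurable f) :
    ∫⁻ s in Ioo 0 m, f (quantile m r s) = ∫⁻ x, ENNReal.ofReal (r x) * f x := by
  rw [← lintegral_map hf h.measurable_quantile, h.map_quantile,
    lintegral_withDensity_eq_lintegral_mul _ h.measurable.ennreal_ofReal hf]
  rfl

theorem IsDensity.integral_quantile (h : IsDensity m r) {f : ℝ → ℝ} (hf : Measurable f) :
    ∫ s in Ioo 0 m, f (quantile m r s) = ∫ x, r x * f x := by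
  rw [← integral_map h.measurable_quantile.aemeasurable hf.aestronglyMeasurable, h.map_quantile,
    integral_withDensity_eq_integral_toReal_smul h.measurable.ennreal_ofReal
      (ae_of_all _ fun _ => ENNReal.ofReal_lt_top)]
  refine integral_congr_ae ?_
  filter_upwards [h.nonneg] with x hx
  rw [ENNReal.toReal_ofReal hx, smul_eq_mul]

theorem IsDensity.integrableOn_quantile (h : IsDensity m r) {f : ℝ → ℝ} (hf : Measurable f)
    (hi : Integrable fun x => r x * f x) :
    IntegrableOn (fun s => f (quantile m r s)) (Ioo 0 m) := by
  refine ⟨(hf.comp h.measurable_quantile).aestronglyMeasurable, ?_⟩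
  rw [hasFiniteIntegral_iff_enorm,
    h.lintegral_quantile (f := fun x => ‖f x‖ₑ) hf.enorm]
  refine lt_of_le_of_lt (lintegral_mono_ae ?_) hi.2
  filter_upwards [h.nonneg] with x hx
  rw [enorm_mul, Real.enorm_eq_ofReal hx]

theorem measurable_realSign : Measurable Real.sign :=
  Measurable.ite measurableSet_Iio measurable_const
    (Measurable.ite measurableSet_Ioi measurable_const measurable_const)

theorem abs_realSign_le (x : ℝ) : |Real.sign x| ≤ 1 := by
  rcases Real.sign_apply_eq x with h | h | h <;> simp [h]

/-- At the two quantiles of a generic mass coordinate the difference of the distribution functions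
has the same sign. -/
theorem IsDensity.ae_sign_quantile (h : IsDensity m r) (h' : IsDensity m r') :
    ∀ᵐ s ∂(volume.restrict (Ioo 0 m)),
      Real.sign (primitive r (quantile m r s) - primitive r' (quantile m r s)) =
      Real.sign (primitive r (quantile m r' s) - primitive r' (quantile m r' s)) := by
  -- A monotone function takes only countably many values more than once. Discarding these mass
  -- coordinates excludes the plateaus, on which one of the two signs could be zero.
  have c1 := (primitive_mono h.integrable h.nonneg).countable_setOfPred_two_preimages
  have c2 := (primitive_mono h'.integrable h'.nonneg).countable_setOfPred_two_preimages
  filter_upwards [ae_restrict_mem measurableSet_Ioo, ae_restrict_of_ae (c1.ae_notMem _),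
    ae_restrict_of_ae (c2.ae_notMem _)] with s hs n1 n2
  have p1 := h.primitive_quantile hs
  have p2 := h'.primitive_quantile hs
  rw [p1, p2]
  rcases lt_trichotomy (quantile m r s) (quantile m r' s) with hlt | heq | hgt
  · have a1 : primitive r' (quantile m r s) < s := by
      by_contra hh
      exact absurd ((h'.quantile_le_iff hs _).2 (not_lt.1 hh)) (not_le.2 hlt)
    -- Equality would make `s` a value attained at both quantiles, that is, a plateau of the
    -- distribution function of `r`.
    have a2 : s < primitive r (quantile m r' s) := by
      refine lt_of_le_of_ne ((h.quantile_le_iff hs _).1 hlt.le) fun hh => n1 ?_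
      exact ⟨_, _, hlt, p1, hh.symm⟩
    rw [Real.sign_of_pos (by linarith), Real.sign_of_pos (by linarith)]
  · rw [← heq, p1, heq, p2]
  · have a1 : primitive r (quantile m r' s) < s := by
      by_contra hh
      exact absurd ((h.quantile_le_iff hs _).2 (not_lt.1 hh)) (not_le.2 hgt)
    have a2 : s < primitive r' (quantile m r s) := by
      refine lt_of_le_of_ne ((h'.quantile_le_iff hs _).1 hgt.le) fun hh => n2 ?_
      exact ⟨_, _, hgt, p2, hh.symm⟩
    rw [Real.sign_of_neg (by linarith), Real.sign_of_neg (by linarith)]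

/-- The momentum difference tested with the sign of the difference of the distribution functions
is controlled by the velocity difference in mass coordinates. -/
theorem IsDensity.neg_integral_sign_le (h : IsDensity m r) (h' : IsDensity m r') {v v' : ℝ → ℝ}
    (hv : Measurable v) (hv' : Measurable v') (hi : Integrable fun x => r x * v x)
    (hi' : Integrable fun x => r' x * v' x) :
    -∫ x, Real.sign (primitive r x - primitive r' x) * (r x * v x - r' x * v' x) ≤
      ∫ s in Ioo 0 m, |v (quantile m r s) - v' (quantile m r' s)| := by
  set σ : ℝ → ℝ := fun x => Real.sign (primitive r x - primitive r' x)
  have hσm : Measurable σ := measurable_realSign.comp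
    ((continuous_primitive h.integrable).sub (continuous_primitive h'.integrable)).measurable
  have hσb : ∀ x, ‖σ x‖ ≤ 1 := fun x => abs_realSign_le _
  have i1 : Integrable fun x => r x * (σ x * v x) := by
    refine (hi.bdd_mul hσm.aestronglyMeasurable (ae_of_all _ hσb)).congr (ae_of_all _ fun x => ?_)
    ring
  have i2 : Integrable fun x => r' x * (σ x * v' x) := by
    refine (hi'.bdd_mul hσm.aestronglyMeasurable (ae_of_all _ hσb)).congr
      (ae_of_all _ fun x => ?_)
    ring
  have q1 : IntegrableOn (fun s => σ (quantile m r s) * v (quantile m r s)) (Ioo 0 m) :=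
    h.integrableOn_quantile (hσm.mul hv) i1
  have q2 : IntegrableOn (fun s => σ (quantile m r' s) * v' (quantile m r' s)) (Ioo 0 m) :=
    h'.integrableOn_quantile (hσm.mul hv') i2
  have d1 := h.integrableOn_quantile hv hi
  have d2 := h'.integrableOn_quantile hv' hi'
  have e : ∫ x, σ x * (r x * v x - r' x * v' x) =
      ∫ s in Ioo 0 m, (σ (quantile m r s) * v (quantile m r s) -
        σ (quantile m r' s) * v' (quantile m r' s)) := by
    have e1 := h.integral_quantile (hσm.mul hv)
    have e2 := h'.integral_quantile (hσm.mul hv')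
    simp only [Pi.mul_apply] at e1 e2
    rw [integral_sub q1 q2, e1, e2, ← integral_sub i1 i2]
    congr 1; ext x; ring
  rw [e, ← integral_neg]
  refine integral_mono_ae (q1.sub q2).neg (d1.sub d2).abs ?_
  -- The common sign factors out of the difference of velocities. Without this agreement there would
  -- be a remainder not controlled by `v - v'`.
  filter_upwards [h.ae_sign_quantile h'] with s hs
  have hs' : σ (quantile m r s) = σ (quantile m r' s) := hs
  rw [hs', ← mul_sub, ← neg_mul]
  refine (le_abs_self _).trans ?_
  rw [abs_mul, abs_neg]
  calc |σ (quantile m r' s)| * _ ≤ 1 * |v (quantile m r s) - v' (quantile m r' s)| := by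
        gcongr; exact hσb _
    _ = _ := one_mul _

/-- The difference of the indicators of the two epigraphs of distribution functions. -/
noncomputable def distKernel (r r' : ℝ → ℝ) (w : ℝ × ℝ) : ℝ :=
  {w : ℝ × ℝ | w.1 ≤ primitive r w.2}.indicator 1 w -
    {w : ℝ × ℝ | w.1 ≤ primitive r' w.2}.indicator 1 w

theorem IsDensity.measurable_distKernel (h : IsDensity m r) (h' : IsDensity m r') :
    Measurable (distKernel r r') := by
  have m1 := (continuous_primitive h.integrable).measurable
  have m2 := (continuous_primitive h'.integrable).measurable
  exact (measurable_one.indicator (measurableSet_le measurable_fst (m1.comp measurable_snd))).sub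
    (measurable_one.indicator (measurableSet_le measurable_fst (m2.comp measurable_snd)))

theorem enorm_indicator_Iic_sub (p q s : ℝ) :
    ‖(Iic p).indicator (1 : ℝ → ℝ) s - (Iic q).indicator 1 s‖ₑ =
      (Ioc (min p q) (max p q)).indicator 1 s := by
  simp only [indicator, mem_Iic, mem_Ioc, inf_lt_iff, le_sup_iff]
  by_cases h1 : s ≤ p <;> by_cases h2 : s ≤ q <;> simp [h1, h2, not_lt.2, not_le.1]

theorem enorm_indicator_Ici_sub (p q s : ℝ) :
    ‖(Ici p).indicator (1 : ℝ → ℝ) s - (Ici q).indicator 1 s‖ₑ =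
      (Ico (min p q) (max p q)).indicator 1 s := by
  simp only [indicator, mem_Ici, mem_Ico, lt_sup_iff, inf_le_iff]
  by_cases h1 : p ≤ s <;> by_cases h2 : q ≤ s <;> simp [h1, h2, not_lt.2, not_le.1]

theorem volume_Ico_min_max (p q : ℝ) : volume (Ico (min p q) (max p q)) = ‖p - q‖ₑ := by
  rw [Real.volume_Ico, max_sub_min_eq_abs', Real.enorm_eq_ofReal_abs]

theorem volume_Ioc_min_max (p q : ℝ) : volume (Ioc (min p q) (max p q)) = ‖p - q‖ₑ := by
  rw [Real.volume_Ioc, max_sub_min_eq_abs', Real.enorm_eq_ofReal_abs]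

theorem distKernel_eq_Iic (x s : ℝ) :
    distKernel r r' (s, x) = (Iic (primitive r x)).indicator 1 s -
      (Iic (primitive r' x)).indicator 1 s := rfl

theorem IsDensity.distKernel_eq_Ici (h : IsDensity m r) (h' : IsDensity m r') {s : ℝ}
    (hs : s ∈ Ioo 0 m) (x : ℝ) :
    distKernel r r' (s, x) = (Ici (quantile m r s)).indicator 1 x -
      (Ici (quantile m r' s)).indicator 1 x := by
  simp [distKernel, indicator, h.quantile_le_iff hs, h'.quantile_le_iff hs]

theorem IsDensity.lintegral_distKernel (h : IsDensity m r) (h' : IsDensity m r') {s : ℝ}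
    (hs : s ∈ Ioo 0 m) :
    ∫⁻ x, ‖distKernel r r' (s, x)‖ₑ = ‖quantile m r s - quantile m r' s‖ₑ := by
  simp_rw [h.distKernel_eq_Ici h' hs, enorm_indicator_Ici_sub]
  rw [lintegral_indicator_one measurableSet_Ico, volume_Ico_min_max]

/-- The `L¹` distance of quantile functions is at most that of the distribution functions. -/
theorem IsDensity.lintegral_quantile_sub_le (h : IsDensity m r) (h' : IsDensity m r') :
    ∫⁻ s in Ioo 0 m, ‖quantile m r s - quantile m r' s‖ₑ ≤
      ∫⁻ x, ‖primitive r x - primitive r' x‖ₑ := by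
  have hm := h.measurable_distKernel h'
  -- The region between the two graphs is measured horizontally on one side and vertically on the
  -- other.
  calc ∫⁻ s in Ioo 0 m, ‖quantile m r s - quantile m r' s‖ₑ
      = ∫⁻ s in Ioo 0 m, ∫⁻ x, ‖distKernel r r' (s, x)‖ₑ :=
        setLIntegral_congr_fun measurableSet_Ioo fun s hs => (h.lintegral_distKernel h' hs).symm
    _ = ∫⁻ x, ∫⁻ s in Ioo 0 m, ‖distKernel r r' (s, x)‖ₑ :=
        lintegral_lintegral_swap hm.enorm.aemeasurable
    _ ≤ ∫⁻ x, ‖primitive r x - primitive r' x‖ₑ := by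
        refine lintegral_mono fun x => ?_
        refine (lintegral_mono' Measure.restrict_le_self le_rfl).trans ?_
        simp_rw [distKernel_eq_Iic, enorm_indicator_Iic_sub]
        rw [lintegral_indicator_one measurableSet_Ioc, volume_Ioc_min_max]

/-- Duality between differences of quantile functions and of distribution functions. -/
theorem IsDensity.integral_quantile_sub_mul (h : IsDensity m r) (h' : IsDensity m r')
    (hN : Integrable fun x => primitive r x - primitive r' x) {α β : ℝ} {ζ : ℝ → ℝ}
    (hα : 0 < α) (hβ : β < m) (hζ : IsCutoff α β ζ) :
    ∫ s in Ioo 0 m, (quantile m r s - quantile m r' s) * ζ s =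
      -∫ x, (primitive ζ (primitive r x) - primitive ζ (primitive r' x)) := by
  have hm := h.measurable_distKernel h'
  obtain ⟨C, hC0, hC⟩ := hζ.exists_bound
  have hK : Integrable (distKernel r r') ((volume.restrict (Ioo 0 m)).prod volume) := by
    refine ⟨hm.aestronglyMeasurable, ?_⟩
    rw [hasFiniteIntegral_iff_enorm, lintegral_prod _ hm.enorm.aemeasurable,
      setLIntegral_congr_fun measurableSet_Ioo fun s hs => h.lintegral_distKernel h' hs]
    exact (h.lintegral_quantile_sub_le h').trans_lt hN.2
  have hKζ : Integrable (fun w : ℝ × ℝ => distKernel r r' w * ζ w.1)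
      ((volume.restrict (Ioo 0 m)).prod volume) :=
    hK.mul_bdd (c := C) (hζ.continuous.measurable.comp measurable_fst).aestronglyMeasurable
      (ae_of_all _ fun w => hC _)
  have hswap := integral_integral_swap (f := fun s x => distKernel r r' (s, x) * ζ s) hKζ
  -- A half-line indicator jumps earlier when the quantile is smaller, whence the minus sign.
  have e1 : ∫ s in Ioo 0 m, (quantile m r s - quantile m r' s) * ζ s =
      -∫ s in Ioo 0 m, ∫ x, distKernel r r' (s, x) * ζ s := by
    rw [← integral_neg]
    refine setIntegral_congr_fun measurableSet_Ioo fun s hs => ?_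
    have key : ∀ p q : ℝ, p ≤ q →
        ∫ x, ((Ici p).indicator (1 : ℝ → ℝ) x - (Ici q).indicator 1 x) = q - p := by
      intro p q hpq
      have : (fun x => (Ici p).indicator (1 : ℝ → ℝ) x - (Ici q).indicator 1 x) =
          (Ico p q).indicator 1 := by
        ext x
        simp only [indicator, mem_Ici, mem_Ico, Pi.one_apply]
        by_cases h1 : p ≤ x <;> by_cases h2 : q ≤ x <;>
          simp [h1, h2, not_lt.2, not_le.1]
        exact absurd (hpq.trans h2) h1
      rw [this, integral_indicator_one measurableSet_Ico]
      simp [hpq]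
    simp only [integral_mul_const, h.distKernel_eq_Ici h' hs]
    rcases le_total (quantile m r s) (quantile m r' s) with hle | hle
    · rw [key _ _ hle]; ring
    · have := key _ _ hle
      rw [← neg_inj, ← integral_neg] at this
      simp only [neg_sub] at this
      rw [this]; ring
  rw [e1, hswap]
  congr 1
  refine integral_congr_ae (ae_of_all _ fun x => ?_)
  have key : ∀ p : ℝ, ∫ s in Ioo 0 m, (Iic p).indicator (1 : ℝ → ℝ) s * ζ s = primitive ζ p := by
    intro p
    rw [setIntegral_eq_integral_of_forall_compl_eq_zero]
    · rw [primitive, ← integral_indicator measurableSet_Iic]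
      refine integral_congr_ae (ae_of_all _ fun s => ?_)
      by_cases hs : s ≤ p <;> simp [indicator, hs]
    · intro s hs
      rw [hζ.2 s fun hs' => hs ⟨hα.trans_le hs'.1, hs'.2.trans_lt hβ⟩, mul_zero]
  have hi : ∀ p : ℝ, IntegrableOn (fun s => (Iic p).indicator (1 : ℝ → ℝ) s * ζ s) (Ioo 0 m) :=
    fun p => (hζ.integrable.bdd_mul (c := 1)
      (measurable_one.indicator measurableSet_Iic).aestronglyMeasurable
      (ae_of_all _ fun s => by
        by_cases hs : s ≤ p <;> simp [indicator, hs])).integrableOn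
  simp only [distKernel_eq_Iic, sub_mul]
  rw [integral_sub (hi _) (hi _), key, key]

end Quantile

theorem restrict_strip (T : ℝ) :
    (volume : Measure (ℝ × ℝ)).restrict (strip T) = (volume.restrict (Ioo 0 T)).prod volume := by
  rw [strip, Measure.volume_eq_prod, ← Measure.prod_restrict, Measure.restrict_univ]

theorem measurableSet_strip (T : ℝ) : MeasurableSet (strip T) :=
  measurableSet_Ioo.prod MeasurableSet.univ

/-! ### A smooth approximation of the absolute value. -/

section SmoothAbs

/-- A smooth convex approximation of the absolute value. -/
noncomputable def smoothAbs (ε y : ℝ) : ℝ := √(y ^ 2 + ε ^ 2) - ε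

/-- The derivative of `smoothAbs`. -/
noncomputable def smoothSign (ε y : ℝ) : ℝ := y / √(y ^ 2 + ε ^ 2)

variable {ε : ℝ}

theorem sqrt_sq_add_pos (hε : 0 < ε) (y : ℝ) : 0 < √(y ^ 2 + ε ^ 2) := by positivity

theorem contDiff_sqrt_sq_add (hε : 0 < ε) : ContDiff ℝ 1 fun y : ℝ => √(y ^ 2 + ε ^ 2) :=
  ContDiff.sqrt (by fun_prop) fun y => by positivity

theorem contDiff_smoothAbs (hε : 0 < ε) : ContDiff ℝ 1 (smoothAbs ε) :=
  (contDiff_sqrt_sq_add hε).sub contDiff_const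

theorem contDiff_smoothSign (hε : 0 < ε) : ContDiff ℝ 1 (smoothSign ε) :=
  contDiff_id.div (contDiff_sqrt_sq_add hε) fun y => (sqrt_sq_add_pos hε y).ne'

theorem hasDerivAt_sqrt_sq_add (hε : 0 < ε) (y : ℝ) :
    HasDerivAt (fun y : ℝ => √(y ^ 2 + ε ^ 2)) (smoothSign ε y) y := by
  have h := ((hasDerivAt_pow 2 y).add_const (ε ^ 2)).sqrt (by positivity)
  convert h using 1
  rw [smoothSign]
  have := (sqrt_sq_add_pos hε y).ne'
  field_simp
  simp [mul_comm]

theorem deriv_smoothAbs (hε : 0 < ε) (y : ℝ) : deriv (smoothAbs ε) y = smoothSign ε y :=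
  ((hasDerivAt_sqrt_sq_add hε y).sub_const ε).deriv

theorem deriv_smoothSign_nonneg (hε : 0 < ε) (y : ℝ) : 0 ≤ deriv (smoothSign ε) y := by
  have h := ((hasDerivAt_id y).div (hasDerivAt_sqrt_sq_add hε y) (sqrt_sq_add_pos hε y).ne').deriv
  have e : (smoothSign ε) = (id : ℝ → ℝ) / fun y : ℝ => √(y ^ 2 + ε ^ 2) := rfl
  rw [e, h]
  refine div_nonneg ?_ (sq_nonneg _)
  have hp := sqrt_sq_add_pos hε y
  have hs : √(y ^ 2 + ε ^ 2) ^ 2 = y ^ 2 + ε ^ 2 := Real.sq_sqrt (by positivity)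
  rw [smoothSign, id, one_mul, sub_nonneg, ← mul_div_assoc, div_le_iff₀ hp]
  nlinarith [sq_nonneg ε]

theorem abs_smoothSign_le (hε : 0 < ε) (y : ℝ) : |smoothSign ε y| ≤ 1 := by
  have hp := sqrt_sq_add_pos hε y
  rw [smoothSign, abs_div, abs_of_pos hp, div_le_one hp]
  exact Real.abs_le_sqrt (by nlinarith [sq_nonneg ε])

theorem smoothSign_zero : smoothSign ε 0 = 0 := by simp [smoothSign]

theorem smoothAbs_zero (hε : 0 < ε) : smoothAbs ε 0 = 0 := by
  simp [smoothAbs, Real.sqrt_sq hε.le]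

theorem abs_smoothAbs_le (hε : 0 < ε) (y : ℝ) : |smoothAbs ε y| ≤ |y| := by
  have h1 : ε ≤ √(y ^ 2 + ε ^ 2) := Real.le_sqrt_of_sq_le (by nlinarith [sq_nonneg y])
  have h2 : √(y ^ 2 + ε ^ 2) ≤ |y| + ε := by
    rw [Real.sqrt_le_left (by positivity)]
    nlinarith [sq_abs y, abs_nonneg y, mul_nonneg (abs_nonneg y) hε.le]
  rw [smoothAbs, abs_of_nonneg (by linarith)]
  linarith

theorem tendsto_sqrt_sq_add (y : ℝ) :
    Tendsto (fun n : ℕ => √(y ^ 2 + (1 / ((n : ℝ) + 1)) ^ 2)) atTop (𝓝 |y|) := by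
  have h := (tendsto_one_div_add_atTop_nhds_zero_nat (𝕜 := ℝ)).pow 2
  have h2 := (h.const_add (y ^ 2)).sqrt
  simpa [Real.sqrt_sq_eq_abs] using h2

theorem tendsto_smoothAbs (y : ℝ) :
    Tendsto (fun n : ℕ => smoothAbs (1 / ((n : ℝ) + 1)) y) atTop (𝓝 |y|) := by
  simpa [smoothAbs] using
    (tendsto_sqrt_sq_add y).sub (tendsto_one_div_add_atTop_nhds_zero_nat (𝕜 := ℝ))

theorem tendsto_smoothSign (y : ℝ) :
    Tendsto (fun n : ℕ => smoothSign (1 / ((n : ℝ) + 1)) y) atTop (𝓝 (Real.sign y)) := by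
  rcases eq_or_ne y 0 with rfl | hy
  · simp [smoothSign_zero]
  · have h := (tendsto_sqrt_sq_add y).inv₀ (abs_ne_zero.2 hy)
    have h2 := h.const_mul y
    have e : y * |y|⁻¹ = Real.sign y := by
      rcases lt_or_gt_of_ne hy with h | h
      · rw [Real.sign_of_neg h, abs_of_neg h]; field_simp
      · rw [Real.sign_of_pos h, abs_of_pos h]; field_simp
    rw [e] at h2
    exact h2

end SmoothAbs

/-! ### The `L¹` estimate for distribution functions. -/

section Contraction

/-- `L¹` estimate for the difference of distribution functions: the diffusive flux `α - J` has the
favourable sign. -/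
theorem integral_abs_spacePrim_le {T : ℝ} {r J α : ℝ × ℝ → ℝ} (hrm : Measurable r)
    (hri : ∀ t, Integrable fun x => r (t, x)) (hr0 : ∀ t, ∫ x, r (t, x) = 0)
    (hJ : Integrable J) (hJ0 : ∀ z, z.1 ≤ 0 → J z = 0)
    (hα : Integrable α)
    (hN : ∀ᵐ z, z.1 ∈ Ioo 0 T → spacePrim r z = -timePrim J z)
    (hΨ : ∀ᵐ z, z.1 ∈ Ioo 0 T → 0 ≤ r z * spacePrim (fun z => α z - J z) z) :
    ∀ᵐ t, t ∈ Ioo 0 T → Integrable (fun x => spacePrim r (t, x)) ∧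
      ∫ x, |spacePrim r (t, x)| ≤ -∫ z in strip t, Real.sign (spacePrim r z) * α z := by
  have hSm := measurable_spacePrim hrm
  have hJx : Integrable fun x => ∫ s, |J (s, x)| := hJ.abs.integral_prod_right
  filter_upwards [ae_slice_fst hN] with t hNt ht
  have hbd : ∀ᵐ x, |spacePrim r (t, x)| ≤ ∫ s, |J (s, x)| := by
    filter_upwards [hNt, integrable_slice_snd hJ] with x hx hJs
    rw [hx ht, abs_neg]
    exact abs_primitive_le hJs t
  have hNi : Integrable fun x => spacePrim r (t, x) :=
    hJx.mono' (hSm.comp (by fun_prop)).aestronglyMeasurable hbd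
  refine ⟨hNi, ?_⟩
  -- The sign is first regularised, so that the chain rule in time and integration by parts in space
  -- apply; `ε → 0` is then taken by dominated convergence.
  have step : ∀ ε : ℝ, 0 < ε → ∫ x, smoothAbs ε (spacePrim r (t, x)) ≤
      -∫ z in strip t, smoothSign ε (spacePrim r z) * α z := by
    intro ε hε
    have hcs := (contDiff_smoothSign hε).continuous
    have hsm : Measurable fun z => smoothSign ε (spacePrim r z) := hcs.measurable.comp hSm
    have hsb : ∀ z, ‖smoothSign ε (spacePrim r z)‖ ≤ 1 := fun z => abs_smoothSign_le hε _
    have iJ : Integrable fun z => smoothSign ε (spacePrim r z) * J z :=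
      hJ.bdd_mul hsm.aestronglyMeasurable (ae_of_all _ hsb)
    have iα : Integrable fun z => smoothSign ε (spacePrim r z) * α z :=
      hα.bdd_mul hsm.aestronglyMeasurable (ae_of_all _ hsb)
    have e1 : ∀ᵐ x, smoothAbs ε (spacePrim r (t, x)) =
        -∫ s in Ioo 0 t, smoothSign ε (spacePrim r (s, x)) * J (s, x) := by
      filter_upwards [hNt, integrable_slice_snd hJ, ae_slice_snd hN] with x hx hJs hNs
      have hg : ∀ c d, (-primitive (fun s => J (s, x)) d) - (-primitive (fun s => J (s, x)) c) =
          ∫ y in c..d, -J (y, x) := fun c d => by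
        rw [intervalIntegral.integral_neg, ← primitive_sub hJs]; ring
      have hc := comp_sub_eq_integral (g := fun t => -primitive (fun s => J (s, x)) t)
        hJs.neg hg (contDiff_smoothAbs hε) 0 t
      -- `J` vanishes at nonpositive times, so the chain rule starts from the value `0` at time `0`.
      have h00 : primitive (fun s => J (s, x)) 0 = 0 :=
        setIntegral_eq_zero_of_forall_eq_zero fun s hs => hJ0 (s, x) hs
      simp only [h00, neg_zero, smoothAbs_zero hε, sub_zero] at hc
      rw [hx ht]
      simp only [timePrim]
      rw [hc, ← integral_Ioc_eq_integral_Ioo, ← intervalIntegral.integral_of_le ht.1.le,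
        ← intervalIntegral.integral_neg]
      refine intervalIntegral.integral_congr_ae ?_
      filter_upwards [hNs] with s hs hs'
      rw [uIoc_of_le ht.1.le] at hs'
      rw [deriv_smoothAbs hε, hs ⟨hs'.1, hs'.2.trans_lt ht.2⟩]
      simp [timePrim]
    rw [integral_congr_ae e1, integral_neg, neg_le_neg_iff]
    have iJs : Integrable (fun z => smoothSign ε (spacePrim r z) * J z)
        ((volume.restrict (Ioo 0 t)).prod volume) := by
      rw [← restrict_strip]; exact iJ.integrableOn
    have iαs : Integrable (fun z => smoothSign ε (spacePrim r z) * α z)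
        ((volume.restrict (Ioo 0 t)).prod volume) := by
      rw [← restrict_strip]; exact iα.integrableOn
    have hswap := integral_integral_swap
      (f := fun s x => smoothSign ε (spacePrim r (s, x)) * J (s, x)) iJs
    rw [← hswap, restrict_strip, integral_prod _ iαs]
    refine integral_mono_ae iαs.integral_prod_left iJs.integral_prod_left ?_
    filter_upwards [ae_restrict_mem measurableSet_Ioo, ae_restrict_of_ae (integrable_slice_fst iJ),
      ae_restrict_of_ae (integrable_slice_fst iα), ae_restrict_of_ae (integrable_slice_fst hα),
      ae_restrict_of_ae (integrable_slice_fst hJ), ae_restrict_of_ae (ae_slice_fst hΨ)]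
      with s hs iJs iαs hαs hJs hΨs
    -- The boundary term at `+∞` vanishes because `r` has total mass zero and `smoothSign ε 0 = 0`.
    have ibp := integral_mul_comp_primitive (hαs.sub hJs) (hri s) (contDiff_smoothSign hε)
    rw [hr0 s, smoothSign_zero, mul_zero, zero_sub] at ibp
    -- The diffusive term: the product assumed nonnegative in `hΨ`, multiplied by the nonnegative
    -- derivative of the regularised sign.
    have hpos : 0 ≤ ∫ x, primitive ((fun x => α (s, x)) - fun x => J (s, x)) x *
        (deriv (smoothSign ε) (primitive (fun x => r (s, x)) x) * r (s, x)) := by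
      refine integral_nonneg_of_ae ?_
      filter_upwards [hΨs] with x hx
      have h1 := mul_nonneg (hx ⟨hs.1, hs.2.trans ht.2⟩)
        (deriv_smoothSign_nonneg hε (primitive (fun x => r (s, x)) x))
      refine h1.trans_eq ?_
      simp only [spacePrim]
      change _ = primitive (fun x => α (s, x) - J (s, x)) x * _
      ring
    have e3 : (∫ x, smoothSign ε (spacePrim r (s, x)) * α (s, x)) -
        ∫ x, smoothSign ε (spacePrim r (s, x)) * J (s, x) =
        ∫ x, ((fun x => α (s, x)) - fun x => J (s, x)) x *
          smoothSign ε (primitive (fun x => r (s, x)) x) := by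
      rw [← integral_sub iαs iJs]
      congr 1; ext x
      simp only [spacePrim, Pi.sub_apply]; ring
    change (∫ x, smoothSign ε (spacePrim r (s, x)) * α (s, x)) ≤
      ∫ x, smoothSign ε (spacePrim r (s, x)) * J (s, x)
    linarith
  have hpos : ∀ n : ℕ, (0 : ℝ) < 1 / ((n : ℝ) + 1) := fun n => by positivity
  have l1 : Tendsto (fun n : ℕ => ∫ x, smoothAbs (1 / ((n : ℝ) + 1)) (spacePrim r (t, x))) atTop
      (𝓝 (∫ x, |spacePrim r (t, x)|)) := by
    refine tendsto_integral_of_dominated_convergence (fun x => |spacePrim r (t, x)|)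
      (fun n => ?_) hNi.abs (fun n => ae_of_all _ fun x => abs_smoothAbs_le (hpos n) _)
      (ae_of_all _ fun x => tendsto_smoothAbs _)
    exact (contDiff_smoothAbs (hpos n)).continuous.comp_aestronglyMeasurable hNi.1
  have l2 : Tendsto (fun n : ℕ => -∫ z in strip t,
      smoothSign (1 / ((n : ℝ) + 1)) (spacePrim r z) * α z) atTop
      (𝓝 (-∫ z in strip t, Real.sign (spacePrim r z) * α z)) := by
    refine Tendsto.neg (tendsto_integral_of_dominated_convergence (fun z => |α z|)
      (fun n => ?_) hα.abs.integrableOn (fun n => ae_of_all _ fun z => ?_)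
      (ae_of_all _ fun z => (tendsto_smoothSign _).mul_const _))
    · exact (((contDiff_smoothSign (hpos n)).continuous.measurable.comp hSm).aestronglyMeasurable.mul
        hα.integrableOn.1)
    · rw [norm_mul]
      calc _ ≤ 1 * ‖α z‖ := by gcongr; exact abs_smoothSign_le (hpos n) _
        _ = |α z| := by rw [one_mul, Real.norm_eq_abs]
  exact le_of_tendsto_of_tendsto' l1 l2 fun n => step _ (hpos n)

end Contraction

/-! ### Conserved solutions and the momentum balance in mass coordinates. -/

/-- The conserved form of a solution: the distribution function of the density and the primitive of
the momentum are explicit time primitives of the fluxes, and the diffusive flux `ρ v - ρ u` is the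
space derivative of `ψ(ρ)`. The data are extended by their initial values to times in `(-T,0]`. -/
structure IsConservedSolution (T mass lam : ℝ) (ψ ρ₀ v₀ : ℝ → ℝ) (ρ u v : ℝ × ℝ → ℝ) : Prop where
  measurable_rho : Measurable ρ
  measurable_u : Measurable u
  measurable_v : Measurable v
  density : ∀ t, IsDensity mass fun x => ρ (t, x)
  bounded : ∃ B, ∀ᵐ z, |ρ z| ≤ B
  kinetic_u : Integrable fun z => ρ z * u z ^ 2
  kinetic_v : Integrable fun z => ρ z * v z ^ 2
  integrable_u : Integrable fun z => ρ z * u z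
  integrable_v : Integrable fun z => ρ z * v z
  internal : IntegrableOn (fun z => ψ (ρ z)) (strip T)
  u_off : ∀ z : ℝ × ℝ, z.1 ∉ Ioo 0 T → u z = 0
  early : ∀ z : ℝ × ℝ, z.1 ∈ Ioc (-T) 0 → ρ z = ρ₀ z.2 ∧ v z = v₀ z.2
  flux_eq : ∀ᵐ z, z.1 ∈ Ioo 0 T → ψ (ρ z) = spacePrim (fun z => ρ z * v z - ρ z * u z) z
  mass_eq : ∀ᵐ z, z.1 ∈ Ioo (-T) T →
    spacePrim ρ z = primitive ρ₀ z.2 - timePrim (fun z => ρ z * u z) z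
  momentum_eq : ∀ᵐ z, z.1 ∈ Ioo (-T) T →
    spacePrim (fun z => ρ z * v z) z = primitive (fun x => ρ₀ x * v₀ x) z.2 -
      timePrim (fun z => ρ z * u z * v z + (strip T).indicator (fun z => lam * ψ (ρ z)) z) z

theorem ae_of_ae_slices {p : ℝ × ℝ → Prop} (hp : MeasurableSet {z | p z})
    (h : ∀ᵐ t, ∀ᵐ x, p (t, x)) : ∀ᵐ z, p z :=
  (Measure.ae_prod_iff_ae_ae hp).2 h

namespace IsConservedSolution

variable {T mass lam : ℝ} {ψ ρ₀ v₀ : ℝ → ℝ} {ρ u v ρ' u' v' : ℝ × ℝ → ℝ}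

theorem nonneg (h : IsConservedSolution T mass lam ψ ρ₀ v₀ ρ u v) : ∀ᵐ z, 0 ≤ ρ z :=
  ae_of_ae_slices (measurableSet_le measurable_const h.measurable_rho)
    (ae_of_all _ fun t => (h.density t).nonneg)

/-- Boundedness of the density upgrades finite kinetic energy to square integrability of the
momentum, since `(ρw)² ≤ B ρw²`. -/
theorem memLp_two_of_kinetic {ρ w : ℝ × ℝ → ℝ} {B : ℝ} (hρ : Measurable ρ) (hw : Measurable w)
    (h0 : ∀ᵐ z, 0 ≤ ρ z) (hB : ∀ᵐ z, |ρ z| ≤ B) (hk : Integrable fun z => ρ z * w z ^ 2) :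
    MemLp (fun z => ρ z * w z) 2 := by
  refine (memLp_two_iff_integrable_sq (hρ.mul hw).aestronglyMeasurable).2 ?_
  refine (hk.const_mul B).mono' ((hρ.mul hw).pow_const 2).aestronglyMeasurable ?_
  filter_upwards [h0, hB] with z h0 hB
  rw [abs_of_nonneg h0] at hB
  rw [Real.norm_of_nonneg (sq_nonneg _)]
  have : 0 ≤ (B - ρ z) * (ρ z * w z ^ 2) :=
    mul_nonneg (by linarith) (mul_nonneg h0 (sq_nonneg _))
  simp only [Pi.mul_apply]
  nlinarith

theorem integrable_uv (h : IsConservedSolution T mass lam ψ ρ₀ v₀ ρ u v) :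
    Integrable fun z => ρ z * u z * v z := by
  refine (h.kinetic_u.add h.kinetic_v).mono'
    ((h.measurable_rho.mul h.measurable_u).mul h.measurable_v).aestronglyMeasurable ?_
  filter_upwards [h.nonneg] with z h0
  rw [mul_assoc, norm_mul, norm_mul, Real.norm_of_nonneg h0]
  simp only [Pi.add_apply]
  have : 0 ≤ ρ z * ((‖u z‖ - ‖v z‖) ^ 2 + ‖u z‖ ^ 2 + ‖v z‖ ^ 2) := by positivity
  rw [← Real.norm_of_nonneg (sq_nonneg (u z)), ← Real.norm_of_nonneg (sq_nonneg (v z)),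
    norm_pow, norm_pow]
  nlinarith

/-- The momentum balance tested in mass coordinates; the pressure is integrated by parts. -/
theorem integral_mass_coordinate (h : IsConservedSolution T mass lam ψ ρ₀ v₀ ρ u v)
    (hψ : Measurable ψ) {α β c d : ℝ} {ξ θ : ℝ → ℝ} (hβ : β < mass)
    (hξ : IsCutoff α β ξ) (hc : -T < c) (hd : d < T) (hθ : IsCutoff c d θ) :
    ∫ z, ρ z * v z * ξ (spacePrim ρ z) * deriv θ z.1 =
      lam * ∫ z in strip T, θ z.1 * ((ρ z * v z - ρ z * u z) * ξ (spacePrim ρ z)) := by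
  obtain ⟨B, hB⟩ := h.bounded
  have hρ := h.measurable_rho
  have hρu := hρ.mul h.measurable_u
  have hρv := hρ.mul h.measurable_v
  have hξmass : ξ mass = 0 := hξ.2 _ fun h' => absurd h'.2 (not_le.2 hβ)
  have hindm : Measurable ((strip T).indicator fun z => lam * ψ (ρ z)) :=
    ((hψ.comp hρ).const_mul lam).indicator (measurableSet_strip T)
  have hind : Integrable ((strip T).indicator fun z => lam * ψ (ρ z)) :=
    (integrable_indicator_iff (measurableSet_strip T)).2 (Integrable.const_mul h.internal lam)
  obtain ⟨C, hC0, hC⟩ := hξ.exists_bound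
  obtain ⟨C', hC'0, hC'⟩ := hξ.deriv.exists_bound
  obtain ⟨D, hD0, hD⟩ := hθ.exists_bound
  have hSm := measurable_spacePrim hρ
  have key := integral_momentum_mass_coordinate (a := -T) (b := T) (B := B) hρv h.integrable_v
    (memLp_two_of_kinetic hρ h.measurable_v h.nonneg hB h.kinetic_v) hρu h.integrable_u
    (memLp_two_of_kinetic hρ h.measurable_u h.nonneg hB h.kinetic_u)
    (F := fun z => ρ z * u z * v z + (strip T).indicator (fun z => lam * ψ (ρ z)) z)
    ((hρu.mul h.measurable_v).add hindm) (h.integrable_uv.add hind) hρ hB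
    (fun t => (h.density t).integrable) h.mass_eq h.momentum_eq hξ
    (fun t => by rw [(h.density t).mass]; exact hξmass) hθ hc hd
  -- The convective terms cancel, `ρ·(ρuv) − (ρv)(ρu) = 0`, and only the pressure remains.
  have e0 : ∫ z, ρ z * v z * ξ (spacePrim ρ z) * deriv θ z.1 =
      -∫ z, θ z.1 * deriv ξ (spacePrim ρ z) * (ρ z * (strip T).indicator
        (fun z => lam * ψ (ρ z)) z) := by
    refine key.trans ?_
    congr 1
    refine integral_congr_ae (ae_of_all _ fun z => ?_)
    simp only [Pi.mul_apply]
    ring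
  have e1 : ∫ z, θ z.1 * deriv ξ (spacePrim ρ z) * (ρ z * (strip T).indicator
        (fun z => lam * ψ (ρ z)) z) =
      ∫ z in strip T, θ z.1 * deriv ξ (spacePrim ρ z) * (ρ z * (lam * ψ (ρ z))) := by
    rw [← integral_indicator (measurableSet_strip T)]
    refine integral_congr_ae (ae_of_all _ fun z => ?_)
    by_cases hz : z ∈ strip T <;> simp [hz]
  rw [e0, e1, ← integral_const_mul, ← integral_neg]
  have m1 : Measurable fun z : ℝ × ℝ => θ z.1 := hθ.continuous.measurable.comp measurable_fst
  have m2 : Measurable fun z => deriv ξ (spacePrim ρ z) := hξ.deriv.continuous.measurable.comp hSm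
  have m3 : Measurable fun z => ξ (spacePrim ρ z) := hξ.continuous.measurable.comp hSm
  have i1 : IntegrableOn (fun z => -(θ z.1 * deriv ξ (spacePrim ρ z) * (ρ z * (lam * ψ (ρ z)))))
      (strip T) := by
    have hψi : IntegrableOn (fun z => lam * ψ (ρ z)) (strip T) :=
      Integrable.const_mul h.internal lam
    refine Integrable.neg (Integrable.bdd_mul (c := D * C') (hψi.bdd_mul (c := B)
      hρ.aestronglyMeasurable (ae_restrict_of_ae hB)) (m1.mul m2).aestronglyMeasurable
      (ae_of_all _ fun z => ?_))
    rw [norm_mul]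
    exact mul_le_mul (hD _) (hC' _) (norm_nonneg _) hD0
  have i2 : IntegrableOn (fun z => lam * (θ z.1 * ((ρ z * v z - ρ z * u z) * ξ (spacePrim ρ z))))
      (strip T) := by
    refine Integrable.integrableOn (Integrable.const_mul (Integrable.bdd_mul (c := D)
      (Integrable.mul_bdd (c := C) (h.integrable_v.sub h.integrable_u) m3.aestronglyMeasurable
        (ae_of_all _ fun z => hC _)) m1.aestronglyMeasurable (ae_of_all _ fun z => hD _)) lam)
  rw [IntegrableOn, restrict_strip] at i1 i2
  rw [restrict_strip, integral_prod _ i1, integral_prod _ i2]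
  refine integral_congr_ae ?_
  filter_upwards [ae_restrict_mem measurableSet_Ioo,
    ae_restrict_of_ae (integrable_slice_fst h.integrable_v),
    ae_restrict_of_ae (integrable_slice_fst h.integrable_u),
    ae_restrict_of_ae (ae_slice_fst h.flux_eq)] with t ht hvt hut hft
  -- The function `ξ'(M)ρ` is the space derivative of `ξ(M)`, and `ψ(ρ)` is the primitive of `ρv −
  -- ρu`. The boundary term vanishes because `ξ` is zero at the total mass.
  have ibp := integral_mul_comp_primitive (hvt.sub hut) (h.density t).integrable
    (ξ := ξ) (hξ.1.of_le (by exact_mod_cast le_top))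
  rw [(h.density t).mass, hξmass, mul_zero, zero_sub] at ibp
  have e2 : ∫ x, -(θ t * deriv ξ (spacePrim ρ (t, x)) * (ρ (t, x) * (lam * ψ (ρ (t, x))))) =
      lam * (θ t * -∫ x, primitive ((fun x => ρ (t, x) * v (t, x)) - fun x => ρ (t, x) * u (t, x)) x *
        (deriv ξ (primitive (fun x => ρ (t, x)) x) * ρ (t, x))) := by
    rw [← integral_neg, ← integral_const_mul, ← integral_const_mul]
    refine integral_congr_ae ?_
    filter_upwards [hft] with x hx
    rw [hx ht]
    simp only [spacePrim]
    change _ = lam * (θ t * -(primitive (fun x => ρ (t, x) * v (t, x) - ρ (t, x) * u (t, x)) x * _))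
    ring
  rw [e2, ← ibp, ← integral_const_mul, ← integral_const_mul]
  rfl

end IsConservedSolution

/-! ### Lagrangian positions and velocities of two solutions. -/

/-- The Lagrangian position of the mass coordinate `w.2` at time `w.1`. -/
noncomputable def lagrangian (mass : ℝ) (ρ : ℝ × ℝ → ℝ) (w : ℝ × ℝ) : ℝ :=
  quantile mass (fun x => ρ (w.1, x)) w.2

theorem measurable_lagrangian {mass : ℝ} {ρ : ℝ × ℝ → ℝ} (hρ : Measurable ρ)
    (hd : ∀ t, IsDensity mass fun x => ρ (t, x)) : Measurable (lagrangian mass ρ) := by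
  refine measurable_of_Iic fun x => ?_
  have e : lagrangian mass ρ ⁻¹' Iic x =
      (Prod.snd ⁻¹' Ioo 0 mass ∩ {w | w.2 ≤ spacePrim ρ (w.1, x)}) ∪
        ((Prod.snd ⁻¹' Ioo 0 mass)ᶜ ∩ {_w | 0 ≤ x}) := by
    ext w
    by_cases hs : w.2 ∈ Ioo 0 mass
    · have := (hd w.1).quantile_le_iff hs x
      simp only [mem_preimage, mem_Iic, lagrangian, this, mem_union, mem_inter_iff, hs, true_and,
        mem_ofPred_eq, mem_compl_iff, not_true, false_and, or_false]
      rfl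
    · simp only [lagrangian, quantile, mem_preimage, hs, if_false, mem_Iic, mem_union,
        mem_inter_iff, false_and, mem_compl_iff, not_false_iff, true_and, false_or, mem_ofPred_eq]
  rw [e]
  have hm := measurable_spacePrim hρ
  exact ((measurable_snd measurableSet_Ioo).inter (measurableSet_le measurable_snd
    (hm.comp (by fun_prop)))).union
    ((measurable_snd measurableSet_Ioo).compl.inter (MeasurableSet.const _))

theorem ae_timePrim_sub {f g : ℝ × ℝ → ℝ} (hf : Integrable f) (hg : Integrable g) :
    ∀ᵐ z, timePrim (fun z => f z - g z) z = timePrim f z - timePrim g z := by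
  filter_upwards [ae_of_ae_snd (integrable_slice_snd hf), ae_of_ae_snd (integrable_slice_snd hg)]
    with z h1 h2
  exact primitive_sub_fun h1 h2 z.1

theorem ae_spacePrim_sub {f g : ℝ × ℝ → ℝ} (hf : Integrable f) (hg : Integrable g) :
    ∀ᵐ z, spacePrim (fun z => f z - g z) z = spacePrim f z - spacePrim g z := by
  filter_upwards [ae_of_ae_fst (integrable_slice_fst hf), ae_of_ae_fst (integrable_slice_fst hg)]
    with z h1 h2
  exact primitive_sub_fun h1 h2 z.2

/-- Chain rule in time for functions of a distribution function. -/
theorem ae_comp_timePrim {a T : ℝ} (ha : a < 0) {W j : ℝ × ℝ → ℝ} {W₀ Z : ℝ → ℝ}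
    (hj : Integrable j) (hj0 : ∀ z, z.1 ≤ 0 → j z = 0)
    (hW : ∀ᵐ z, z.1 ∈ Ioo a T → W z = W₀ z.2 - timePrim j z) (hZ : ContDiff ℝ 1 Z) :
    ∀ᵐ z, z.1 ∈ Ioo 0 T → Z (W z) = Z (W₀ z.2) - timePrim (fun z => deriv Z (W z) * j z) z := by
  filter_upwards [hW, ae_of_ae_snd (ae_slice_snd hW), ae_of_ae_snd (integrable_slice_snd hj)]
    with z h1 h2 h3 hz
  have hg : ∀ c d, (W₀ z.2 - primitive (fun s => j (s, z.2)) d) -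
      (W₀ z.2 - primitive (fun s => j (s, z.2)) c) = ∫ y in c..d, -j (y, z.2) := fun c d => by
    rw [intervalIntegral.integral_neg, ← primitive_sub h3]; ring
  have hc := comp_sub_eq_integral (g := fun t => W₀ z.2 - primitive (fun s => j (s, z.2)) t)
    h3.neg hg hZ 0 z.1
  have h00 : primitive (fun s => j (s, z.2)) 0 = 0 :=
    setIntegral_eq_zero_of_forall_eq_zero fun s hs => hj0 (s, z.2) hs
  have e : timePrim (fun z => deriv Z (W z) * j z) z =
      ∫ s in (0 : ℝ)..z.1, deriv Z (W (s, z.2)) * j (s, z.2) := by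
    rw [timePrim, primitive, intervalIntegral.integral_of_le hz.1.le]
    refine (setIntegral_eq_of_subset_of_forall_sdiff_eq_zero measurableSet_Iic
      (fun s hs => hs.2) fun s hs => ?_)
    have hs0 : s ≤ 0 := by
      by_contra hh
      exact hs.2 ⟨not_le.1 hh, hs.1⟩
    rw [hj0 (s, z.2) hs0, mul_zero]
  simp only [h00, sub_zero] at hc
  rw [h1 ⟨ha.trans hz.1, hz.2⟩, e]
  simp only [timePrim]
  refine eq_add_of_sub_eq' (hc.trans ?_) |>.trans (sub_eq_add_neg _ _).symm
  rw [← intervalIntegral.integral_neg]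
  refine intervalIntegral.integral_congr_ae ?_
  filter_upwards [h2] with s hs hs'
  rw [uIoc_of_le hz.1.le] at hs'
  rw [hs ⟨ha.trans hs'.1, hs'.2.trans_lt hz.2⟩]
  simp [timePrim]

namespace IsConservedSolution

variable {T mass lam : ℝ} {ψ ρ₀ v₀ : ℝ → ℝ} {ρ u v ρ' u' v' : ℝ × ℝ → ℝ}

theorem u_of_nonpos (h : IsConservedSolution T mass lam ψ ρ₀ v₀ ρ u v) (z : ℝ × ℝ)
    (hz : z.1 ≤ 0) : ρ z * u z = 0 := by
  rw [h.u_off z fun h' => absurd h'.1 (not_lt.2 hz), mul_zero]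

theorem spacePrim_density_sub (h : IsConservedSolution T mass lam ψ ρ₀ v₀ ρ u v)
    (h' : IsConservedSolution T mass lam ψ ρ₀ v₀ ρ' u' v') (z : ℝ × ℝ) :
    spacePrim (fun z => ρ z - ρ' z) z = spacePrim ρ z - spacePrim ρ' z :=
  primitive_sub_fun (h.density z.1).integrable (h'.density z.1).integrable z.2

theorem spacePrim_sub_eq (hT : 0 < T) (h : IsConservedSolution T mass lam ψ ρ₀ v₀ ρ u v)
    (h' : IsConservedSolution T mass lam ψ ρ₀ v₀ ρ' u' v') :
    ∀ᵐ z, z.1 ∈ Ioo 0 T → spacePrim (fun z => ρ z - ρ' z) z =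
      -timePrim (fun z => ρ z * u z - ρ' z * u' z) z := by
  filter_upwards [h.mass_eq, h'.mass_eq, ae_timePrim_sub h.integrable_u h'.integrable_u]
    with z h1 h2 h3 hz
  have hz' : z.1 ∈ Ioo (-T) T := ⟨by linarith [hz.1], hz.2⟩
  rw [h.spacePrim_density_sub h', h1 hz', h2 hz', h3]
  ring

/-- Each distribution function tends to the total mass at `+∞`, so only the difference can be
integrable. Equal initial densities make it a time primitive of the flux difference, dominated
uniformly in time by an integrable function of `x`. -/
theorem integrable_spacePrim_sub (hT : 0 < T) (h : IsConservedSolution T mass lam ψ ρ₀ v₀ ρ u v)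
    (h' : IsConservedSolution T mass lam ψ ρ₀ v₀ ρ' u' v') :
    Integrable (fun z => spacePrim ρ z - spacePrim ρ' z)
      ((volume.restrict (Ioo 0 T)).prod volume) := by
  have hJ := h.integrable_u.sub h'.integrable_u
  have hb : Integrable fun x => ∫ s, |ρ (s, x) * u (s, x) - ρ' (s, x) * u' (s, x)| :=
    hJ.abs.integral_prod_right
  refine (hb.comp_snd (volume.restrict (Ioo 0 T))).mono'
    ((measurable_spacePrim h.measurable_rho).sub
      (measurable_spacePrim h'.measurable_rho)).aestronglyMeasurable ?_
  rw [← restrict_strip, ae_restrict_iff' (measurableSet_strip T)]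
  filter_upwards [spacePrim_sub_eq hT h h', ae_of_ae_snd (integrable_slice_snd hJ)] with z h1 h2 hz
  rw [← h.spacePrim_density_sub h', h1 hz.1, norm_neg]
  exact abs_primitive_le h2 z.1

/-- The velocity in mass coordinates. -/
noncomputable def massVelocity (mass : ℝ) (ρ v : ℝ × ℝ → ℝ) (w : ℝ × ℝ) : ℝ :=
  v (w.1, lagrangian mass ρ w)

theorem measurable_massVelocity (h : IsConservedSolution T mass lam ψ ρ₀ v₀ ρ u v) :
    Measurable (massVelocity mass ρ v) :=
  h.measurable_v.comp (measurable_fst.prodMk (measurable_lagrangian h.measurable_rho h.density))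

/-- At each time the quantile change of variables turns the integral of the velocity in mass
coordinates into that of the momentum. -/
theorem integrable_massVelocity (h : IsConservedSolution T mass lam ψ ρ₀ v₀ ρ u v) :
    Integrable (massVelocity mass ρ v)
      ((volume.restrict (Ioo 0 T)).prod (volume.restrict (Ioo 0 mass))) := by
  have hm := h.measurable_massVelocity
  refine ⟨hm.aestronglyMeasurable, ?_⟩
  have hv := h.integrable_v.2
  rw [hasFiniteIntegral_iff_enorm] at hv ⊢
  rw [lintegral_prod _ hm.enorm.aemeasurable]
  refine lt_of_le_of_lt ?_ hv
  have hvm : Measurable fun z => ρ z * v z := h.measurable_rho.mul h.measurable_v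
  rw [Measure.volume_eq_prod, lintegral_prod _ hvm.enorm.aemeasurable]
  refine (lintegral_mono' Measure.restrict_le_self le_rfl).trans (lintegral_mono fun t => ?_)
  have e := (h.density t).lintegral_quantile (f := fun x => ‖v (t, x)‖ₑ)
    (h.measurable_v.comp (by fun_prop)).enorm
  change ∫⁻ s in Ioo 0 mass, ‖v (t, quantile mass (fun x => ρ (t, x)) s)‖ₑ ≤ _
  rw [e]
  refine lintegral_mono_ae ?_
  filter_upwards [(h.density t).nonneg] with x hx
  rw [enorm_mul, Real.enorm_eq_ofReal hx]

theorem integrable_lagrangian_sub (hT : 0 < T) (h : IsConservedSolution T mass lam ψ ρ₀ v₀ ρ u v)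
    (h' : IsConservedSolution T mass lam ψ ρ₀ v₀ ρ' u' v') :
    Integrable (fun w => lagrangian mass ρ w - lagrangian mass ρ' w)
      ((volume.restrict (Ioo 0 T)).prod (volume.restrict (Ioo 0 mass))) := by
  have hm : Measurable fun w => lagrangian mass ρ w - lagrangian mass ρ' w :=
    (measurable_lagrangian h.measurable_rho h.density).sub
      (measurable_lagrangian h'.measurable_rho h'.density)
  have hNm : Measurable fun z => spacePrim ρ z - spacePrim ρ' z :=
    (measurable_spacePrim h.measurable_rho).sub (measurable_spacePrim h'.measurable_rho)
  refine ⟨hm.aestronglyMeasurable, ?_⟩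
  have hN := (integrable_spacePrim_sub hT h h').2
  rw [hasFiniteIntegral_iff_enorm] at hN ⊢
  refine lt_of_le_of_lt ?_ hN
  rw [lintegral_prod _ hm.enorm.aemeasurable, lintegral_prod _ hNm.enorm.aemeasurable]
  refine lintegral_mono fun t => ?_
  have := (h.density t).lintegral_quantile_sub_le (h'.density t)
  exact this

/-- The `L¹` distance of the distribution functions is controlled by the time integral of the
velocity difference in mass coordinates. -/
theorem lintegral_spacePrim_sub_le (hT : 0 < T) (hψ : MonotoneOn ψ (Ici 0))
    (h : IsConservedSolution T mass lam ψ ρ₀ v₀ ρ u v)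
    (h' : IsConservedSolution T mass lam ψ ρ₀ v₀ ρ' u' v') :
    ∀ᵐ t ∂(volume.restrict (Ioo 0 T)),
      ∫⁻ x, ‖spacePrim ρ (t, x) - spacePrim ρ' (t, x)‖ₑ ≤
      ∫⁻ τ in Ioo 0 t, ∫⁻ s in Ioo 0 mass,
        ‖massVelocity mass ρ v (τ, s) - massVelocity mass ρ' v' (τ, s)‖ₑ := by
  have hJ := h.integrable_u.sub h'.integrable_u
  have hα : Integrable fun z => ρ z * v z - ρ' z * v' z := h.integrable_v.sub h'.integrable_v
  -- The primitive is `ψ(ρ) − ψ(ρ')`, which has the sign of `ρ − ρ'` by monotonicity.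
  have hΨ : ∀ᵐ z, z.1 ∈ Ioo 0 T → 0 ≤ (ρ z - ρ' z) * spacePrim (fun z =>
      (ρ z * v z - ρ' z * v' z) - (ρ z * u z - ρ' z * u' z)) z := by
    filter_upwards [h.flux_eq, h'.flux_eq, h.nonneg, h'.nonneg,
      ae_spacePrim_sub (h.integrable_v.sub h.integrable_u)
        (h'.integrable_v.sub h'.integrable_u)] with z h1 h2 n1 n2 h3 hz
    have e : spacePrim (fun z => (ρ z * v z - ρ' z * v' z) - (ρ z * u z - ρ' z * u' z)) z =
        ψ (ρ z) - ψ (ρ' z) := by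
      rw [h1 hz, h2 hz]
      refine Eq.trans ?_ h3
      congr 1; ext z; simp only [Pi.sub_apply]; ring
    rw [e]
    rcases le_total (ρ z) (ρ' z) with hle | hle
    · exact mul_nonneg_of_nonpos_of_nonpos (by linarith) (by linarith [hψ n1 n2 hle])
    · exact mul_nonneg (by linarith) (by linarith [hψ n2 n1 hle])
  have key := integral_abs_spacePrim_le (T := T) (h.measurable_rho.sub h'.measurable_rho)
    (fun t => (h.density t).integrable.sub (h'.density t).integrable)
    (fun t => by
      have := integral_sub (h.density t).integrable (h'.density t).integrable
      rw [(h.density t).mass, (h'.density t).mass, sub_self] at this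
      exact this)
    hJ (fun z hz => by
      simp only [Pi.sub_apply, h.u_of_nonpos z hz, h'.u_of_nonpos z hz, sub_self]) hα
    (spacePrim_sub_eq hT h h') hΨ
  have hD := h.integrable_massVelocity.sub h'.integrable_massVelocity
  have hDm : Measurable fun w => massVelocity mass ρ v w - massVelocity mass ρ' v' w :=
    h.measurable_massVelocity.sub h'.measurable_massVelocity
  rw [ae_restrict_iff' measurableSet_Ioo]
  filter_upwards [key] with t ht htT
  obtain ⟨hNi, hle⟩ := ht htT
  have e0 : ∀ z, spacePrim (ρ - ρ') z = spacePrim ρ z - spacePrim ρ' z :=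
    fun z => h.spacePrim_density_sub h' z
  simp only [e0] at hNi hle
  have hDt : Integrable (fun w => massVelocity mass ρ v w - massVelocity mass ρ' v' w)
      ((volume.restrict (Ioo 0 t)).prod (volume.restrict (Ioo 0 mass))) :=
    hD.mono_measure (Measure.prod_mono (Measure.restrict_mono_set _
      (Ioo_subset_Ioo_right htT.2.le)) le_rfl)
  have hle2 : ∫ x, |spacePrim ρ (t, x) - spacePrim ρ' (t, x)| ≤
      ∫ w, ‖massVelocity mass ρ v w - massVelocity mass ρ' v' w‖
        ∂((volume.restrict (Ioo 0 t)).prod (volume.restrict (Ioo 0 mass))) := by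
    refine hle.trans ?_
    have hσm : Measurable fun z => Real.sign (spacePrim ρ z - spacePrim ρ' z) :=
      measurable_realSign.comp ((measurable_spacePrim h.measurable_rho).sub
        (measurable_spacePrim h'.measurable_rho))
    have hσα : Integrable (fun z => Real.sign (spacePrim ρ z - spacePrim ρ' z) *
        (ρ z * v z - ρ' z * v' z)) ((volume.restrict (Ioo 0 t)).prod volume) := by
      rw [← restrict_strip]
      exact (hα.bdd_mul (c := 1) hσm.aestronglyMeasurable
        (ae_of_all _ fun z => abs_realSign_le _)).integrableOn
    rw [restrict_strip, integral_prod _ hDt.norm]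
    rw [integral_prod _ hσα, ← integral_neg]
    refine integral_mono_ae hσα.integral_prod_left.neg hDt.norm.integral_prod_left ?_
    filter_upwards [ae_restrict_of_ae (integrable_slice_fst h.integrable_v),
      ae_restrict_of_ae (integrable_slice_fst h'.integrable_v)] with τ h1 h2
    exact (h.density τ).neg_integral_sign_le (h'.density τ)
      (h.measurable_v.comp (by fun_prop)) (h'.measurable_v.comp (by fun_prop)) h1 h2
  rw [← ofReal_integral_norm_eq_lintegral_enorm hNi]
  refine (ENNReal.ofReal_le_ofReal hle2).trans_eq ?_
  rw [ofReal_integral_norm_eq_lintegral_enorm hDt, lintegral_prod _ hDm.enorm.aemeasurable]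

end IsConservedSolution

/-! ### The weak equation for the differences in mass coordinates. -/

/-- Integration by parts in time against a primitive. -/
theorem integral_primitive_mul_deriv {k θ : ℝ → ℝ} {a b : ℝ} (hk : Integrable k)
    (hθ : IsCutoff a b θ) : ∫ t, primitive k t * deriv θ t = -∫ t, k t * θ t := by
  have h := integral_mul_comp_primitive hk hθ.deriv.integrable (ξ := fun x => x) contDiff_id
  have e : ∀ x, primitive (deriv θ) x = θ x := hθ.primitive_deriv
  simp only [deriv_id'', one_mul, e, hθ.integral_deriv_eq_zero, mul_zero, zero_sub] at h
  rw [h, neg_neg]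

/-- Only positive times contribute, and there the window reaches beyond the support of `τ`, hence
equals the full tail `∫ τ` over `(t,∞)`. Integration by parts then moves the primitive onto `k`. -/
theorem integral_mul_windowIntegral {k τ : ℝ → ℝ} {a b T : ℝ} (hk : Integrable k) (hb : b < T)
    (hk0 : ∀ t ≤ 0, k t = 0) (hτ : IsCutoff a b τ) :
    ∫ t, k t * windowIntegral τ T t = ∫ t, primitive k t * τ t := by
  have h := integral_mul_comp_primitive hk hτ.integrable (ξ := fun x => x) contDiff_id
  simp only [deriv_id'', one_mul] at h
  obtain ⟨C, hC⟩ := exists_bound_comp_primitive hτ.integrable continuous_id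
  have i1 : Integrable fun t => k t * primitive τ t :=
    hk.mul_bdd (c := C) (continuous_primitive hτ.integrable).aestronglyMeasurable
      (ae_of_all _ fun t => hC t)
  have e : ∀ t, k t * windowIntegral τ T t = k t * (∫ x, τ x) - k t * primitive τ t := fun t => by
    rcases le_or_gt t 0 with ht | ht
    · rw [hk0 t ht]; ring
    · have : primitive τ (t + T) = ∫ x, τ x := by
        refine setIntegral_eq_integral_of_forall_compl_eq_zero fun x hx => hτ.2 x fun hx' => ?_
        have := hx'.2
        simp only [mem_Iic, not_le] at hx
        linarith
      rw [windowIntegral, this]; ring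
  simp_rw [e]
  rw [integral_sub (hk.mul_const _) i1, integral_mul_const, h]
  ring

namespace IsConservedSolution

variable {T mass lam : ℝ} {ψ ρ₀ v₀ : ℝ → ℝ} {ρ u v ρ' u' v' : ℝ × ℝ → ℝ}

/-- Change of variables to mass coordinates. -/
theorem integral_mul_massVelocity (h : IsConservedSolution T mass lam ψ ρ₀ v₀ ρ u v)
    {α β c d : ℝ} {ξ θ : ℝ → ℝ} (hξ : IsCutoff α β ξ) (hθ : IsCutoff c d θ) :
    ∫ z in strip T, ρ z * v z * ξ (spacePrim ρ z) * θ z.1 =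
      ∫ w, massVelocity mass ρ v w * ξ w.2 * θ w.1
        ∂((volume.restrict (Ioo 0 T)).prod (volume.restrict (Ioo 0 mass))) := by
  obtain ⟨C, -, hC⟩ := hξ.exists_bound
  obtain ⟨D, -, hD⟩ := hθ.exists_bound
  have m1 : Measurable fun z : ℝ × ℝ => θ z.1 := hθ.continuous.measurable.comp measurable_fst
  have m2 : Measurable fun z : ℝ × ℝ => ξ z.2 := hξ.continuous.measurable.comp measurable_snd
  have m3 : Measurable fun z => ξ (spacePrim ρ z) :=
    hξ.continuous.measurable.comp (measurable_spacePrim h.measurable_rho)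
  have i1 : IntegrableOn (fun z => ρ z * v z * ξ (spacePrim ρ z) * θ z.1) (strip T) :=
    ((h.integrable_v.mul_bdd (c := C) m3.aestronglyMeasurable (ae_of_all _ fun z => hC _)).mul_bdd
      (c := D) m1.aestronglyMeasurable (ae_of_all _ fun z => hD _)).integrableOn
  have i2 : Integrable (fun w : ℝ × ℝ => massVelocity mass ρ v w * ξ w.2 * θ w.1)
      ((volume.restrict (Ioo 0 T)).prod (volume.restrict (Ioo 0 mass))) :=
    (h.integrable_massVelocity.mul_bdd (c := C) m2.aestronglyMeasurable
      (ae_of_all _ fun z => hC _)).mul_bdd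
      (c := D) m1.aestronglyMeasurable (ae_of_all _ fun z => hD _)
  rw [IntegrableOn, restrict_strip] at i1
  rw [restrict_strip, integral_prod _ i1, integral_prod _ i2]
  refine integral_congr_ae (ae_of_all _ fun t => ?_)
  simp only
  rw [integral_mul_const, integral_mul_const]
  congr 1
  have hv : Measurable fun x => v (t, x) := h.measurable_v.comp (by fun_prop)
  have hm : Measurable fun x => ξ (spacePrim ρ (t, x)) := m3.comp (by fun_prop)
  have e := (h.density t).integral_quantile (hv.mul hm)
  simp only [Pi.mul_apply] at e
  calc ∫ x, ρ (t, x) * v (t, x) * ξ (spacePrim ρ (t, x))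
      = ∫ x, ρ (t, x) * (v (t, x) * ξ (spacePrim ρ (t, x))) := by simp_rw [mul_assoc]
    _ = _ := e.symm
    _ = _ := by
      refine setIntegral_congr_fun measurableSet_Ioo fun s hs => ?_
      have := (h.density t).primitive_quantile hs
      simp only [spacePrim, massVelocity, lagrangian, this]

theorem integrable_comp_spacePrim_sub (hT : 0 < T)
    (h : IsConservedSolution T mass lam ψ ρ₀ v₀ ρ u v)
    (h' : IsConservedSolution T mass lam ψ ρ₀ v₀ ρ' u' v') {α β : ℝ} {ξ : ℝ → ℝ}
    (hξ : IsCutoff α β ξ) :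
    Integrable (fun z => primitive ξ (spacePrim ρ z) - primitive ξ (spacePrim ρ' z))
      ((volume.restrict (Ioo 0 T)).prod volume) := by
  obtain ⟨C, -, hC⟩ := hξ.exists_bound
  have m1 := (continuous_primitive hξ.integrable).measurable
  refine ((integrable_spacePrim_sub hT h h').norm.const_mul C).mono'
    ((m1.comp (measurable_spacePrim h.measurable_rho)).sub
      (m1.comp (measurable_spacePrim h'.measurable_rho))).aestronglyMeasurable
    (ae_of_all _ fun z => ?_)
  rw [primitive_sub hξ.integrable, Real.norm_eq_abs (_ - _)]
  exact intervalIntegral.norm_integral_le_of_norm_le_const fun x _ => hC x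

/-- The weak time derivative of the Lagrangian position difference. -/
theorem integral_lagrangian_sub_mul (hT : 0 < T)
    (h : IsConservedSolution T mass lam ψ ρ₀ v₀ ρ u v)
    (h' : IsConservedSolution T mass lam ψ ρ₀ v₀ ρ' u' v')
    {α β c d : ℝ} {ξ θ : ℝ → ℝ} (hα : 0 < α) (hβ : β < mass) (hξ : IsCutoff α β ξ) (hd : d < T)
    (hθ : IsCutoff c d θ) :
    ∫ w, (lagrangian mass ρ w - lagrangian mass ρ' w) * ξ w.2 * deriv θ w.1
        ∂((volume.restrict (Ioo 0 T)).prod (volume.restrict (Ioo 0 mass))) =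
      -∫ z, (ξ (spacePrim ρ z) * (ρ z * u z) - ξ (spacePrim ρ' z) * (ρ' z * u' z)) * θ z.1 := by
  obtain ⟨C, -, hC⟩ := hξ.exists_bound
  obtain ⟨D, -, hD⟩ := hθ.deriv.exists_bound
  obtain ⟨D', -, hD'⟩ := hθ.exists_bound
  have m1 : Measurable fun z : ℝ × ℝ => deriv θ z.1 :=
    hθ.deriv.continuous.measurable.comp measurable_fst
  have m1' : Measurable fun z : ℝ × ℝ => θ z.1 := hθ.continuous.measurable.comp measurable_fst
  have m2 : Measurable fun z : ℝ × ℝ => ξ z.2 := hξ.continuous.measurable.comp measurable_snd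
  have m3 : Measurable fun z => ξ (spacePrim ρ z) :=
    hξ.continuous.measurable.comp (measurable_spacePrim h.measurable_rho)
  have m3' : Measurable fun z => ξ (spacePrim ρ' z) :=
    hξ.continuous.measurable.comp (measurable_spacePrim h'.measurable_rho)
  have i2 : Integrable (fun w : ℝ × ℝ => (lagrangian mass ρ w - lagrangian mass ρ' w) * ξ w.2 *
      deriv θ w.1) ((volume.restrict (Ioo 0 T)).prod (volume.restrict (Ioo 0 mass))) :=
    ((integrable_lagrangian_sub hT h h').mul_bdd (c := C) m2.aestronglyMeasurable
      (ae_of_all _ fun z => hC _)).mul_bdd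
      (c := D) m1.aestronglyMeasurable (ae_of_all _ fun z => hD _)
  set k : ℝ × ℝ → ℝ := fun z =>
    ξ (spacePrim ρ z) * (ρ z * u z) - ξ (spacePrim ρ' z) * (ρ' z * u' z) with hk
  have ik1 : Integrable fun z => ξ (spacePrim ρ z) * (ρ z * u z) :=
    h.integrable_u.bdd_mul (c := C) m3.aestronglyMeasurable (ae_of_all _ fun z => hC _)
  have ik2 : Integrable fun z => ξ (spacePrim ρ' z) * (ρ' z * u' z) :=
    h'.integrable_u.bdd_mul (c := C) m3'.aestronglyMeasurable (ae_of_all _ fun z => hC _)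
  have ik : Integrable k := ik1.sub ik2
  have i3 : Integrable (fun z => (primitive ξ (spacePrim ρ z) - primitive ξ (spacePrim ρ' z)) *
      deriv θ z.1) ((volume.restrict (Ioo 0 T)).prod volume) :=
    (integrable_comp_spacePrim_sub hT h h' hξ).mul_bdd (c := D) m1.aestronglyMeasurable
      (ae_of_all _ fun z => hD _)
  have i4 : Integrable fun z => k z * θ z.1 :=
    ik.mul_bdd (c := D') m1'.aestronglyMeasurable (ae_of_all _ fun z => hD' _)
  -- Positions are replaced by distribution functions through duality, since the mass equation is
  -- available only for the latter.
  have e1 : ∫ w, (lagrangian mass ρ w - lagrangian mass ρ' w) * ξ w.2 * deriv θ w.1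
        ∂((volume.restrict (Ioo 0 T)).prod (volume.restrict (Ioo 0 mass))) =
      -∫ z, (primitive ξ (spacePrim ρ z) - primitive ξ (spacePrim ρ' z)) * deriv θ z.1
        ∂((volume.restrict (Ioo 0 T)).prod volume) := by
    rw [integral_prod _ i2, integral_prod _ i3, ← integral_neg]
    refine integral_congr_ae ?_
    filter_upwards [(integrable_spacePrim_sub hT h h').prod_right_ae] with t ht
    rw [integral_mul_const, integral_mul_const, ← neg_mul]
    congr 1
    exact (h.density t).integral_quantile_sub_mul (h'.density t) ht hα hβ hξ
  have hZ : ContDiff ℝ 1 (primitive ξ) := hξ.contDiff_primitive.of_le (by exact_mod_cast le_top)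
  have hdZ : deriv (primitive ξ) = ξ := funext fun x => (hξ.hasDerivAt_primitive x).deriv
  have hc1 := ae_comp_timePrim (neg_lt_zero.2 hT) h.integrable_u h.u_of_nonpos h.mass_eq hZ
  have hc2 := ae_comp_timePrim (neg_lt_zero.2 hT) h'.integrable_u h'.u_of_nonpos h'.mass_eq hZ
  rw [hdZ] at hc1 hc2
  have hpt : ∀ᵐ z, z.1 ∈ Ioo 0 T →
      primitive ξ (spacePrim ρ z) - primitive ξ (spacePrim ρ' z) = -timePrim k z := by
    filter_upwards [hc1, hc2, ae_timePrim_sub ik1 ik2] with z h1 h2 h3 hz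
    rw [h1 hz, h2 hz, h3]; ring
  rw [e1, neg_inj]
  have hz0 : Measure.prod volume volume = (volume : Measure (ℝ × ℝ)) := rfl
  rw [integral_prod_symm _ i3, ← hz0, integral_prod_symm _ i4]
  refine integral_congr_ae ?_
  filter_upwards [ae_slice_snd hpt, integrable_slice_snd ik] with x h1 h2
  have e2 : ∫ t in Ioo 0 T, (primitive ξ (spacePrim ρ (t, x)) - primitive ξ (spacePrim ρ' (t, x))) *
      deriv θ t = -∫ t, primitive (fun t => k (t, x)) t * deriv θ t := by
    rw [← integral_neg, ← setIntegral_eq_integral_of_forall_compl_eq_zero (s := Ioo 0 T)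
      (f := fun t => -(primitive (fun t => k (t, x)) t * deriv θ t))]
    · refine setIntegral_congr_ae measurableSet_Ioo ?_
      filter_upwards [h1] with t ht htT
      rw [ht htT, neg_mul]
      rfl
    -- Outside `(0,T)` nothing is lost: the primitive of `k` vanishes at nonpositive times, and `θ'`
    -- vanishes beyond `d < T`.
    · intro t ht
      rcases le_or_gt t 0 with h0 | h0
      · have : primitive (fun t => k (t, x)) t = 0 :=
          setIntegral_eq_zero_of_forall_eq_zero fun s hs => by
            have hs0 : s ≤ 0 := le_trans hs h0
            have a1 := h.u_of_nonpos (s, x) hs0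
            have a2 := h'.u_of_nonpos (s, x) hs0
            simp [hk, a1, a2]
        rw [this]; simp
      · rw [hθ.deriv.2 t fun h' => ht ⟨h0, h'.2.trans_lt hd⟩]; simp
  rw [e2, integral_primitive_mul_deriv h2 hθ, neg_neg]

/-- The difference of two solutions in mass coordinates: `∂ₜ(D - λY) = -λD`, weakly. -/
theorem integral_massVelocity_sub (hT : 0 < T) (hψ : Measurable ψ)
    (h : IsConservedSolution T mass lam ψ ρ₀ v₀ ρ u v)
    (h' : IsConservedSolution T mass lam ψ ρ₀ v₀ ρ' u' v')
    {α β c d : ℝ} {ξ θ : ℝ → ℝ} (hα : 0 < α) (hβ : β < mass) (hξ : IsCutoff α β ξ)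
    (hc : -T < c) (hd : d < T) (hθ : IsCutoff c d θ) :
    ∫ w, (massVelocity mass ρ v w - massVelocity mass ρ' v' w -
        lam * (lagrangian mass ρ w - lagrangian mass ρ' w)) * ξ w.2 * deriv θ w.1
        ∂((volume.restrict (Ioo 0 T)).prod (volume.restrict (Ioo 0 mass))) =
      lam * ∫ w, (massVelocity mass ρ v w - massVelocity mass ρ' v' w) * ξ w.2 * θ w.1
        ∂((volume.restrict (Ioo 0 T)).prod (volume.restrict (Ioo 0 mass))) := by
  have a1 := h.integral_mass_coordinate hψ hβ hξ hc hd hθ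
  have a2 := h'.integral_mass_coordinate hψ hβ hξ hc hd hθ
  have b1 := h.integral_mul_massVelocity hξ hθ
  have b2 := h'.integral_mul_massVelocity hξ hθ
  have c1 := h.integral_mul_massVelocity hξ hθ.deriv
  have c2 := h'.integral_mul_massVelocity hξ hθ.deriv
  have y := integral_lagrangian_sub_mul hT h h' hα hβ hξ hd hθ
  set m := (volume.restrict (Ioo 0 T)).prod (volume.restrict (Ioo 0 mass))
  obtain ⟨C, -, hC⟩ := hξ.exists_bound
  obtain ⟨D, -, hD⟩ := hθ.exists_bound
  obtain ⟨D', -, hD'⟩ := hθ.deriv.exists_bound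
  have m1 : Measurable fun z : ℝ × ℝ => θ z.1 := hθ.continuous.measurable.comp measurable_fst
  have m1' : Measurable fun z : ℝ × ℝ => deriv θ z.1 :=
    hθ.deriv.continuous.measurable.comp measurable_fst
  have m2 : Measurable fun z : ℝ × ℝ => ξ z.2 := hξ.continuous.measurable.comp measurable_snd
  have I : ∀ {f : ℝ × ℝ → ℝ} {ν : Measure (ℝ × ℝ)}, Integrable f ν →
      Integrable (fun w => f w * ξ w.2 * θ w.1) ν := fun hf =>
    (hf.mul_bdd (c := C) m2.aestronglyMeasurable (ae_of_all _ fun z => hC _)).mul_bdd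
      (c := D) m1.aestronglyMeasurable (ae_of_all _ fun z => hD _)
  have I' : ∀ {f : ℝ × ℝ → ℝ} {ν : Measure (ℝ × ℝ)}, Integrable f ν →
      Integrable (fun w => f w * ξ w.2 * deriv θ w.1) ν := fun hf =>
    (hf.mul_bdd (c := C) m2.aestronglyMeasurable (ae_of_all _ fun z => hC _)).mul_bdd
      (c := D') m1'.aestronglyMeasurable (ae_of_all _ fun z => hD' _)
  have J : ∀ {f g : ℝ × ℝ → ℝ} {ν : Measure (ℝ × ℝ)} {φ : ℝ × ℝ → ℝ},
      Measurable g → Integrable f ν → Measurable φ → (∃ B, ∀ z, |φ z| ≤ B) →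
      Integrable (fun w => f w * ξ (g w) * φ w) ν := fun hg hf hφ ⟨B, hB⟩ =>
    (hf.mul_bdd (c := C) (hξ.continuous.measurable.comp hg).aestronglyMeasurable
      (ae_of_all _ fun z => hC _)).mul_bdd
      (c := B) hφ.aestronglyMeasurable (ae_of_all _ fun z => hB _)
  have s1 := measurable_spacePrim h.measurable_rho
  have s2 := measurable_spacePrim h'.measurable_rho
  have Bθ : ∃ B, ∀ z : ℝ × ℝ, |θ z.1| ≤ B := ⟨D, fun z => hD _⟩
  have Bθ' : ∃ B, ∀ z : ℝ × ℝ, |deriv θ z.1| ≤ B := ⟨D', fun z => hD' _⟩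
  have iV := h.integrable_massVelocity
  have iV' := h'.integrable_massVelocity
  -- the contributions of nonpositive times cancel
  have early : (∫ z, ρ z * v z * ξ (spacePrim ρ z) * deriv θ z.1) -
        ∫ z, ρ' z * v' z * ξ (spacePrim ρ' z) * deriv θ z.1 =
      (∫ z in strip T, ρ z * v z * ξ (spacePrim ρ z) * deriv θ z.1) -
        ∫ z in strip T, ρ' z * v' z * ξ (spacePrim ρ' z) * deriv θ z.1 := by
    have j1 := J (φ := fun z => deriv θ z.1) s1 h.integrable_v m1' Bθ'
    have j2 := J (φ := fun z => deriv θ z.1) s2 h'.integrable_v m1' Bθ'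
    rw [← integral_sub j1 j2, ← integral_sub j1.integrableOn j2.integrableOn]
    refine (setIntegral_eq_integral_of_forall_compl_eq_zero fun z hz => ?_).symm
    by_cases hz1 : z.1 ∈ Ioc (-T) 0
    · have e : ∀ x, ρ (z.1, x) = ρ' (z.1, x) := fun x =>
        (h.early (z.1, x) hz1).1.trans (h'.early (z.1, x) hz1).1.symm
      have e2 : v z = v' z := (h.early z hz1).2.trans (h'.early z hz1).2.symm
      have e3 : spacePrim ρ z = spacePrim ρ' z := by simp only [spacePrim, e]
      rw [e3, e2, e z.2, sub_self]
    · have : deriv θ z.1 = 0 := hθ.deriv.2 _ fun hz2 => by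
        rcases le_or_gt z.1 0 with h0 | h0
        · exact hz1 ⟨hc.trans_le hz2.1, h0⟩
        · exact hz ⟨⟨h0, hz2.2.trans_lt hd⟩, mem_univ _⟩
      rw [this]; ring
  -- splitting of the right-hand sides
  have split : ∀ {ρ u v : ℝ × ℝ → ℝ}, IsConservedSolution T mass lam ψ ρ₀ v₀ ρ u v →
      ∫ z in strip T, θ z.1 * ((ρ z * v z - ρ z * u z) * ξ (spacePrim ρ z)) =
      (∫ z in strip T, ρ z * v z * ξ (spacePrim ρ z) * θ z.1) -
        ∫ z, ρ z * u z * ξ (spacePrim ρ z) * θ z.1 := fun {ρ u v} h => by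
    have s1 := measurable_spacePrim h.measurable_rho
    have j1 := J (φ := fun z => θ z.1) s1 h.integrable_v m1 Bθ
    have j2 := J (φ := fun z => θ z.1) s1 h.integrable_u m1 Bθ
    rw [← setIntegral_eq_integral_of_forall_compl_eq_zero (s := strip T)
      (f := fun z => ρ z * u z * ξ (spacePrim ρ z) * θ z.1) (fun z hz => by
      rw [h.u_off z fun hz' => hz ⟨hz', mem_univ _⟩]; ring),
      ← integral_sub j1.integrableOn j2.integrableOn]
    exact integral_congr_ae (ae_of_all _ fun z => by ring)
  rw [split h, b1] at a1
  rw [split h', b2] at a2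
  rw [a1, a2, c1, c2] at early
  have e1 : ∫ w, (massVelocity mass ρ v w - massVelocity mass ρ' v' w -
        lam * (lagrangian mass ρ w - lagrangian mass ρ' w)) * ξ w.2 * deriv θ w.1 ∂m =
      (∫ w, massVelocity mass ρ v w * ξ w.2 * deriv θ w.1 ∂m) -
      (∫ w, massVelocity mass ρ' v' w * ξ w.2 * deriv θ w.1 ∂m) -
      lam * ∫ w, (lagrangian mass ρ w - lagrangian mass ρ' w) * ξ w.2 * deriv θ w.1 ∂m := by
    have iY := I' (integrable_lagrangian_sub hT h h')
    have iVV : Integrable (fun w => massVelocity mass ρ v w * ξ w.2 * deriv θ w.1 -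
        massVelocity mass ρ' v' w * ξ w.2 * deriv θ w.1) m := (I' iV).sub (I' iV')
    rw [← integral_const_mul, ← integral_sub (I' iV) (I' iV'),
      ← integral_sub iVV (iY.const_mul lam)]
    exact integral_congr_ae (ae_of_all _ fun z => by ring)
  have e2 : ∫ w, (massVelocity mass ρ v w - massVelocity mass ρ' v' w) * ξ w.2 * θ w.1 ∂m =
      (∫ w, massVelocity mass ρ v w * ξ w.2 * θ w.1 ∂m) -
      ∫ w, massVelocity mass ρ' v' w * ξ w.2 * θ w.1 ∂m := by
    rw [← integral_sub (I iV) (I iV')]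
    exact integral_congr_ae (ae_of_all _ fun z => by ring)
  have e3 : ∫ z, (ξ (spacePrim ρ z) * (ρ z * u z) - ξ (spacePrim ρ' z) * (ρ' z * u' z)) * θ z.1 =
      (∫ z, ρ z * u z * ξ (spacePrim ρ z) * θ z.1) -
        ∫ z, ρ' z * u' z * ξ (spacePrim ρ' z) * θ z.1 := by
    rw [← integral_sub (J (φ := fun z => θ z.1) s1 h.integrable_u m1 Bθ)
      (J (φ := fun z => θ z.1) s2 h'.integrable_u m1 Bθ)]
    exact integral_congr_ae (ae_of_all _ fun z => by ring)
  rw [e1, e2, y, e3, ← early]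
  ring

end IsConservedSolution

/-! ### Time primitives over the strip. -/

section TimePrimitive

variable {T : ℝ} {ν : Measure ℝ} {f : ℝ × ℝ → ℝ}

theorem slice_indicator_strip (f : ℝ × ℝ → ℝ) (x : ℝ) :
    (fun t => (strip T).indicator f (t, x)) = (Ioo 0 T).indicator fun t => f (t, x) := by
  ext t
  by_cases ht : t ∈ Ioo 0 T
  · rw [indicator_of_mem ht]
    exact indicator_of_mem (show (t, x) ∈ strip T from ⟨ht, mem_univ _⟩) _
  · rw [indicator_of_notMem ht]
    exact indicator_of_notMem (show (t, x) ∉ strip T from fun h => ht h.1) _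

theorem ae_integrable_slice_indicator [SFinite ν]
    (hf : Integrable f ((volume.restrict (Ioo 0 T)).prod ν)) :
    ∀ᵐ x ∂ν, Integrable fun t => (strip T).indicator f (t, x) := by
  filter_upwards [hf.prod_left_ae] with x hx
  rw [slice_indicator_strip, integrable_indicator_iff measurableSet_Ioo]
  exact hx

theorem integrable_timePrim_indicator [SFinite ν] (hm : Measurable f)
    (hf : Integrable f ((volume.restrict (Ioo 0 T)).prod ν)) :
    Integrable (timePrim ((strip T).indicator f)) ((volume.restrict (Ioo 0 T)).prod ν) := by
  have hb : Integrable (fun w : ℝ × ℝ => ∫ t in Ioo 0 T, ‖f (t, w.2)‖)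
      ((volume.restrict (Ioo 0 T)).prod ν) :=
    (hf.norm.integral_prod_right).comp_snd (volume.restrict (Ioo 0 T))
  refine hb.mono' (measurable_timePrim
    (hm.indicator (measurableSet_strip T))).aestronglyMeasurable ?_
  filter_upwards [Measure.quasiMeasurePreserving_snd.ae (ae_integrable_slice_indicator hf)]
    with w hw
  refine (abs_primitive_le hw w.1).trans_eq ?_
  rw [← integral_indicator measurableSet_Ioo]
  congr 1
  ext t
  have : (strip T).indicator f (t, w.2) = _ := congrFun (slice_indicator_strip f w.2) t
  rw [this]
  by_cases ht : t ∈ Ioo 0 T <;> simp [ht]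

/-- Integration by parts in time over the strip. -/
theorem integral_mul_windowIntegral_prod [SFinite ν] (hm : Measurable f)
    (hf : Integrable f ((volume.restrict (Ioo 0 T)).prod ν)) {a b c d : ℝ} {τ ξ : ℝ → ℝ}
    (hT : 0 < T) (ha : 0 < a) (hb : b < T) (hτ : IsCutoff a b τ) (hξ : IsCutoff c d ξ) :
    ∫ w, f w * ξ w.2 * windowIntegral τ T w.1 ∂((volume.restrict (Ioo 0 T)).prod ν) =
      ∫ w, timePrim ((strip T).indicator f) w * ξ w.2 * τ w.1
        ∂((volume.restrict (Ioo 0 T)).prod ν) := by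
  obtain ⟨C, -, hC⟩ := hτ.exists_bound
  obtain ⟨C', -, hC'⟩ := hξ.exists_bound
  obtain ⟨C'', -, hC''⟩ := (hτ.windowIntegral hT.le).exists_bound
  have mτ : Measurable fun w : ℝ × ℝ => τ w.1 := hτ.continuous.measurable.comp measurable_fst
  have mξ : Measurable fun w : ℝ × ℝ => ξ w.2 := hξ.continuous.measurable.comp measurable_snd
  have mθ : Measurable fun w : ℝ × ℝ => windowIntegral τ T w.1 :=
    (hτ.windowIntegral hT.le).continuous.measurable.comp measurable_fst
  have K := ((integrable_timePrim_indicator hm hf).mul_bdd (c := C') mξ.aestronglyMeasurable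
    (ae_of_all _ fun z => hC' _)).mul_bdd (c := C) mτ.aestronglyMeasurable
    (ae_of_all _ fun z => hC _)
  have K' := (hf.mul_bdd (c := C') mξ.aestronglyMeasurable
    (ae_of_all _ fun z => hC' _)).mul_bdd (c := C'') mθ.aestronglyMeasurable
    (ae_of_all _ fun z => hC'' _)
  rw [integral_prod_symm _ K', integral_prod_symm _ K]
  refine integral_congr_ae ?_
  filter_upwards [ae_integrable_slice_indicator hf] with s hs
  have e3 := integral_mul_windowIntegral hs hb (fun t ht => indicator_of_notMem
    (fun h => absurd h.1.1 (not_lt.2 ht)) _) hτ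
  have e4 : ∫ t in Ioo 0 T, f (t, s) * windowIntegral τ T t =
      ∫ t, (strip T).indicator f (t, s) * windowIntegral τ T t := by
    rw [← integral_indicator measurableSet_Ioo]
    congr 1
    ext t
    have : (strip T).indicator f (t, s) = _ := congrFun (slice_indicator_strip f s) t
    rw [this]
    by_cases ht : t ∈ Ioo 0 T <;> simp [ht]
  have e5 : ∫ t in Ioo 0 T, timePrim ((strip T).indicator f) (t, s) * τ t =
      ∫ t, primitive (fun t => (strip T).indicator f (t, s)) t * τ t :=
    setIntegral_eq_integral_of_forall_compl_eq_zero fun t ht => by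
      rw [hτ.2 t fun h => ht ⟨ha.trans_le h.1, h.2.trans_lt hb⟩, mul_zero]
  calc ∫ t in Ioo 0 T, f (t, s) * ξ s * windowIntegral τ T t
      = ξ s * ∫ t in Ioo 0 T, f (t, s) * windowIntegral τ T t := by
        rw [← integral_const_mul]; congr 1; ext t; ring
    _ = ξ s * ∫ t in Ioo 0 T, timePrim ((strip T).indicator f) (t, s) * τ t := by rw [e4, e5, e3]
    _ = _ := by rw [← integral_const_mul]; congr 1; ext t; ring

theorem IsCutoff.deriv_windowIntegral_of_pos {a b : ℝ} {τ : ℝ → ℝ} (hτ : IsCutoff a b τ)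
    (hb : b < T) {t : ℝ} (ht : 0 < t) : _root_.deriv (DegenerateNS.windowIntegral τ T) t = -τ t := by
  rw [(hτ.hasDerivAt_windowIntegral T t).deriv, hτ.2 (t + T) fun h => by linarith [h.2], zero_sub]

theorem ae_fst_mem_Ioo [SFinite ν] :
    ∀ᵐ w ∂((volume.restrict (Ioo 0 T)).prod ν), w.1 ∈ Ioo 0 T :=
  Measure.quasiMeasurePreserving_fst.ae (ae_restrict_mem measurableSet_Ioo)

end TimePrimitive

/-! ### The Volterra equation and uniqueness of conserved solutions. -/

namespace IsConservedSolution

variable {T mass lam : ℝ} {ψ ρ₀ v₀ : ℝ → ℝ} {ρ u v ρ' u' v' : ℝ × ℝ → ℝ}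

/-- The velocity difference in mass coordinates solves a linear Volterra equation driven by the
difference of the Lagrangian positions. -/
theorem massVelocity_sub_eq (hT : 0 < T) (hmass : 0 < mass) (hψ : Measurable ψ)
    (h : IsConservedSolution T mass lam ψ ρ₀ v₀ ρ u v)
    (h' : IsConservedSolution T mass lam ψ ρ₀ v₀ ρ' u' v') :
    ∀ᵐ w ∂((volume.restrict (Ioo 0 T)).prod (volume.restrict (Ioo 0 mass))),
      massVelocity mass ρ v w - massVelocity mass ρ' v' w -
        lam * (lagrangian mass ρ w - lagrangian mass ρ' w) +
        lam * ∫ τ in Ioo 0 w.1,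
          (massVelocity mass ρ v (τ, w.2) - massVelocity mass ρ' v' (τ, w.2)) = 0 := by
  set m := (volume.restrict (Ioo 0 T)).prod (volume.restrict (Ioo 0 mass)) with hm
  set D : ℝ × ℝ → ℝ := fun w => massVelocity mass ρ v w - massVelocity mass ρ' v' w
  set Y : ℝ × ℝ → ℝ := fun w => lagrangian mass ρ w - lagrangian mass ρ' w
  have iD : Integrable D m := h.integrable_massVelocity.sub h'.integrable_massVelocity
  have iY : Integrable Y m := integrable_lagrangian_sub hT h h'
  have mD : Measurable D := h.measurable_massVelocity.sub h'.measurable_massVelocity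
  let D₁ : ℝ × ℝ → ℝ := (strip T).indicator D
  have iI : Integrable (timePrim D₁) m := integrable_timePrim_indicator mD iD
  set G : ℝ × ℝ → ℝ := fun w => D w - lam * Y w + lam * timePrim D₁ w with hG
  have iG : Integrable G m := (iD.sub (iY.const_mul lam)).add (iI.const_mul lam)
  suffices hG0 : ∀ᵐ w ∂m, G w = 0 by
    filter_upwards [hG0, ae_fst_mem_Ioo] with w hw hwT
    have e : timePrim D₁ w = ∫ τ in Ioo 0 w.1, D (τ, w.2) := by
      rw [timePrim, primitive, slice_indicator_strip, setIntegral_indicator measurableSet_Ioo,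
        ← integral_Ioc_eq_integral_Ioo]
      congr 2
      ext τ
      simp only [mem_inter_iff, mem_Iic, mem_Ioo, mem_Ioc]
      exact ⟨fun h => ⟨h.2.1, h.1⟩, fun h => ⟨h.2, h.1, h.2.trans_lt hwT.2⟩⟩
    rw [← e]
    exact hw
  refine ae_eq_zero_of_forall_cutoff hT iG fun a b τ ha hab hb hτ => ?_
  obtain ⟨C, -, hC⟩ := hτ.exists_bound
  have mτ : Measurable fun w : ℝ × ℝ => τ w.1 := hτ.continuous.measurable.comp measurable_fst
  have iτG : Integrable (fun w => τ w.1 * G w) m :=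
    iG.bdd_mul (c := C) mτ.aestronglyMeasurable (ae_of_all _ fun w => hC _)
  have hloc : LocallyIntegrableOn (fun s => ∫ t in Ioo 0 T, τ t * G (t, s)) (Ioo 0 mass) :=
    IntegrableOn.locallyIntegrableOn iτG.integral_prod_right
  rw [ae_restrict_iff' measurableSet_Ioo]
  refine isOpen_Ioo.ae_eq_zero_of_integral_contDiff_smul_eq_zero hloc fun ξ h1 h2 h3 => ?_
  obtain ⟨α, β, hα, -, hβ, hξ⟩ := exists_isCutoff_of_tsupport_subset h1 h2 hmass h3
  -- The window of length `T` has derivative `-τ` on `(0,T)`, and its support starts at `a - T >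
  -- -T`. It need not vanish at time `0`; this is where the equality of the initial data is used.
  have key := integral_massVelocity_sub hT hψ h h' hα hβ hξ (c := a - T) (by linarith) hb
    (hτ.windowIntegral hT.le)
  obtain ⟨C', -, hC'⟩ := hξ.exists_bound
  have mξ : Measurable fun w : ℝ × ℝ => ξ w.2 := hξ.continuous.measurable.comp measurable_snd
  have K : ∀ {f : ℝ × ℝ → ℝ}, Integrable f m → Integrable (fun w => f w * ξ w.2 * τ w.1) m :=
    fun hf => (hf.mul_bdd (c := C') mξ.aestronglyMeasurable (ae_of_all _ fun z => hC' _)).mul_bdd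
      (c := C) mτ.aestronglyMeasurable (ae_of_all _ fun z => hC _)
  have e1 : ∫ w, (D w - lam * Y w) * ξ w.2 * deriv (windowIntegral τ T) w.1 ∂m =
      -∫ w, (D w - lam * Y w) * ξ w.2 * τ w.1 ∂m := by
    rw [← integral_neg]
    refine integral_congr_ae ?_
    filter_upwards [ae_fst_mem_Ioo] with w hw
    rw [hτ.deriv_windowIntegral_of_pos hb hw.1]
    ring
  have e2 := integral_mul_windowIntegral_prod mD iD hT ha hb hτ hξ
  have e6 : ∫ s, ξ s • ∫ t in Ioo 0 T, τ t * G (t, s) =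
      (∫ w, (D w - lam * Y w) * ξ w.2 * τ w.1 ∂m) + lam * ∫ w, timePrim D₁ w * ξ w.2 * τ w.1 ∂m := by
    have iDY : Integrable (fun w => D w - lam * Y w) m := iD.sub (iY.const_mul lam)
    rw [← integral_const_mul, ← integral_add (K iDY)
      ((K iI).const_mul lam), ← setIntegral_eq_integral_of_forall_compl_eq_zero (s := Ioo 0 mass)]
    · have e7 : ∀ w : ℝ × ℝ, (D w - lam * Y w) * ξ w.2 * τ w.1 +
          lam * (timePrim D₁ w * ξ w.2 * τ w.1) = ξ w.2 * (τ w.1 * G w) := fun w => by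
        rw [hG]; ring
      have i7 : Integrable (fun w : ℝ × ℝ => ξ w.2 * (τ w.1 * G w)) m :=
        iτG.bdd_mul (c := C') mξ.aestronglyMeasurable (ae_of_all _ fun z => hC' _)
      refine Eq.trans ?_ (integral_congr_ae (ae_of_all _ fun w => (e7 w).symm))
      rw [hm, integral_prod_symm _ i7]
      refine integral_congr_ae (ae_of_all _ fun s => ?_)
      simp only [smul_eq_mul]
      rw [integral_const_mul]
    · intro s hs
      rw [hξ.2 s fun h => hs ⟨hα.trans_le h.1, h.2.trans_lt hβ⟩, zero_smul]
  rw [e6, ← e2, ← key, e1]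
  ring

/-- In the Volterra equation the position term and the memory term each contribute `λ` times the
same time integral; the position term is bounded through the `L¹` distance of the distribution
functions. -/
theorem lintegral_massVelocity_sub_le (hT : 0 < T) (hmass : 0 < mass) (hlam : 0 ≤ lam)
    (hψ : Measurable ψ) (hmono : MonotoneOn ψ (Ici 0))
    (h : IsConservedSolution T mass lam ψ ρ₀ v₀ ρ u v)
    (h' : IsConservedSolution T mass lam ψ ρ₀ v₀ ρ' u' v') :
    ∀ᵐ t ∂(volume.restrict (Ioo 0 T)),
      ∫⁻ s in Ioo 0 mass, ‖massVelocity mass ρ v (t, s) - massVelocity mass ρ' v' (t, s)‖ₑ ≤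
      ENNReal.ofReal (2 * lam) * ∫⁻ τ in Ioo 0 t, ∫⁻ s in Ioo 0 mass,
        ‖massVelocity mass ρ v (τ, s) - massVelocity mass ρ' v' (τ, s)‖ₑ := by
  have mD : Measurable fun w => massVelocity mass ρ v w - massVelocity mass ρ' v' w :=
    h.measurable_massVelocity.sub h'.measurable_massVelocity
  have mY : Measurable fun w => lagrangian mass ρ w - lagrangian mass ρ' w :=
    (measurable_lagrangian h.measurable_rho h.density).sub
      (measurable_lagrangian h'.measurable_rho h'.density)
  filter_upwards [Measure.ae_ae_of_ae_prod (massVelocity_sub_eq hT hmass hψ h h'),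
    lintegral_spacePrim_sub_le hT hmono h h'] with t h1 h2
  have hX : ∫⁻ s in Ioo 0 mass, ‖lagrangian mass ρ (t, s) - lagrangian mass ρ' (t, s)‖ₑ ≤
      ∫⁻ x, ‖spacePrim ρ (t, x) - spacePrim ρ' (t, x)‖ₑ := by
    have := (h.density t).lintegral_quantile_sub_le (h'.density t)
    exact this
  set J := ∫⁻ τ in Ioo 0 t, ∫⁻ s in Ioo 0 mass,
        ‖massVelocity mass ρ v (τ, s) - massVelocity mass ρ' v' (τ, s)‖ₑ with hJ
  have e2 : ENNReal.ofReal (2 * lam) = ENNReal.ofReal lam + ENNReal.ofReal lam := by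
    rw [← ENNReal.ofReal_add hlam hlam, two_mul]
  calc ∫⁻ s in Ioo 0 mass, ‖massVelocity mass ρ v (t, s) - massVelocity mass ρ' v' (t, s)‖ₑ
      ≤ ∫⁻ s in Ioo 0 mass, (ENNReal.ofReal lam *
          ‖lagrangian mass ρ (t, s) - lagrangian mass ρ' (t, s)‖ₑ + ENNReal.ofReal lam *
          ∫⁻ τ in Ioo 0 t, ‖massVelocity mass ρ v (τ, s) - massVelocity mass ρ' v' (τ, s)‖ₑ) := by
        refine lintegral_mono_ae ?_
        filter_upwards [h1] with s hs
        have e : massVelocity mass ρ v (t, s) - massVelocity mass ρ' v' (t, s) =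
            lam * (lagrangian mass ρ (t, s) - lagrangian mass ρ' (t, s)) - lam *
            ∫ τ in Ioo 0 t, (massVelocity mass ρ v (τ, s) - massVelocity mass ρ' v' (τ, s)) := by
          linarith
        rw [e]
        refine (enorm_sub_le).trans ?_
        rw [enorm_mul, enorm_mul, Real.enorm_eq_ofReal hlam]
        gcongr
        exact enorm_integral_le_lintegral_enorm _
    _ = ENNReal.ofReal lam *
          (∫⁻ s in Ioo 0 mass, ‖lagrangian mass ρ (t, s) - lagrangian mass ρ' (t, s)‖ₑ) +
        ENNReal.ofReal lam * J := by
        have m2 : Measurable fun s => ‖lagrangian mass ρ (t, s) - lagrangian mass ρ' (t, s)‖ₑ :=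
          (mY.comp (measurable_const.prodMk measurable_id)).enorm
        rw [lintegral_add_left (m2.const_mul _), lintegral_const_mul' _ _ ENNReal.ofReal_ne_top,
          lintegral_const_mul' _ _ ENNReal.ofReal_ne_top, hJ, lintegral_lintegral_swap]
        exact (mD.comp measurable_swap).enorm.aemeasurable
    _ ≤ ENNReal.ofReal lam * J + ENNReal.ofReal lam * J := by
        gcongr
        exact hX.trans h2
    _ = _ := by rw [e2, add_mul]

/-- Uniqueness of conserved solutions. -/
theorem unique (hT : 0 < T) (hmass : 0 < mass) (hlam : 0 < lam)
    (hψ : Measurable ψ) (hmono : MonotoneOn ψ (Ici 0))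
    (h : IsConservedSolution T mass lam ψ ρ₀ v₀ ρ u v)
    (h' : IsConservedSolution T mass lam ψ ρ₀ v₀ ρ' u' v') :
    ∀ᵐ z ∂(volume.restrict (strip T)), ρ z = ρ' z ∧ (ρ z = 0 ∨ v z = v' z) := by
  have mD : Measurable fun w => massVelocity mass ρ v w - massVelocity mass ρ' v' w :=
    h.measurable_massVelocity.sub h'.measurable_massVelocity
  have iD : Integrable (fun w => massVelocity mass ρ v w - massVelocity mass ρ' v' w)
      ((volume.restrict (Ioo 0 T)).prod (volume.restrict (Ioo 0 mass))) :=
    h.integrable_massVelocity.sub h'.integrable_massVelocity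
  have hfin := iD.2
  rw [hasFiniteIntegral_iff_enorm, lintegral_prod _ mD.enorm.aemeasurable] at hfin
  have hg := ae_eq_zero_of_le_lintegral (C := 2 * lam) (by positivity)
    mD.enorm.lintegral_prod_right' hfin.ne
    (lintegral_massVelocity_sub_le hT hmass hlam.le hψ hmono h h')
  have hslice : ∀ᵐ t ∂(volume.restrict (Ioo 0 T)), ∀ᵐ x,
      ρ (t, x) = ρ' (t, x) ∧ (ρ (t, x) = 0 ∨ v (t, x) = v' (t, x)) := by
    filter_upwards [hg, lintegral_spacePrim_sub_le hT hmono h h', ae_restrict_mem measurableSet_Ioo]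
      with t h1 h2 htT
    have hz : ∫⁻ τ in Ioo 0 t, ∫⁻ s in Ioo 0 mass,
        ‖massVelocity mass ρ v (τ, s) - massVelocity mass ρ' v' (τ, s)‖ₑ = 0 := by
      rw [← nonpos_iff_eq_zero]
      refine (lintegral_mono_set (Ioo_subset_Ioo_right htT.2.le)).trans_eq ?_
      rw [lintegral_congr_ae hg, lintegral_zero]
    rw [hz, nonpos_iff_eq_zero] at h2
    have hd := h.density t
    have hd' := h'.density t
    have c1 : Continuous fun x => spacePrim ρ (t, x) := continuous_primitive hd.integrable
    have c2 : Continuous fun x => spacePrim ρ' (t, x) := continuous_primitive hd'.integrable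
    have hM : ∀ x, primitive (fun x => ρ (t, x)) x = primitive (fun x => ρ' (t, x)) x := by
      have c12 : Continuous fun x => spacePrim ρ (t, x) - spacePrim ρ' (t, x) := c1.sub c2
      rw [lintegral_eq_zero_iff c12.measurable.enorm] at h2
      have hae : (fun x => spacePrim ρ (t, x)) =ᵐ[volume] fun x => spacePrim ρ' (t, x) := by
        filter_upwards [h2] with x hx
        simpa [sub_eq_zero] using hx
      exact congrFun (Continuous.ae_eq_iff_eq volume c1 c2 |>.1 hae)
    have hρ := ae_eq_of_primitive_eq hd.integrable hd'.integrable hM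
    -- With a common quantile function, the vanishing of the difference in mass coordinates becomes,
    -- after changing variables, equality of the velocities almost everywhere for the measure `ρ
    -- dx`.
    have hq : quantile mass (fun x => ρ (t, x)) = quantile mass fun x => ρ' (t, x) := by
      ext s; simp only [quantile, hM]
    have hv : Measurable fun x => ‖v (t, x) - v' (t, x)‖ₑ :=
      ((h.measurable_v.sub h'.measurable_v).comp (measurable_const.prodMk measurable_id)).enorm
    have e := hd.lintegral_quantile hv
    have h1' : ∫⁻ s in Ioo 0 mass, ‖v (t, quantile mass (fun x => ρ (t, x)) s) -
        v' (t, quantile mass (fun x => ρ (t, x)) s)‖ₑ = 0 := by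
      rw [← h1]
      simp only [massVelocity, lagrangian, hq]
    have hρv : Measurable fun x => ENNReal.ofReal (ρ (t, x)) * ‖v (t, x) - v' (t, x)‖ₑ :=
      hd.measurable.ennreal_ofReal.mul hv
    rw [h1', eq_comm, lintegral_eq_zero_iff hρv] at e
    filter_upwards [hρ, e, hd.nonneg] with x h3 h4 h5
    refine ⟨h3, ?_⟩
    rcases mul_eq_zero.1 h4 with h6 | h6
    · exact Or.inl (le_antisymm (ENNReal.ofReal_eq_zero.1 h6) h5)
    · exact Or.inr (by simpa [sub_eq_zero] using h6)
  rw [restrict_strip]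
  refine (Measure.ae_prod_iff_ae_ae ?_).2 hslice
  exact (measurableSet_eq_fun h.measurable_rho h'.measurable_rho).inter
    ((measurableSet_eq_fun h.measurable_rho measurable_const).union
      (measurableSet_eq_fun h.measurable_v h'.measurable_v))

end IsConservedSolution

/-! ### From distributional equations to identities between primitives. -/

section WeakForms

variable {T a b c d : ℝ} {θ Φ : ℝ → ℝ}

theorem IsCutoff.hasFDerivAt_mul (hθ : IsCutoff a b θ) (hΦ : IsCutoff c d Φ) (z : ℝ × ℝ) :
    HasFDerivAt (fun z : ℝ × ℝ => θ z.1 * Φ z.2)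
      (θ z.1 • (_root_.deriv Φ z.2 • ContinuousLinearMap.snd ℝ ℝ ℝ) +
        Φ z.2 • (_root_.deriv θ z.1 • ContinuousLinearMap.fst ℝ ℝ ℝ)) z :=
  ((hθ.hasDerivAt z.1).comp_hasFDerivAt z hasFDerivAt_fst).mul
    ((hΦ.hasDerivAt z.2).comp_hasFDerivAt z hasFDerivAt_snd)

theorem IsCutoff.dt_mul (hθ : IsCutoff a b θ) (hΦ : IsCutoff c d Φ) (z : ℝ × ℝ) :
    dt (fun z : ℝ × ℝ => θ z.1 * Φ z.2) z = _root_.deriv θ z.1 * Φ z.2 := by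
  rw [dt, (hθ.hasFDerivAt_mul hΦ z).fderiv]
  simp [mul_comm]

theorem IsCutoff.dx_mul (hθ : IsCutoff a b θ) (hΦ : IsCutoff c d Φ) (z : ℝ × ℝ) :
    dx (fun z : ℝ × ℝ => θ z.1 * Φ z.2) z = θ z.1 * _root_.deriv Φ z.2 := by
  rw [dx, (hθ.hasFDerivAt_mul hΦ z).fderiv]
  simp

theorem IsCutoff.tsupport_mul_subset (hθ : IsCutoff a b θ) (hΦ : IsCutoff c d Φ) :
    tsupport (fun z : ℝ × ℝ => θ z.1 * Φ z.2) ⊆ Icc a b ×ˢ Icc c d := by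
  refine closure_minimal (fun z hz => ?_) (isClosed_Icc.prod isClosed_Icc)
  by_contra hz'
  refine hz ?_
  by_cases h1 : z.1 ∈ Icc a b
  · simp only [hΦ.2 z.2 fun h2 => hz' ⟨h1, h2⟩, mul_zero]
  · simp only [hθ.2 z.1 h1, zero_mul]

theorem IsCutoff.contDiff_mul (hθ : IsCutoff a b θ) (hΦ : IsCutoff c d Φ) :
    ContDiff ℝ (⊤ : ℕ∞) (fun z : ℝ × ℝ => θ z.1 * Φ z.2) :=
  (hθ.1.comp contDiff_fst).mul (hΦ.1.comp contDiff_snd)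

theorem IsCutoff.hasCompactSupport_mul (hθ : IsCutoff a b θ) (hΦ : IsCutoff c d Φ) :
    HasCompactSupport (fun z : ℝ × ℝ => θ z.1 * Φ z.2) :=
  (isCompact_Icc.prod isCompact_Icc).of_isClosed_subset (isClosed_tsupport _)
    (hθ.tsupport_mul_subset hΦ)

theorem IsCutoff.isTest_mul (hθ : IsCutoff a b θ) (hΦ : IsCutoff c d Φ) (ha : 0 < a)
    (hb : b < T) : IsTest T (fun z : ℝ × ℝ => θ z.1 * Φ z.2) :=
  ⟨hθ.contDiff_mul hΦ, hθ.hasCompactSupport_mul hΦ, (hθ.tsupport_mul_subset hΦ).trans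
    (prod_mono (fun _ hx => ⟨ha.trans_le hx.1, hx.2.trans_lt hb⟩) (subset_univ _))⟩

theorem IsCutoff.isTestInit_mul (hθ : IsCutoff a b θ) (hΦ : IsCutoff c d Φ)
    (hb : b < T) : IsTestInit T (fun z : ℝ × ℝ => θ z.1 * Φ z.2) :=
  ⟨hθ.contDiff_mul hΦ, hθ.hasCompactSupport_mul hΦ, (hθ.tsupport_mul_subset hΦ).trans
    (prod_mono (fun _ hx => hx.2.trans_lt hb) (subset_univ _))⟩

/-- A function with an integrable weak space derivative is the primitive of that derivative. -/
theorem ae_eq_spacePrim_of_weak (hT : 0 < T) {f g : ℝ × ℝ → ℝ}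
    (hf : Integrable f ((volume.restrict (Ioo 0 T)).prod volume))
    (hg : Integrable g ((volume.restrict (Ioo 0 T)).prod volume)) (hgm : Measurable g)
    (h : ∀ a b τ, 0 < a → b < T → IsCutoff a b τ → ∀ c d Φ, IsCutoff c d Φ →
      ∫ z, f z * deriv Φ z.2 * τ z.1 ∂((volume.restrict (Ioo 0 T)).prod volume) =
        -∫ z, g z * Φ z.2 * τ z.1 ∂((volume.restrict (Ioo 0 T)).prod volume)) :
    ∀ᵐ z ∂((volume.restrict (Ioo 0 T)).prod volume), f z = spacePrim g z := by
  -- A space primitive is bounded on almost every time slice but in general not integrable over the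
  -- line, so the comparison is made on bounded intervals.
  have hrect : ∀ n : ℕ, ∀ᵐ z, z ∈ Ioo 0 T ×ˢ Ioo (-(n : ℝ)) n → f z = spacePrim g z := fun n => by
    rw [← ae_restrict_iff' (measurableSet_Ioo.prod measurableSet_Ioo), Measure.volume_eq_prod,
      ← Measure.prod_restrict]
    set ν := (volume : Measure ℝ).restrict (Ioo (-(n : ℝ)) n)
    have hle : (volume.restrict (Ioo 0 T)).prod ν ≤ (volume.restrict (Ioo 0 T)).prod volume :=
      Measure.prod_mono le_rfl Measure.restrict_le_self
    have hS : Integrable (spacePrim g) ((volume.restrict (Ioo 0 T)).prod ν) := by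
      have hb : Integrable (fun z : ℝ × ℝ => ∫ x, ‖g (z.1, x)‖)
          ((volume.restrict (Ioo 0 T)).prod ν) := hg.norm.integral_prod_left.comp_fst ν
      refine hb.mono' (measurable_spacePrim hgm).aestronglyMeasurable ?_
      filter_upwards [Measure.quasiMeasurePreserving_fst.ae hg.prod_right_ae] with z hz
      exact abs_primitive_le hz z.2
    have hsub : ∀ᵐ z ∂((volume.restrict (Ioo 0 T)).prod ν), f z - spacePrim g z = 0 := by
      refine ae_eq_zero_of_forall_cutoff hT ((hf.mono_measure hle).sub hS)
        fun a b τ ha _ hb hτ => ?_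
      obtain ⟨C, -, hC⟩ := hτ.exists_bound
      have mτ : Measurable fun w : ℝ × ℝ => τ w.1 := hτ.continuous.measurable.comp measurable_fst
      have K : ∀ {k : ℝ × ℝ → ℝ} {μ : Measure ℝ} [SFinite μ],
          Integrable k ((volume.restrict (Ioo 0 T)).prod μ) →
          Integrable (fun w => τ w.1 * k w) ((volume.restrict (Ioo 0 T)).prod μ) :=
        fun hk => hk.bdd_mul (c := C) mτ.aestronglyMeasurable (ae_of_all _ fun w => hC _)
      -- After averaging in time against `τ`, the problem becomes one-dimensional.
      have hw := ae_eq_primitive_of_weak (K hf).integral_prod_right (K hg).integral_prod_right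
        fun c d Φ hΦ => by
          have := h a b τ ha hb hτ c d Φ hΦ
          obtain ⟨D, -, hD⟩ := hΦ.exists_bound
          obtain ⟨D', -, hD'⟩ := hΦ.deriv.exists_bound
          have mΦ : Measurable fun w : ℝ × ℝ => Φ w.2 :=
            hΦ.continuous.measurable.comp measurable_snd
          have mΦ' : Measurable fun w : ℝ × ℝ => deriv Φ w.2 :=
            hΦ.deriv.continuous.measurable.comp measurable_snd
          have i1 : Integrable (fun z : ℝ × ℝ => f z * deriv Φ z.2 * τ z.1)
              ((volume.restrict (Ioo 0 T)).prod volume) :=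
            (hf.mul_bdd (c := D') mΦ'.aestronglyMeasurable (ae_of_all _ fun w => hD' _)).mul_bdd
              (c := C) mτ.aestronglyMeasurable (ae_of_all _ fun w => hC _)
          have i2 : Integrable (fun z : ℝ × ℝ => g z * Φ z.2 * τ z.1)
              ((volume.restrict (Ioo 0 T)).prod volume) :=
            (hg.mul_bdd (c := D) mΦ.aestronglyMeasurable (ae_of_all _ fun w => hD _)).mul_bdd
              (c := C) mτ.aestronglyMeasurable (ae_of_all _ fun w => hC _)
          rw [integral_prod_symm _ i1, integral_prod_symm _ i2] at this
          refine Eq.trans ?_ (this.trans ?_)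
          · congr 1; ext x; rw [← integral_mul_const]; congr 1; ext t; ring
          · congr 2; ext x; rw [← integral_mul_const]; congr 1; ext t; ring
      filter_upwards [ae_restrict_of_ae hw, ae_restrict_of_ae (K hf).prod_left_ae,
        (K hS).prod_left_ae] with x h1 h2 h3
      have e1 : primitive (fun y => ∫ t in Ioo 0 T, τ t * g (t, y)) x =
          ∫ t in Ioo 0 T, τ t * spacePrim g (t, x) := by
        rw [primitive, integral_integral_swap (f := fun y t => τ t * g (t, y))]
        · refine integral_congr_ae (ae_of_all _ fun t => ?_)
          simp only
          rw [integral_const_mul]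
          rfl
        · exact ((K hg).mono_measure (Measure.prod_mono le_rfl Measure.restrict_le_self)).swap
      simp_rw [mul_sub]
      rw [integral_sub h2 h3, ← e1, h1, sub_self]
    filter_upwards [hsub] with z hz using sub_eq_zero.1 hz
  rw [← restrict_strip, ae_restrict_iff' (measurableSet_strip T)]
  filter_upwards [ae_all_iff.2 hrect] with z hz hzT
  obtain ⟨n, hn⟩ := exists_nat_gt |z.2|
  exact hz n ⟨hzT.1, abs_lt.1 hn⟩

/-- The primitive of a conserved quantity is the time primitive of its flux. -/
theorem spacePrim_eq_of_conservation (hT : 0 < T) {w F : ℝ × ℝ → ℝ} {w₀ : ℝ → ℝ}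
    (mw : Measurable w) (mF : Measurable F) (m0 : Measurable w₀)
    (iw : Integrable w ((volume.restrict (Ioo 0 T)).prod volume))
    (iF : Integrable F ((volume.restrict (Ioo 0 T)).prod volume)) (i0 : Integrable w₀)
    (h : ∀ η, IsTestInit T η → (∫ z in strip T, (w z * dt η z + F z * dx η z))
      + ∫ x, w₀ x * η (0, x) = 0) :
    ∀ᵐ z ∂((volume.restrict (Ioo 0 T)).prod volume),
      spacePrim w z = primitive w₀ z.2 - timePrim ((strip T).indicator F) z := by
  set m : Measure (ℝ × ℝ) := (volume.restrict (Ioo 0 T)).prod volume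
  have i0' : Integrable (fun z : ℝ × ℝ => w₀ z.2) m := i0.comp_snd _
  have ig : Integrable (fun z : ℝ × ℝ => w₀ z.2 - w z) m := i0'.sub iw
  -- The roles are exchanged: the time primitive of the flux, integrable over the strip, has weak
  -- space derivative `w₀ − w`. No time regularity of `w` is required.
  have key := ae_eq_spacePrim_of_weak hT (integrable_timePrim_indicator mF iF) ig
    ((m0.comp measurable_snd).sub mw) fun a b τ ha hb hτ c d Φ hΦ => by
      have ht := h _ ((hτ.windowIntegral hT.le).isTestInit_mul hΦ hb)
      obtain ⟨C, -, hC⟩ := hτ.exists_bound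
      obtain ⟨C', -, hC'⟩ := (hτ.windowIntegral hT.le).exists_bound
      obtain ⟨D, -, hD⟩ := hΦ.exists_bound
      obtain ⟨D', -, hD'⟩ := hΦ.deriv.exists_bound
      have mτ : Measurable fun w : ℝ × ℝ => τ w.1 := hτ.continuous.measurable.comp measurable_fst
      have mθ : Measurable fun w : ℝ × ℝ => windowIntegral τ T w.1 :=
        (hτ.windowIntegral hT.le).continuous.measurable.comp measurable_fst
      have mΦ : Measurable fun w : ℝ × ℝ => Φ w.2 := hΦ.continuous.measurable.comp measurable_snd
      have mΦ' : Measurable fun w : ℝ × ℝ => deriv Φ w.2 :=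
        hΦ.deriv.continuous.measurable.comp measurable_snd
      have K : ∀ {k : ℝ × ℝ → ℝ}, Integrable k m → Integrable (fun z => k z * Φ z.2 * τ z.1) m :=
        fun hk => (hk.mul_bdd (c := D) mΦ.aestronglyMeasurable (ae_of_all _ fun w => hD _)).mul_bdd
              (c := C) mτ.aestronglyMeasurable (ae_of_all _ fun w => hC _)
      have K' : Integrable (fun z => F z * deriv Φ z.2 * windowIntegral τ T z.1) m :=
        (iF.mul_bdd (c := D') mΦ'.aestronglyMeasurable (ae_of_all _ fun w => hD' _)).mul_bdd
              (c := C') mθ.aestronglyMeasurable (ae_of_all _ fun w => hC' _)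
      have e1 : ∫ z in strip T, (w z * dt (fun z => windowIntegral τ T z.1 * Φ z.2) z +
          F z * dx (fun z => windowIntegral τ T z.1 * Φ z.2) z) =
          (∫ z, F z * deriv Φ z.2 * windowIntegral τ T z.1 ∂m) -
            ∫ z, w z * Φ z.2 * τ z.1 ∂m := by
        rw [← integral_sub K' (K iw), restrict_strip]
        refine integral_congr_ae ?_
        filter_upwards [ae_fst_mem_Ioo] with z hz
        rw [(hτ.windowIntegral hT.le).dt_mul hΦ, (hτ.windowIntegral hT.le).dx_mul hΦ,
          hτ.deriv_windowIntegral_of_pos hb hz.1]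
        ring
      have e2 : ∫ x, w₀ x * (windowIntegral τ T 0 * Φ x) =
          ∫ z, w₀ z.2 * Φ z.2 * τ z.1 ∂m := by
        -- The value of the test function at time `0` is the full integral of `τ`, so the initial
        -- term becomes an integral over the strip.
        have h0 : windowIntegral τ T 0 = ∫ t in Ioo 0 T, τ t := by
          rw [windowIntegral, primitive_sub hτ.integrable, zero_add,
            intervalIntegral.integral_of_le hT.le, integral_Ioc_eq_integral_Ioo]
        rw [h0, integral_prod_symm _ (K i0')]
        refine integral_congr_ae (ae_of_all _ fun x => ?_)
        simp only
        rw [integral_const_mul]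
        ring
      rw [← integral_mul_windowIntegral_prod mF iF hT ha hb hτ hΦ.deriv]
      have e3 : ∫ z, (w₀ z.2 - w z) * Φ z.2 * τ z.1 ∂m =
          (∫ z, w₀ z.2 * Φ z.2 * τ z.1 ∂m) - ∫ z, w z * Φ z.2 * τ z.1 ∂m := by
        rw [← integral_sub (K i0') (K iw)]
        exact integral_congr_ae (ae_of_all _ fun z => by ring)
      rw [e1, e2] at ht
      rw [e3]
      linarith
  filter_upwards [key, Measure.quasiMeasurePreserving_fst.ae iw.prod_right_ae] with z h1 h2
  have := primitive_sub_fun i0 h2 z.2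
  rw [h1]
  simp only [spacePrim] at this ⊢
  rw [this]
  ring

/-- Half-lines have infinite measure. Applied to a difference of distribution functions, this gives
conservation of mass. -/
theorem eq_zero_of_tendsto_of_integrable {f : ℝ → ℝ} {l : ℝ} (hf : Integrable f)
    (h : Tendsto f atTop (𝓝 l)) : l = 0 := by
  refine IntegrableAtFilter.eq_zero_of_tendsto (hf.integrableAtFilter atTop) (fun s hs => ?_) h
  obtain ⟨x, hx⟩ := mem_atTop_sets.1 hs
  rw [← top_le_iff, ← Real.volume_Ici (a := x)]
  exact measure_mono hx

end WeakForms

/-! ### Choice of representatives and extension to negative times. -/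

theorem exists_measurableSet_of_ae_restrict {s : Set ℝ} (hs : MeasurableSet s) {p : ℝ → Prop}
    (h : ∀ᵐ t ∂(volume.restrict s), p t) :
    ∃ G, MeasurableSet G ∧ G ⊆ s ∧ (∀ t ∈ G, p t) ∧ ∀ᵐ t, t ∈ s → t ∈ G := by
  rw [ae_restrict_iff' hs] at h
  refine ⟨s \ toMeasurable volume {t | ¬(t ∈ s → p t)}, hs.diff (measurableSet_toMeasurable _ _),
    sdiff_subset, fun t ht => ?_, ?_⟩
  · by_contra hp
    exact ht.2 (subset_toMeasurable _ _ fun h' => hp (h' ht.1))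
  · have h0 : volume (toMeasurable volume {t | ¬(t ∈ s → p t)}) = 0 := by
      rw [measure_toMeasurable]; exact h
    filter_upwards [measure_eq_zero_iff_ae_notMem.1 h0] with t ht hts
    exact ⟨hts, ht⟩

/-- Quantiles require a density of the right mass at every time, whereas the equations give one at
almost every time. The exceptional times are overwritten with `ρ₀`. On `(-T,0]` the state is frozen
at the initial data with zero velocity, so the identities between primitives hold across time `0`.
-/
theorem exists_isConservedSolution {T mass lam : ℝ} {ψ ρ₀ v₀ : ℝ → ℝ} {ρ u v : ℝ × ℝ → ℝ}
    (mρ : Measurable ρ) (mu : Measurable u) (mv : Measurable v)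
    (mv₀ : Measurable v₀) (hρ₀ : IsDensity mass ρ₀) (hb₀ : ∃ B, ∀ᵐ x, |ρ₀ x| ≤ B)
    (kv₀ : Integrable fun x => ρ₀ x * v₀ x ^ 2) (iv₀ : Integrable fun x => ρ₀ x * v₀ x)
    (hd : ∀ᵐ t ∂(volume.restrict (Ioo 0 T)), IsDensity mass fun x => ρ (t, x))
    (hb : ∃ B, ∀ᵐ z ∂(volume.restrict (strip T)), |ρ z| ≤ B)
    (ku : IntegrableOn (fun z => ρ z * u z ^ 2) (strip T))
    (kv : IntegrableOn (fun z => ρ z * v z ^ 2) (strip T))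
    (iu : IntegrableOn (fun z => ρ z * u z) (strip T))
    (iv : IntegrableOn (fun z => ρ z * v z) (strip T))
    (iψ : IntegrableOn (fun z => ψ (ρ z)) (strip T))
    (hflux : ∀ᵐ z ∂(volume.restrict (strip T)),
      ψ (ρ z) = spacePrim (fun z => ρ z * v z - ρ z * u z) z)
    (hM : ∀ᵐ z ∂(volume.restrict (strip T)), spacePrim ρ z = primitive ρ₀ z.2 -
      timePrim ((strip T).indicator fun z => ρ z * u z) z)
    (hQ : ∀ᵐ z ∂(volume.restrict (strip T)), spacePrim (fun z => ρ z * v z) z =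
      primitive (fun x => ρ₀ x * v₀ x) z.2 -
      timePrim ((strip T).indicator fun z => ρ z * u z * v z + lam * ψ (ρ z)) z) :
    ∃ ρ' u' v', IsConservedSolution T mass lam ψ ρ₀ v₀ ρ' u' v' ∧
      ∀ᵐ z ∂(volume.restrict (strip T)), ρ' z = ρ z ∧ v' z = v z := by
  classical
  obtain ⟨G, mG, hG, hdG, haeG⟩ := exists_measurableSet_of_ae_restrict measurableSet_Ioo hd
  obtain ⟨B₀, hB₀⟩ := hb₀
  obtain ⟨B, hB⟩ := hb
  rw [ae_restrict_iff' (measurableSet_strip T)] at hB hflux hM hQ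
  have mG' : MeasurableSet {z : ℝ × ℝ | z.1 ∈ G} := measurable_fst mG
  let ρ' : ℝ × ℝ → ℝ := fun z => if z.1 ∈ G then ρ z else ρ₀ z.2
  let u' : ℝ × ℝ → ℝ := fun z => if z.1 ∈ G then u z else 0
  -- Keeping `v₀` only on the bounded interval `(-T,0]` makes the momentum and the kinetic energy
  -- integrable over all of space-time.
  let v' : ℝ × ℝ → ℝ := fun z => if z.1 ∈ G then v z else if z.1 ∈ Ioc (-T) 0 then v₀ z.2 else 0
  have mρ' : Measurable ρ' := mρ.ite mG' (hρ₀.measurable.comp measurable_snd)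
  have mu' : Measurable u' := mu.ite mG' measurable_const
  have mv' : Measurable v' := mv.ite mG'
    ((mv₀.comp measurable_snd).ite (measurable_fst measurableSet_Ioc) measurable_const)
  have pG : ∀ {z : ℝ × ℝ}, z.1 ∈ G → ρ' z = ρ z ∧ u' z = u z ∧ v' z = v z := fun {z} hz =>
    ⟨if_pos hz, if_pos hz, if_pos hz⟩
  have nG : ∀ {z : ℝ × ℝ}, z.1 ∉ G → ρ' z = ρ₀ z.2 ∧ u' z = 0 := fun {z} hz =>
    ⟨if_neg hz, if_neg hz⟩
  have eG : ∀ {z : ℝ × ℝ}, z.1 ∈ Ioc (-T) 0 → ρ' z = ρ₀ z.2 ∧ u' z = 0 ∧ v' z = v₀ z.2 :=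
    fun {z} hz => by
      have hz' : z.1 ∉ G := fun h => absurd (hG h).1 (not_lt.2 hz.2)
      exact ⟨if_neg hz', if_neg hz', (if_neg hz').trans (if_pos hz)⟩
  have oG : ∀ {z : ℝ × ℝ}, z.1 ∉ G → z.1 ∉ Ioc (-T) 0 → v' z = 0 := fun {z} h1 h2 =>
    (if_neg h1).trans (if_neg h2)
  have haeG' : ∀ᵐ z : ℝ × ℝ, z.1 ∈ Ioo 0 T → z.1 ∈ G := ae_of_ae_fst haeG
  -- integrability of functions glued from the strip and the initial data
  have glue : ∀ {g f : ℝ × ℝ → ℝ} {f₀ : ℝ → ℝ}, IntegrableOn f (strip T) → Integrable f₀ →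
      (∀ z, z.1 ∈ G → g z = f z) → (∀ z, z.1 ∈ Ioc (-T) 0 → g z = f₀ z.2) →
      (∀ z, z.1 ∉ G → z.1 ∉ Ioc (-T) 0 → g z = 0) → Integrable g :=
    fun {g f f₀} hf hf₀ h1 h2 h3 => by
      have i1 := (integrable_indicator_iff (measurableSet_strip T)).2 hf
      have i2 : IntegrableOn (fun z : ℝ × ℝ => f₀ z.2) (Ioc (-T) 0 ×ˢ univ) := by
        rw [IntegrableOn, Measure.volume_eq_prod, ← Measure.prod_restrict, Measure.restrict_univ]
        exact hf₀.comp_snd _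
      have i3 := (integrable_indicator_iff (measurableSet_Ioc.prod MeasurableSet.univ)).2 i2
      refine (i1.add i3).congr ?_
      filter_upwards [haeG'] with z hz
      simp only [Pi.add_apply]
      by_cases hzT : z.1 ∈ Ioo 0 T
      · rw [indicator_of_mem (show z ∈ strip T from ⟨hzT, mem_univ _⟩), indicator_of_notMem
          (fun h => absurd h.1.2 (not_le.2 hzT.1)), h1 z (hz hzT), add_zero]
      · rw [indicator_of_notMem (show z ∉ strip T from fun h => hzT h.1), zero_add]
        by_cases hz0 : z.1 ∈ Ioc (-T) 0
        · rw [indicator_of_mem (show z ∈ Ioc (-T) 0 ×ˢ univ from ⟨hz0, mem_univ _⟩), h2 z hz0]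
        · rw [indicator_of_notMem fun h => hz0 h.1, h3 z (fun h => hzT (hG h)) hz0]
  have sG : ∀ {f f' : ℝ × ℝ → ℝ} {z : ℝ × ℝ}, (∀ z, z.1 ∈ G → f z = f' z) → z.1 ∈ G →
      spacePrim f z = spacePrim f' z := fun {f f' z} h hz => by
    have : ∀ y, f (z.1, y) = f' (z.1, y) := fun y => h _ hz
    simp only [spacePrim, this]
  have tG : ∀ {f f' : ℝ × ℝ → ℝ}, (∀ z, z.1 ∈ G → f z = f' z) → (∀ z, z.1 ∉ Ioo 0 T → f z = 0) →
      ∀ z, timePrim f z = timePrim ((strip T).indicator f') z := fun {f f'} h h0 z => by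
    simp only [timePrim]
    refine congrFun (primitive_congr ?_) _
    filter_upwards [haeG] with t ht
    by_cases htT : t ∈ Ioo 0 T
    · rw [indicator_of_mem (show (t, z.2) ∈ strip T from ⟨htT, mem_univ _⟩)]
      exact h _ (ht htT)
    · rw [indicator_of_notMem (show (t, z.2) ∉ strip T from fun h => htT h.1)]
      exact h0 _ htT
  have e0 : ∀ {f : ℝ × ℝ → ℝ} {z : ℝ × ℝ}, z.1 ≤ 0 → timePrim ((strip T).indicator f) z = 0 :=
    fun {f z} hz => setIntegral_eq_zero_of_forall_eq_zero fun s hs =>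
      indicator_of_notMem (fun h => absurd h.1.1 (not_lt.2 (le_trans hs hz))) _
  have oT : ∀ {z : ℝ × ℝ}, z.1 ∉ Ioo 0 T → u' z = 0 := fun {z} hz => (nG fun h => hz (hG h)).2
  have zero_int : Integrable fun _ : ℝ => (0 : ℝ) := integrable_zero _ _ _
  refine ⟨ρ', u', v', ⟨mρ', mu', mv', fun t => ?_, ⟨max B B₀, ?_⟩, ?_, ?_, ?_, ?_, ?_,
    fun z hz => oT hz, fun z hz => ⟨(eG hz).1, (eG hz).2.2⟩, ?_, ?_, ?_⟩, ?_⟩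
  · by_cases ht : t ∈ G
    · have : (fun x => ρ' (t, x)) = fun x => ρ (t, x) := funext fun x => (pG (z := (t, x)) ht).1
      rw [this]; exact hdG t ht
    · have : (fun x => ρ' (t, x)) = ρ₀ := funext fun x => (nG (z := (t, x)) ht).1
      rw [this]; exact hρ₀
  · filter_upwards [hB, ae_of_ae_snd hB₀] with z h1 h2
    by_cases hz : z.1 ∈ G
    · rw [(pG hz).1]; exact (h1 ⟨hG hz, mem_univ _⟩).trans (le_max_left _ _)
    · rw [(nG hz).1]; exact h2.trans (le_max_right _ _)
  · exact glue ku zero_int (fun z hz => by rw [(pG hz).1, (pG hz).2.1])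
      (fun z hz => by rw [(eG hz).2.1]; ring) fun z hz _ => by rw [(nG hz).2]; ring
  · exact glue kv kv₀ (fun z hz => by rw [(pG hz).1, (pG hz).2.2])
      (fun z hz => by rw [(eG hz).1, (eG hz).2.2]) fun z hz hz' => by rw [oG hz hz']; ring
  · exact glue iu zero_int (fun z hz => by rw [(pG hz).1, (pG hz).2.1])
      (fun z hz => by rw [(eG hz).2.1]; ring) fun z hz _ => by rw [(nG hz).2]; ring
  · exact glue iv iv₀ (fun z hz => by rw [(pG hz).1, (pG hz).2.2])
      (fun z hz => by rw [(eG hz).1, (eG hz).2.2]) fun z hz hz' => by rw [oG hz hz']; ring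
  · refine iψ.congr_fun_ae ?_
    filter_upwards [ae_restrict_of_ae haeG', ae_restrict_mem (measurableSet_strip T)] with z h1 h2
    rw [(pG (h1 h2.1)).1]
  · filter_upwards [hflux, haeG'] with z h1 h2 hz
    rw [(pG (h2 hz)).1, h1 ⟨hz, mem_univ _⟩]
    exact (sG (fun z hz => by rw [(pG hz).1, (pG hz).2.1, (pG hz).2.2]) (h2 hz)).symm
  · filter_upwards [hM, haeG'] with z h1 h2 hz
    rw [tG (f' := fun z => ρ z * u z) (fun z hz => by rw [(pG hz).1, (pG hz).2.1])
      fun z hz => by rw [oT hz, mul_zero]]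
    rcases le_or_gt z.1 0 with h0 | h0
    · rw [e0 h0, sub_zero]
      have : ∀ y, ρ' (z.1, y) = ρ₀ y := fun y => (eG (z := (z.1, y)) ⟨hz.1, h0⟩).1
      simp only [spacePrim, this]
    · rw [sG (fun z hz => (pG hz).1) (h2 ⟨h0, hz.2⟩), h1 ⟨⟨h0, hz.2⟩, mem_univ _⟩]
  · filter_upwards [hQ, haeG'] with z h1 h2 hz
    rw [tG (f' := fun z => ρ z * u z * v z + lam * ψ (ρ z)) (fun z hz => by
        rw [indicator_of_mem (show z ∈ strip T from ⟨hG hz, mem_univ _⟩), (pG hz).1, (pG hz).2.1,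
          (pG hz).2.2])
      fun z hz => by
        rw [indicator_of_notMem (show z ∉ strip T from fun h => hz h.1), oT hz]; ring]
    rcases le_or_gt z.1 0 with h0 | h0
    · rw [e0 h0, sub_zero]
      have h3 : ∀ y, ρ' (z.1, y) = ρ₀ y := fun y => (eG (z := (z.1, y)) ⟨hz.1, h0⟩).1
      have h4 : ∀ y, v' (z.1, y) = v₀ y := fun y => (eG (z := (z.1, y)) ⟨hz.1, h0⟩).2.2
      simp only [spacePrim, h3, h4]
    · rw [sG (f' := fun z => ρ z * v z) (fun z hz => by rw [(pG hz).1, (pG hz).2.2])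
        (h2 ⟨h0, hz.2⟩), h1 ⟨⟨h0, hz.2⟩, mem_univ _⟩]
  · filter_upwards [ae_restrict_of_ae haeG', ae_restrict_mem (measurableSet_strip T)] with z h1 h2
    exact ⟨(pG (h1 h2.1)).1, (pG (h1 h2.1)).2.2⟩

/-! ### The potential `ψ` and elementary integrability. -/

theorem measurable_fluxPotential (μ γ : ℝ) : Measurable (fluxPotential μ γ) :=
  (measurable_id.pow_const γ).const_mul (μ / γ)

theorem monotoneOn_fluxPotential {μ γ : ℝ} (hμ : 0 < μ) (hγ : 1 < γ) :
    MonotoneOn (fluxPotential μ γ) (Ici 0) := fun r hr s _ hrs =>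
  mul_le_mul_of_nonneg_left (Real.rpow_le_rpow hr hrs (by linarith))
    (div_nonneg hμ.le (by linarith))

/-- Inverts `ψ`, so that a bound on the primitive of the diffusive flux bounds the density. -/
theorem le_of_fluxPotential_le {μ γ r K : ℝ} (hμ : 0 < μ) (hγ : 1 < γ) (hr : 0 ≤ r)
    (h : fluxPotential μ γ r ≤ K) : r ≤ (γ / μ * K) ^ γ⁻¹ := by
  have hγ0 : 0 < γ := by linarith
  have h1 : r ^ γ ≤ γ / μ * K := by
    calc r ^ γ = γ / μ * fluxPotential μ γ r := by rw [fluxPotential]; field_simp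
      _ ≤ _ := mul_le_mul_of_nonneg_left h (by positivity)
  calc r = (r ^ γ) ^ γ⁻¹ := (Real.rpow_rpow_inv hr hγ0.ne').symm
    _ ≤ _ := Real.rpow_le_rpow (Real.rpow_nonneg hr _) h1 (by positivity)

/-- The structural fact behind the proof: pressure and viscosity carry the same exponent, so the
pressure gradient is a multiple of the diffusive flux. -/
theorem pressure_eq_mul_fluxPotential {a μ γ : ℝ} (hμ : 0 < μ) (hγ : 1 < γ) (r : ℝ) :
    pressure a γ r = a * γ / μ * fluxPotential μ γ r := by
  have hγ0 : 0 < γ := by linarith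
  rw [pressure, fluxPotential]
  field_simp

/-- Rests on `|w| ≤ 1 + w²`, weighted by the density. -/
theorem integrable_mul_of_kinetic {α : Type*} [MeasurableSpace α] {m : Measure α} {ρ w : α → ℝ}
    (hρ : Measurable ρ) (hw : Measurable w) (h0 : ∀ᵐ z ∂m, 0 ≤ ρ z) (hi : Integrable ρ m)
    (hk : Integrable (fun z => ρ z * w z ^ 2) m) : Integrable (fun z => ρ z * w z) m := by
  refine (hi.add hk).mono' (hρ.mul hw).aestronglyMeasurable ?_
  filter_upwards [h0] with z hz
  simp only [Pi.add_apply]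
  rw [norm_mul, Real.norm_of_nonneg hz, Real.norm_eq_abs]
  have : 0 ≤ ρ z * ((|w z| - 1) ^ 2 + |w z| ^ 2 + 1) := by positivity
  rw [← sq_abs (w z)]
  nlinarith

theorem integrableOn_strip_of_slice {T : ℝ} {f : ℝ × ℝ → ℝ} (hm : Measurable f) {C : ℝ≥0}
    (h : ∀ᵐ t ∂(volume.restrict (Ioo 0 T)), ∫⁻ x, ‖f (t, x)‖ₑ ≤ C) :
    IntegrableOn f (strip T) := by
  refine ⟨hm.aestronglyMeasurable, ?_⟩
  rw [hasFiniteIntegral_iff_enorm, restrict_strip, lintegral_prod _ hm.enorm.aemeasurable]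
  refine (lintegral_mono_ae h).trans_lt ?_
  rw [lintegral_const, Measure.restrict_apply_univ, Real.volume_Ioo]
  exact ENNReal.mul_lt_top ENNReal.coe_lt_top ENNReal.ofReal_lt_top

/-! ### Bounds for the initial data. -/

section InitialData

variable {μ γ δ : ℝ} {ρ₀ u₀ v₀ : ℝ → ℝ}

theorem integrable_kinetic_of_memLp_sqrt {ρ w : ℝ → ℝ} (h0 : ∀ᵐ x, 0 ≤ ρ x)
    (h : MemLp (fun x => √(ρ x) * w x) 2) : Integrable fun x => ρ x * w x ^ 2 := by
  refine h.integrable_sq.congr ?_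
  filter_upwards [h0] with x hx
  rw [mul_pow, Real.sq_sqrt hx]

theorem IsInitialData.isDensity (h : IsInitialData μ γ δ ρ₀ u₀ v₀) :
    IsDensity (∫ x, ρ₀ x) ρ₀ :=
  ⟨h.measurable_rho, memLp_one_iff_integrable.1 h.rho_L1, h.nonneg, rfl⟩

theorem IsInitialData.integrable_fluxPotential (hγ : 1 < γ)
    (h : IsInitialData μ γ δ ρ₀ u₀ v₀) : Integrable fun x => fluxPotential μ γ (ρ₀ x) := by
  have hγ0 : 0 < γ := by linarith
  have h1 := h.rho_Lgamma.integrable_norm_rpow (by simpa using hγ0) ENNReal.ofReal_ne_top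
  rw [ENNReal.toReal_ofReal hγ0.le] at h1
  refine (h1.const_mul (μ / γ)).congr ?_
  filter_upwards [h.nonneg] with x hx
  rw [Real.norm_of_nonneg hx, fluxPotential]

/-- The relation between `u₀` and `v₀` exhibits `ψ(ρ₀)` as the primitive of the integrable function
`ρ₀v₀ − ρ₀u₀`, hence as a bounded function. -/
theorem IsInitialData.exists_bound (hμ : 0 < μ) (hγ : 1 < γ)
    (h : IsInitialData μ γ δ ρ₀ u₀ v₀) : ∃ B, ∀ᵐ x, |ρ₀ x| ≤ B := by
  have hi := h.isDensity.integrable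
  have iu := integrable_mul_of_kinetic h.measurable_rho h.measurable_u h.nonneg hi
    (integrable_kinetic_of_memLp_sqrt h.nonneg h.u_L2)
  have iv := integrable_mul_of_kinetic h.measurable_rho h.measurable_v h.nonneg hi
    (integrable_kinetic_of_memLp_sqrt h.nonneg h.v_L2)
  obtain ⟨q₀, ⟨-, -, hw⟩, hq⟩ := h.effective
  have ig : Integrable fun x => ρ₀ x * v₀ x - ρ₀ x * u₀ x := iv.sub iu
  have key := ae_eq_primitive_of_weak (h.integrable_fluxPotential hγ) ig fun a b Φ hΦ => by
    rw [hw Φ hΦ.1 hΦ.hasCompactSupport]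
    congr 1
    refine integral_congr_ae ?_
    filter_upwards [hq] with x hx
    rw [hx]; ring
  refine ⟨(γ / μ * ∫ x, |ρ₀ x * v₀ x - ρ₀ x * u₀ x|) ^ γ⁻¹, ?_⟩
  filter_upwards [key, h.nonneg] with x h1 h2
  rw [abs_of_nonneg h2]
  exact le_of_fluxPotential_le hμ hγ h2 (h1.trans_le ((le_abs_self _).trans (abs_primitive_le ig x)))

end InitialData

/-! ### Finite energy solutions are conserved solutions. -/

section FiniteEnergy

variable {a μ γ δ T : ℝ} {ρ₀ u₀ v₀ : ℝ → ℝ} {ρ u v : ℝ × ℝ → ℝ}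

theorem lintegral_kinetic_le {r w : ℝ → ℝ} {C : ℝ≥0} (hγ : 1 < γ) (h0 : ∀ᵐ x, 0 ≤ r x)
    (h : ∫⁻ x, ENNReal.ofReal (1 / 2 * r x * w x ^ 2 + 1 / (γ - 1) * r x ^ γ) ≤ C) :
    ∫⁻ x, ‖r x * w x ^ 2‖ₑ ≤ (2 * C : ℝ≥0) ∧
      ∫⁻ x, ‖r x ^ γ‖ₑ ≤ ((γ - 1).toNNReal * C : ℝ≥0) := by
  have hγ1 : 0 < γ - 1 := by linarith
  constructor
  · rw [ENNReal.coe_mul]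
    refine le_trans ?_ (mul_le_mul_right h _)
    rw [← lintegral_const_mul' _ _ ENNReal.coe_ne_top]
    refine lintegral_mono_ae ?_
    filter_upwards [h0] with x hx
    rw [Real.enorm_eq_ofReal (by positivity), ENNReal.coe_ofNat, ← ENNReal.ofReal_ofNat 2,
      ← ENNReal.ofReal_mul (by norm_num)]
    refine ENNReal.ofReal_le_ofReal ?_
    have : 0 ≤ 1 / (γ - 1) * r x ^ γ := by positivity
    linarith
  · rw [ENNReal.coe_mul]
    refine le_trans ?_ (mul_le_mul_right h _)
    rw [← lintegral_const_mul' _ _ ENNReal.coe_ne_top]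
    refine lintegral_mono_ae ?_
    filter_upwards [h0] with x hx
    rw [Real.enorm_eq_ofReal (by positivity), ← ENNReal.ofReal, ← ENNReal.ofReal_mul hγ1.le]
    refine ENNReal.ofReal_le_ofReal ?_
    have h1 : 0 ≤ (γ - 1) * (1 / 2 * r x * w x ^ 2) := by positivity
    have h2 : (γ - 1) * (1 / (γ - 1) * r x ^ γ) = r x ^ γ := by field_simp
    linarith

/-- From `|w₁ − w₂| ≤ 1 + w₁² + w₂²`, weighted by `r`: the constant is `5 = 1 + 2 + 2`. -/
theorem lintegral_effective_flux_le {r w₁ w₂ : ℝ → ℝ} {C : ℝ≥0} (hr : Measurable r)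
    (hw : Measurable w₁) (h0 : ∀ᵐ x, 0 ≤ r x)
    (h1 : ∫⁻ x, ‖r x‖ₑ ≤ C) (h2 : ∫⁻ x, ‖r x * w₁ x ^ 2‖ₑ ≤ (2 * C : ℝ≥0))
    (h3 : ∫⁻ x, ‖r x * w₂ x ^ 2‖ₑ ≤ (2 * C : ℝ≥0)) :
    ∫⁻ x, ‖r x * w₁ x - r x * w₂ x‖ₑ ≤ (5 * C : ℝ≥0) := by
  have e : ((5 * C : ℝ≥0) : ℝ≥0∞) = C + (2 * C : ℝ≥0) + (2 * C : ℝ≥0) := by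
    rw [← ENNReal.coe_add, ← ENNReal.coe_add]; congr 1; ring
  rw [e]
  refine le_trans ?_ (add_le_add (add_le_add h1 h2) h3)
  have m2 : Measurable fun x => r x * w₁ x ^ 2 := hr.mul (hw.pow_const 2)
  have m1 : Measurable fun x => ‖r x‖ₑ + ‖r x * w₁ x ^ 2‖ₑ := hr.enorm.add m2.enorm
  rw [← lintegral_add_left hr.enorm, ← lintegral_add_left m1]
  refine lintegral_mono_ae ?_
  filter_upwards [h0] with x hx
  rw [Real.enorm_eq_ofReal hx, Real.enorm_eq_ofReal (by positivity : 0 ≤ r x * w₁ x ^ 2),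
    Real.enorm_eq_ofReal (by positivity : 0 ≤ r x * w₂ x ^ 2),
    ← ENNReal.ofReal_add hx (by positivity), ← ENNReal.ofReal_add (by positivity) (by positivity),
    Real.enorm_eq_ofReal_abs, ← mul_sub, abs_mul, abs_of_nonneg hx]
  refine ENNReal.ofReal_le_ofReal ?_
  have h4 : |w₁ x - w₂ x| ≤ 1 + w₁ x ^ 2 + w₂ x ^ 2 := by
    rw [abs_le]
    constructor <;> nlinarith [sq_nonneg (w₁ x + 1), sq_nonneg (w₁ x - 1), sq_nonneg (w₂ x + 1),
      sq_nonneg (w₂ x - 1), sq_nonneg (w₁ x), sq_nonneg (w₂ x)]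
  nlinarith [mul_le_mul_of_nonneg_left h4 hx]

/-- Every finite energy solution is almost everywhere equal to a conserved solution. -/
theorem IsFiniteEnergySolution.exists_isConservedSolution (hμ : 0 < μ) (hγ : 1 < γ)
    (hT : 0 < T) (h₀ : IsInitialData μ γ δ ρ₀ u₀ v₀)
    (h : IsFiniteEnergySolution a μ γ T ρ₀ v₀ ρ u v) :
    ∃ ρ' u' v', IsConservedSolution T (∫ x, ρ₀ x) (a * γ / μ) (fluxPotential μ γ) ρ₀ v₀ ρ' u' v' ∧
      ∀ᵐ z ∂(volume.restrict (strip T)), ρ' z = ρ z ∧ v' z = v z := by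
  obtain ⟨q, w, px, hw, -, -, -, C, hC⟩ := h
  have mρ := hw.measurable_rho
  have mu := hw.measurable_u
  have mv := hw.measurable_v
  have sl : ∀ {f : ℝ × ℝ → ℝ}, Measurable f → ∀ t, Measurable fun x => f (t, x) :=
    fun hf t => hf.comp (by fun_prop)
  have h0 := hw.nonneg
  have h0' := h0
  rw [restrict_strip] at h0'
  have h0t : ∀ᵐ t ∂(volume.restrict (Ioo 0 T)), ∀ᵐ x, 0 ≤ ρ (t, x) := Measure.ae_ae_of_ae_prod h0'
  have hslice : ∀ᵐ t ∂(volume.restrict (Ioo 0 T)),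
      ∫⁻ x, ‖ρ (t, x)‖ₑ ≤ C ∧ ∫⁻ x, ‖ρ (t, x) * u (t, x) ^ 2‖ₑ ≤ (2 * C : ℝ≥0) ∧
      ∫⁻ x, ‖ρ (t, x) * v (t, x) ^ 2‖ₑ ≤ (2 * C : ℝ≥0) ∧
      ∫⁻ x, ‖ρ (t, x) ^ γ‖ₑ ≤ ((γ - 1).toNNReal * C : ℝ≥0) := by
    filter_upwards [hC, h0t] with t h1 h2
    rw [eLpNorm_one_eq_lintegral_enorm] at h1
    have hu := lintegral_kinetic_le hγ h2 (le_self_add.trans h1.2.1)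
    have hv := lintegral_kinetic_le hγ h2 (le_self_add.trans h1.2.2)
    exact ⟨h1.1, hu.1, hv.1, hu.2⟩
  have iρ : IntegrableOn ρ (strip T) :=
    integrableOn_strip_of_slice mρ (hslice.mono fun t h => h.1)
  have ku : IntegrableOn (fun z => ρ z * u z ^ 2) (strip T) :=
    integrableOn_strip_of_slice (mρ.mul (mu.pow_const 2)) (hslice.mono fun t h => h.2.1)
  have kv : IntegrableOn (fun z => ρ z * v z ^ 2) (strip T) :=
    integrableOn_strip_of_slice (mρ.mul (mv.pow_const 2)) (hslice.mono fun t h => h.2.2.1)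
  have iγ : IntegrableOn (fun z => ρ z ^ γ) (strip T) :=
    integrableOn_strip_of_slice (mρ.pow_const γ) (hslice.mono fun t h => h.2.2.2)
  have iψ : IntegrableOn (fun z => fluxPotential μ γ (ρ z)) (strip T) :=
    Integrable.const_mul iγ (μ / γ)
  have iu : IntegrableOn (fun z => ρ z * u z) (strip T) :=
    integrable_mul_of_kinetic mρ mu h0 iρ ku
  have iv : IntegrableOn (fun z => ρ z * v z) (strip T) :=
    integrable_mul_of_kinetic mρ mv h0 iρ kv
  have mρu : Measurable fun z => ρ z * u z := mρ.mul mu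
  have mρv : Measurable fun z => ρ z * v z := mρ.mul mv
  have mq : Measurable fun z => ρ z * v z - ρ z * u z := mρv.sub mρu
  have iq : IntegrableOn (fun z => ρ z * v z - ρ z * u z) (strip T) := iv.sub iu
  have iuv : IntegrableOn (fun z => ρ z * u z * v z) (strip T) := by
    refine (ku.add kv).mono' (mρu.mul mv).aestronglyMeasurable ?_
    filter_upwards [h0] with z hz
    simp only [Pi.add_apply]
    rw [mul_assoc, norm_mul, Real.norm_of_nonneg hz, Real.norm_eq_abs]
    have h1 : |u z * v z| ≤ u z ^ 2 + v z ^ 2 := by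
      rw [abs_le]
      constructor <;> nlinarith [sq_nonneg (u z + v z), sq_nonneg (u z - v z), sq_nonneg (u z),
        sq_nonneg (v z)]
    nlinarith [mul_le_mul_of_nonneg_left h1 hz]
  have mψ : Measurable fun z => fluxPotential μ γ (ρ z) := (measurable_fluxPotential μ γ).comp mρ
  have mF : Measurable fun z => ρ z * u z * v z + a * γ / μ * fluxPotential μ γ (ρ z) :=
    (mρu.mul mv).add (mψ.const_mul _)
  have iF : IntegrableOn (fun z => ρ z * u z * v z + a * γ / μ * fluxPotential μ γ (ρ z))
      (strip T) := iuv.add (Integrable.const_mul iψ _)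
  have iρ₀ := h₀.isDensity.integrable
  have kv₀ := integrable_kinetic_of_memLp_sqrt h₀.nonneg h₀.v_L2
  have iv₀ := integrable_mul_of_kinetic h₀.measurable_rho h₀.measurable_v h₀.nonneg iρ₀ kv₀
  rw [IntegrableOn, restrict_strip] at iρ iψ iu iv iq iF
  have hflux : ∀ᵐ z ∂(volume.restrict (strip T)), fluxPotential μ γ (ρ z) =
      spacePrim (fun z => ρ z * v z - ρ z * u z) z := by
    rw [restrict_strip]
    refine ae_eq_spacePrim_of_weak hT iψ iq mq fun α β τ hα hβ hτ c d Φ hΦ => ?_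
    have e := hw.weakDx_q.2.2 _ (hτ.isTest_mul hΦ hα hβ)
    rw [← restrict_strip]
    refine Eq.trans ?_ (e.trans ?_)
    · refine integral_congr_ae (ae_of_all _ fun z => ?_)
      simp only
      rw [hτ.dx_mul hΦ]
      ring
    · congr 1
      refine integral_congr_ae ?_
      filter_upwards [hw.effective] with z hz
      rw [hz]; ring
  have hM : ∀ᵐ z ∂(volume.restrict (strip T)), spacePrim ρ z = primitive ρ₀ z.2 -
      timePrim ((strip T).indicator fun z => ρ z * u z) z := by
    rw [restrict_strip]
    refine spacePrim_eq_of_conservation hT mρ mρu h₀.measurable_rho iρ iu iρ₀ fun η hη => ?_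
    refine Eq.trans ?_ (hw.mass η hη)
    congr 1
    refine integral_congr_ae ?_
    filter_upwards [hw.effective] with z hz
    rw [hz]; ring
  have hQ : ∀ᵐ z ∂(volume.restrict (strip T)), spacePrim (fun z => ρ z * v z) z =
      primitive (fun x => ρ₀ x * v₀ x) z.2 - timePrim ((strip T).indicator
        fun z => ρ z * u z * v z + a * γ / μ * fluxPotential μ γ (ρ z)) z := by
    rw [restrict_strip]
    refine spacePrim_eq_of_conservation hT mρv mF (h₀.measurable_rho.mul h₀.measurable_v)
      iv iF iv₀ fun η hη => ?_
    refine Eq.trans ?_ (hw.momentum η hη)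
    simp only [pressure_eq_mul_fluxPotential hμ hγ]
  have hd : ∀ᵐ t ∂(volume.restrict (Ioo 0 T)), IsDensity (∫ x, ρ₀ x) fun x => ρ (t, x) := by
    have hM' := hM
    rw [restrict_strip] at hM'
    filter_upwards [h0t, iρ.prod_right_ae, Measure.ae_ae_of_ae_prod hM',
      (integrable_timePrim_indicator mρu iu).prod_right_ae] with t h1 h2 h3 h4
    refine ⟨sl mρ t, h2, h1, ?_⟩
    -- The difference of the distribution functions is the time primitive of the mass flux, which is
    -- integrable in `x`. Its limit at `+∞`, the difference of the masses, must therefore be zero.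
    have hdiff : Integrable fun x => primitive ρ₀ x - primitive (fun x => ρ (t, x)) x := by
      refine h4.congr ?_
      filter_upwards [h3] with x hx
      have hx' : primitive (fun x => ρ (t, x)) x = _ := hx
      rw [hx']; ring
    have := eq_zero_of_tendsto_of_integrable hdiff
      ((tendsto_primitive_atTop iρ₀).sub (tendsto_primitive_atTop h2))
    linarith
  -- `ψ(ρ)` is a space primitive of `ρv − ρu`, whose `L¹` norm on almost every time slice is bounded
  -- by the mass and the two kinetic energies.
  have hb : ∃ B, ∀ᵐ z ∂(volume.restrict (strip T)), |ρ z| ≤ B := by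
    have hK : ∀ᵐ t ∂(volume.restrict (Ioo 0 T)),
        ∫ x, |ρ (t, x) * v (t, x) - ρ (t, x) * u (t, x)| ≤ (5 * C : ℝ≥0) := by
      filter_upwards [hslice, h0t] with t h1 h2
      have h3 := lintegral_effective_flux_le (sl mρ t) (sl mv t) h2 h1.1 h1.2.2.1 h1.2.1
      have e := integral_norm_eq_lintegral_enorm (μ := volume) (sl mq t).aestronglyMeasurable
      refine e.trans_le ?_
      exact ENNReal.toReal_le_of_le_ofReal (NNReal.coe_nonneg _)
        (h3.trans_eq (ENNReal.ofReal_coe_nnreal).symm)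
    refine ⟨(γ / μ * (5 * C : ℝ≥0)) ^ γ⁻¹, ?_⟩
    have hflux' := hflux
    rw [restrict_strip] at hflux' ⊢
    filter_upwards [hflux', h0', Measure.quasiMeasurePreserving_fst.ae hK,
      Measure.quasiMeasurePreserving_fst.ae iq.prod_right_ae] with z h1 h2 h3 h4
    rw [abs_of_nonneg h2]
    exact le_of_fluxPotential_le hμ hγ h2
      (h1.trans_le ((le_abs_self _).trans ((abs_primitive_le h4 z.2).trans h3)))
  rw [← restrict_strip] at iψ iu iv
  exact DegenerateNS.exists_isConservedSolution mρ mu mv h₀.measurable_v h₀.isDensity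
    (h₀.exists_bound hμ hγ) kv₀ iv₀ hd hb ku kv iu iv iψ hflux hM hQ

end FiniteEnergy

end DegenerateNS

theorem theorem1 (a μ γ δ T : ℝ) (ha : 0 < a) (hμ : 0 < μ) (hγ : 1 < γ) (hδ : 0 < δ) (hT : 0 < T)
    (ρ₀ u₀ v₀ : ℝ → ℝ) (h₀ : DegenerateNS.IsInitialData μ γ δ ρ₀ u₀ v₀)
    (ρbar ubar vbar : ℝ × ℝ → ℝ)
    (hbar : DegenerateNS.IsFiniteEnergySolution a μ γ T ρ₀ v₀ ρbar ubar vbar)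
    (hreg : DegenerateNS.IsRegular T ubar vbar)
    (ρ u v : ℝ × ℝ → ℝ)
    (hsol : DegenerateNS.IsFiniteEnergySolution a μ γ T ρ₀ v₀ ρ u v) :
    (∀ᵐ z ∂(volume.restrict (DegenerateNS.strip T)), ρ z = ρbar z) ∧
      ∀ᵐ z ∂(volume.restrict (DegenerateNS.strip T)),
        √(ρ z) * v z = √(ρbar z) * vbar z := by
  obtain ⟨ρ₁, u₁, v₁, h₁, e₁⟩ := hsol.exists_isConservedSolution hμ hγ hT h₀
  obtain ⟨ρ₂, u₂, v₂, h₂, e₂⟩ := hbar.exists_isConservedSolution hμ hγ hT h₀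
  have key : ∀ᵐ z ∂(volume.restrict (DegenerateNS.strip T)),
      ρ₁ z = ρ₂ z ∧ (ρ₁ z = 0 ∨ v₁ z = v₂ z) := by
    -- With zero total mass there are no mass coordinates, but both densities then vanish almost
    -- everywhere.
    rcases (integral_nonneg_of_ae h₀.nonneg).eq_or_lt' with hm | hm
    · have hz : ∀ {ρ u v : ℝ × ℝ → ℝ}, DegenerateNS.IsConservedSolution T (∫ x, ρ₀ x) (a * γ / μ)
          (DegenerateNS.fluxPotential μ γ) ρ₀ v₀ ρ u v → ∀ᵐ z, ρ z = 0 := fun h =>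
        DegenerateNS.ae_of_ae_slices (measurableSet_eq_fun h.measurable_rho measurable_const)
          (ae_of_all _ fun t => (integral_eq_zero_iff_of_nonneg_ae (h.density t).nonneg
            (h.density t).integrable).1 ((h.density t).mass.trans hm))
      filter_upwards [ae_restrict_of_ae (hz h₁), ae_restrict_of_ae (hz h₂)] with z z₁ z₂
      exact ⟨z₁.trans z₂.symm, Or.inl z₁⟩
    · exact h₁.unique hT hm (by positivity) (DegenerateNS.measurable_fluxPotential μ γ)
        (DegenerateNS.monotoneOn_fluxPotential hμ hγ) h₂
  constructor
  · filter_upwards [key, e₁, e₂] with z hz h1 h2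
    rw [← h1.1, ← h2.1, hz.1]
  · filter_upwards [key, e₁, e₂] with z hz h1 h2
    rw [← h1.1, ← h2.1, ← h1.2, ← h2.2, ← hz.1]
    rcases hz.2 with h | h
    · simp [h]
    · rw [h]
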